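/- **Language.** The finite types are generated from the type $0$ (natural numbers) by $\sigma,\tau\mapsto(\sigma\to\tau)$; put $1:=0\to0$, $2:=1\to 0$, $3:=2\to0$. The language $\mathsf{L}_\omega$ of higher-order arithmetic is many-sorted, with variables of every finite type, constants $0,1,+,\times$, the combinators $\Pi_{\rho,\tau}$ and $\Sigma_{\delta,\rho,\tau}$, recursors $\mathbf{R}_\sigma$ of type $(\sigma\to\sigma)\to\sigma\to0\to\sigma$, and the atomic formulas $s=_0t$ and $s<_0t$ for terms of type $0$; equality $=_\sigma$ at higher types is defined pointwise. Provability is derivability in classical many-sorted first-order logic. **Systems.** $\mathsf{RCA}_0^\omega$ has the following axioms: the basic axioms saying that $0,1,<_0,+,\times$ form a (discretely) ordered semi-ring with equality $=_0$; $\Pi xy=x$ and $\Sigma xyz=xz(yz)$; $\mathbf{R}_0(f,m,0)=m$ and $\mathbf{R}_0(f,m,n+1)=f(\mathbf{R}_0(f,m,n))$; extensionality $x=_\rho y\to\varphi(x)=_\tau\varphi(y)$ for all types $\rho,\tau$ and $\varphi$ of type $\rho\to\tau$; induction for quantifier-free formulas; and $\mathsf{QF\text{-}AC}^{1,0}$.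 Here $\mathsf{QF\text{-}AC}^{\sigma,\tau}$ is the schema $$(\forall x^\sigma)(\exists y^\tau)A(x,y)\to(\exists Y^{\sigma\to\tau})(\forall x^\sigma)A(x,Y(x)),\qquad A\text{ quantifier-free},$$ and quantifier-free formulas may contain parameters of all types. Finally $\mathsf{WKL}_0^\omega:=\mathsf{RCA}_0^\omega+\mathsf{WKL}$, where $\mathsf{WKL}$ is the sentence "every infinite binary tree has a path". **Sentences.** Let $C$ be the set of $f^1$ with $f(n)\le1$ for all $n$, and let $\overline fN$ be the initial segment $\langle f(0),\dots,f(N-1)\rangle$. A functional $Y^2$ is called continuous if $(\forall f^1)(\exists N^0)(\forall g^1)(\overline fN=\overline gN\to Y(f)=Y(g))$. Define - $(\exists^2)$: $(\exists\varphi^2\le1)(\forall f^1)[(\exists n)(f(n)=0)\leftrightarrow\varphi(f)=0]$; - $(\exists^3)$: $(\exists E^3\le1)(\forall Y^2)[(\exists f^1)(Y(f)=0)\leftrightarrow E(Y)=0]$; - $(\kappa_0^3)$: $(\exists\kappa^3)(\forall Y^2)[\kappa(Y)=0\leftrightarrow(\exists f\in C)(Y(f)>0)]$; - $\mathsf{MUC}$: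 $(\exists\Omega^3)(\forall Y^2)(\forall f,g\in C)(\overline f\,\Omega(Y)=\overline g\,\Omega(Y)\to Y(f)=Y(g))$; - $\mathsf{FF}$: $(\exists\Phi^3)(\forall Y^2\text{ continuous})(\forall f,g\in C)(\overline f\,\Phi(Y)=\overline g\,\Phi(Y)\to Y(f)=Y(g))$. **Theorem.** 1. $\mathsf{RCA}_0^\omega+\mathsf{QF\text{-}AC}^{2,0}$ proves $[(\kappa_0^3)\wedge\mathsf{WKL}]\leftrightarrow[(\exists^3)\vee\mathsf{MUC}]$ and $[(\exists^3)\vee\mathsf{MUC}]\leftrightarrow[(\kappa_0^3)\wedge\mathsf{FF}]$. 2. $\mathsf{RCA}_0^\omega$ proves $\mathsf{FF}\leftrightarrow[(\exists^2)\vee\mathsf{MUC}]$. 3. $\mathsf{WKL}_0^\omega+\mathsf{QF\text{-}AC}^{2,0}$ proves $\mathsf{FF}\leftrightarrow[(\exists^2)\vee(\kappa_0^3)]$. -/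

import Mathlib

namespace HOArith

/-! ## Finite types, terms and formulas of higher-order arithmetic -/

/-- The finite types: `nat` is the type `0`, `arr σ τ` is the type `σ → τ`. -/
inductive Ty : Type
  | nat : Ty
  | arr : Ty → Ty → Ty
  deriving DecidableEq

infixr:80 " ⇒ₜ " => Ty.arr

/-- The pure types: `0` is the type of numbers and `n + 1 ≡ (n → 0)`. -/
def Ty.pure : ℕ → Ty
  | 0 => Ty.nat
  | n + 1 => Ty.pure n ⇒ₜ Ty.nat

/-- The constants, each with its type. `combK` and `combS` are the combinators
usually written `Π` and `Σ`. There is a recursor constant for every type `σ`. -/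
inductive Const : Ty → Type
  | zero : Const Ty.nat
  | one : Const Ty.nat
  | add : Const (Ty.nat ⇒ₜ Ty.nat ⇒ₜ Ty.nat)
  | mul : Const (Ty.nat ⇒ₜ Ty.nat ⇒ₜ Ty.nat)
  | combK (ρ τ : Ty) : Const (ρ ⇒ₜ τ ⇒ₜ ρ)
  | combS (δ ρ τ : Ty) : Const ((δ ⇒ₜ ρ ⇒ₜ τ) ⇒ₜ (δ ⇒ₜ ρ) ⇒ₜ δ ⇒ₜ τ)
  | recursor (σ : Ty) : Const ((σ ⇒ₜ σ) ⇒ₜ σ ⇒ₜ Ty.nat ⇒ₜ σ)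

/-- Well-typed terms. There are infinitely many variables `var σ 0, var σ 1, …` of each type `σ`. -/
inductive Term : Ty → Type
  | var (σ : Ty) (n : ℕ) : Term σ
  | const {σ : Ty} (c : Const σ) : Term σ
  | app {σ τ : Ty} (s : Term (σ ⇒ₜ τ)) (t : Term σ) : Term τ

infixl:90 " ⬝ₜ " => Term.app

/-- Formulas, with classical primitives `⊥`, `→`, `∀`; the atomic formulas are `s =₀ t` and
`s <₀ t`. Bound variables are De Bruijn indices counted separately for every type:
in `all σ φ` the quantifier `∀ x^σ` binds the variable `var σ 0` of `φ`, the variable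
`var σ (n + 1)` of `φ` is the variable `var σ n` outside the quantifier, and variables of types
other than `σ` keep their index. -/
inductive Formula : Type
  | falsum : Formula
  | eq (s t : Term Ty.nat) : Formula
  | lt (s t : Term Ty.nat) : Formula
  | imp (φ ψ : Formula) : Formula
  | all (σ : Ty) (φ : Formula) : Formula

infix:75 " =₀ " => Formula.eq
infix:75 " <₀ " => Formula.lt
infixr:60 " ⟹ " => Formula.imp

/-- Quantifier-free formulas; variables of all types may occur. -/
def Formula.QF : Formula → Prop
  | .falsum => True
  | .eq _ _ => True
  | .lt _ _ => True
  | .imp φ ψ => φ.QF ∧ ψ.QF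
  | .all _ _ => False

def Formula.neg (φ : Formula) : Formula := φ ⟹ .falsum
def Formula.or (φ ψ : Formula) : Formula := φ.neg ⟹ ψ
def Formula.and (φ ψ : Formula) : Formula := (φ ⟹ ψ.neg).neg
def Formula.iff (φ ψ : Formula) : Formula := (φ ⟹ ψ).and (ψ ⟹ φ)
def Formula.ex (σ : Ty) (φ : Formula) : Formula := (Formula.all σ φ.neg).neg

infixr:66 " ⋎ " => Formula.or
infixr:68 " ⋏ " => Formula.and
infix:58 " ⟺ " => Formula.iff

/-! ## Substitution -/

/-- A simultaneous substitution: the term put for each variable. -/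
abbrev Subst : Type := (τ : Ty) → ℕ → Term τ

def Term.subst (s : Subst) : {σ : Ty} → Term σ → Term σ
  | _, .var σ n => s σ n
  | _, .const c => .const c
  | _, .app t u => .app (t.subst s) (u.subst s)

/-- The renaming of variables that makes room for a new variable `var σ 0`. -/
def Subst.shift (σ : Ty) : Subst := fun τ n => .var τ (if τ = σ then n + 1 else n)

def Term.shift (σ : Ty) {τ : Ty} (t : Term τ) : Term τ := t.subst (Subst.shift σ)

/-- The substitution `s` carried under a quantifier over type `σ`. -/
def Subst.lift (σ : Ty) (s : Subst) : Subst := fun τ n =>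
  if τ = σ then
    match n with
    | 0 => .var τ 0
    | n + 1 => (s τ n).shift σ
  else (s τ n).shift σ

/-- The substitution that puts `t` for `var σ 0` and acts as `s` on the remaining variables
(`var σ (n + 1)` is treated as `s` treats `var σ n`). -/
def Subst.cons {σ : Ty} (t : Term σ) (s : Subst) : Subst := fun τ n =>
  if h : τ = σ then
    match n with
    | 0 => h ▸ t
    | n + 1 => s τ n
  else s τ n

def Formula.subst : Subst → Formula → Formula
  | _, .falsum => .falsum
  | s, .eq t u => .eq (t.subst s) (u.subst s)
  | s, .lt t u => .lt (t.subst s) (u.subst s)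
  | s, .imp φ ψ => .imp (φ.subst s) (ψ.subst s)
  | s, .all σ φ => .all σ (φ.subst (s.lift σ))

/-- `φ` moved under a new quantifier over type `σ` that does not bind anything in it. -/
def Formula.shift (σ : Ty) (φ : Formula) : Formula := φ.subst (Subst.shift σ)

/-- The body `φ` of `∀ x^σ φ` with the term `t` put for the bound variable. -/
def Formula.inst {σ : Ty} (t : Term σ) (φ : Formula) : Formula := φ.subst (Subst.cons t Term.var)

/-! ## Provability -/

/-- Classical natural deduction for many-sorted first-order logic: `Derives T Γ φ` means that `φ`
is derivable from the hypotheses `Γ` in the theory with the set `T` of axioms. As usual, free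
variables of axioms are read as universally quantified: they may be generalised by `allI`, unlike
those of the hypotheses. -/
inductive Derives (T : Set Formula) : List Formula → Formula → Prop
  | ax {Γ : List Formula} {φ : Formula} : φ ∈ T → Derives T Γ φ
  | hyp {Γ : List Formula} {φ : Formula} : φ ∈ Γ → Derives T Γ φ
  | impI {Γ : List Formula} {φ ψ : Formula} : Derives T (φ :: Γ) ψ → Derives T Γ (φ ⟹ ψ)
  | impE {Γ : List Formula} {φ ψ : Formula} :
      Derives T Γ (φ ⟹ ψ) → Derives T Γ φ → Derives T Γ ψ
  | raa {Γ : List Formula} {φ : Formula} : Derives T (φ.neg :: Γ) .falsum → Derives T Γ φ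
  | allI {Γ : List Formula} {σ : Ty} {φ : Formula} :
      Derives T (Γ.map (Formula.shift σ)) φ → Derives T Γ (.all σ φ)
  | allE {Γ : List Formula} {σ : Ty} {φ : Formula} (t : Term σ) :
      Derives T Γ (.all σ φ) → Derives T Γ (φ.inst t)

/-- The theory with the set `T` of axioms proves `φ`. -/
def Proves (T : Set Formula) (φ : Formula) : Prop := Derives T [] φ

infix:50 " ⊢ₜ " => Proves

/-! ## Abbreviations -/

def tZero : Term Ty.nat := .const .zero
def tOne : Term Ty.nat := .const .one
def tAdd (s t : Term Ty.nat) : Term Ty.nat := .const .add ⬝ₜ s ⬝ₜ t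
def tMul (s t : Term Ty.nat) : Term Ty.nat := .const .mul ⬝ₜ s ⬝ₜ t

infixl:82 " +₀ " => tAdd
infixl:84 " *₀ " => tMul

def Formula.le (s t : Term Ty.nat) : Formula := s <₀ t ⋎ s =₀ t

infix:75 " ≤₀ " => Formula.le

/-- Equality at all types, defined pointwise from `=₀`. -/
def eqAt : (σ : Ty) → Term σ → Term σ → Formula
  | .nat, s, t => s =₀ t
  | .arr ρ τ, s, t => .all ρ (eqAt τ (s.shift ρ ⬝ₜ .var ρ 0) (t.shift ρ ⬝ₜ .var ρ 0))

/-- The variable number `n` of pure type `k`. -/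
abbrev v (k n : ℕ) : Term (Ty.pure k) := .var (Ty.pure k) n

/-- Variables of type `0`. -/
abbrev num (n : ℕ) : Term Ty.nat := .var Ty.nat n

/-- Application of a term of pure type `k + 1` to one of pure type `k`. -/
def ap {k : ℕ} (s : Term (Ty.pure (k + 1))) (t : Term (Ty.pure k)) : Term Ty.nat :=
  Term.app (σ := Ty.pure k) (τ := Ty.nat) s t

/-- Quantifiers over the pure type `k`. -/
def allP (k : ℕ) (φ : Formula) : Formula := .all (Ty.pure k) φ
def exP (k : ℕ) (φ : Formula) : Formula := .ex (Ty.pure k) φ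

/-! ## The axioms -/

/-- `0, 1, <₀, +₀, ×₀` form a (discretely) ordered commutative semi-ring with equality `=₀`. -/
inductive BasicAxiom : Formula → Prop
  | eq_refl : BasicAxiom (num 0 =₀ num 0)
  | eq_symm : BasicAxiom (num 0 =₀ num 1 ⟹ num 1 =₀ num 0)
  | eq_trans : BasicAxiom (num 0 =₀ num 1 ⟹ num 1 =₀ num 2 ⟹ num 0 =₀ num 2)
  | lt_congr : BasicAxiom
      (num 0 =₀ num 1 ⟹ num 2 =₀ num 3 ⟹ num 0 <₀ num 2 ⟹ num 1 <₀ num 3)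
  | add_assoc : BasicAxiom ((num 0 +₀ num 1) +₀ num 2 =₀ num 0 +₀ (num 1 +₀ num 2))
  | add_comm : BasicAxiom (num 0 +₀ num 1 =₀ num 1 +₀ num 0)
  | add_zero : BasicAxiom (num 0 +₀ tZero =₀ num 0)
  | mul_assoc : BasicAxiom ((num 0 *₀ num 1) *₀ num 2 =₀ num 0 *₀ (num 1 *₀ num 2))
  | mul_comm : BasicAxiom (num 0 *₀ num 1 =₀ num 1 *₀ num 0)
  | mul_one : BasicAxiom (num 0 *₀ tOne =₀ num 0)
  | mul_zero : BasicAxiom (num 0 *₀ tZero =₀ tZero)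
  | mul_add : BasicAxiom
      (num 0 *₀ (num 1 +₀ num 2) =₀ (num 0 *₀ num 1) +₀ (num 0 *₀ num 2))
  | lt_irrefl : BasicAxiom (num 0 <₀ num 0).neg
  | lt_trans : BasicAxiom (num 0 <₀ num 1 ⟹ num 1 <₀ num 2 ⟹ num 0 <₀ num 2)
  | lt_trichotomy : BasicAxiom (num 0 <₀ num 1 ⋎ num 0 =₀ num 1 ⋎ num 1 <₀ num 0)
  | add_lt_add : BasicAxiom (num 0 <₀ num 1 ⟹ num 0 +₀ num 2 <₀ num 1 +₀ num 2)
  | mul_lt_mul : BasicAxiom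
      (num 0 <₀ num 1 ⟹ tZero <₀ num 2 ⟹ num 0 *₀ num 2 <₀ num 1 *₀ num 2)
  | zero_lt_one : BasicAxiom (tZero <₀ tOne)
  | not_lt_zero : BasicAxiom (num 0 <₀ tZero).neg
  | lt_succ : BasicAxiom (num 0 <₀ num 1 +₀ tOne ⟺ num 0 ≤₀ num 1)

/-- The defining axioms `Π x y = x` and `Σ x y z = x z (y z)` of the combinators. -/
inductive CombinatorAxiom : Formula → Prop
  | combK (ρ τ : Ty) (x : Term ρ) (y : Term τ) : CombinatorAxiom
      (eqAt ρ (.const (.combK ρ τ) ⬝ₜ x ⬝ₜ y) x)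
  | combS (δ ρ τ : Ty) (x : Term (δ ⇒ₜ ρ ⇒ₜ τ)) (y : Term (δ ⇒ₜ ρ)) (z : Term δ) : CombinatorAxiom
      (eqAt τ (.const (.combS δ ρ τ) ⬝ₜ x ⬝ₜ y ⬝ₜ z) (x ⬝ₜ z ⬝ₜ (y ⬝ₜ z)))

/-- The defining axioms `R₀(f, m, 0) = m`, `R₀(f, m, n + 1) = f(R₀(f, m, n))` of the recursor
of type `0`. -/
inductive RecursorAxiom : Formula → Prop
  | zero (f : Term (Ty.nat ⇒ₜ Ty.nat)) (m : Term Ty.nat) : RecursorAxiom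
      (.const (.recursor Ty.nat) ⬝ₜ f ⬝ₜ m ⬝ₜ tZero =₀ m)
  | succ (f : Term (Ty.nat ⇒ₜ Ty.nat)) (m n : Term Ty.nat) : RecursorAxiom
      (.const (.recursor Ty.nat) ⬝ₜ f ⬝ₜ m ⬝ₜ (n +₀ tOne) =₀
        f ⬝ₜ (.const (.recursor Ty.nat) ⬝ₜ f ⬝ₜ m ⬝ₜ n))

/-- The axiom of extensionality: `x =_ρ y → φ(x) =_τ φ(y)`. -/
def extAxiom (ρ τ : Ty) (x y : Term ρ) (φ : Term (ρ ⇒ₜ τ)) : Formula :=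
  eqAt ρ x y ⟹ eqAt τ (φ ⬝ₜ x) (φ ⬝ₜ y)

/-- Induction for `A(n)`, where `n` is the variable `var nat 0` of `A`:
`A(0) ∧ ∀ n (A(n) → A(n + 1)) → ∀ n A(n)`. -/
def inductionAxiom (A : Formula) : Formula :=
  A.inst tZero ⋏
      .all Ty.nat (A ⟹ A.subst (Subst.cons (num 0 +₀ tOne) (Subst.shift Ty.nat))) ⟹
    .all Ty.nat A

/-- Choice for `A(x, y)`: `∀ x^σ ∃ y^τ A(x, y) → ∃ Y^{σ → τ} ∀ x^σ A(x, Y(x))`. -/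
def choiceAxiom (σ τ : Ty) (A : Formula) : Formula :=
  .all σ (.ex τ A) ⟹
    .ex (σ ⇒ₜ τ) (.all σ (A.subst
      (Subst.cons (.var (σ ⇒ₜ τ) 0 ⬝ₜ .var σ 0) (Subst.lift σ (Subst.shift (σ ⇒ₜ τ))))))

/-- The schema of quantifier-free choice for the types `σ, τ`. -/
def QFAC (σ τ : Ty) : Set Formula := {φ | ∃ A : Formula, A.QF ∧ φ = choiceAxiom σ τ A}

/-- Kohlenbach's base theory `RCA₀^ω` of higher-order reverse mathematics. -/
def RCA0ω : Set Formula :=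
  {φ | BasicAxiom φ} ∪ {φ | CombinatorAxiom φ} ∪ {φ | RecursorAxiom φ} ∪
  {φ | ∃ (ρ τ : Ty) (x y : Term ρ) (f : Term (ρ ⇒ₜ τ)), φ = extAxiom ρ τ x y f} ∪
  {φ | ∃ A : Formula, A.QF ∧ φ = inductionAxiom A} ∪
  QFAC (Ty.pure 1) (Ty.pure 0)

/-! ## The sentences

In the comments, `0, 1, 2, 3` are the pure types. -/

/-- `f ∈ C`, i.e. `∀ n (f(n) ≤ 1)`. -/
def inCantor (f : Term (Ty.pure 1)) : Formula :=
  allP 0 (ap (f.shift (Ty.pure 0)) (v 0 0) ≤₀ tOne)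

/-- The initial segments of `f` and `g` of length `N` are equal: `∀ i < N (f(i) = g(i))`. -/
def agree (f g : Term (Ty.pure 1)) (N : Term Ty.nat) : Formula :=
  allP 0 (num 0 <₀ N.shift (Ty.pure 0) ⟹
    ap (f.shift (Ty.pure 0)) (v 0 0) =₀ ap (g.shift (Ty.pure 0)) (v 0 0))

/-- `Y` is continuous on Baire space, for `Y` the variable `v 2 0`:
`∀ f ∃ N ∀ g (f and g agree below N → Y(f) = Y(g))`. -/
def isCont : Formula :=
  allP 1 (exP 0 (allP 1 (agree (v 1 1) (v 1 0) (v 0 0) ⟹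
    ap (v 2 0) (v 1 1) =₀ ap (v 2 0) (v 1 0))))

/-- For `Φ` the variable `v 3 0` and `Y` the variable `v 2 0`:
`∀ f g ∈ C (f and g agree below Φ(Y) → Y(f) = Y(g))`. -/
def hasModulus : Formula :=
  allP 1 (allP 1 (inCantor (v 1 1) ⋏ inCantor (v 1 0) ⟹
    agree (v 1 1) (v 1 0) (ap (v 3 0) (v 2 0)) ⟹
      ap (v 2 0) (v 1 1) =₀ ap (v 2 0) (v 1 0)))

/-- `(∃²)`: `∃ φ² ≤ 1 ∀ f¹ (∃ n (f(n) = 0) ↔ φ(f) = 0)`. -/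
def Exists2 : Formula :=
  exP 2 (allP 1 (ap (v 2 0) (v 1 0) ≤₀ tOne) ⋏
    allP 1 (exP 0 (ap (v 1 0) (v 0 0) =₀ tZero) ⟺ ap (v 2 0) (v 1 0) =₀ tZero))

/-- `(∃³)`: `∃ E³ ≤ 1 ∀ Y² (∃ f¹ (Y(f) = 0) ↔ E(Y) = 0)`. -/
def Exists3 : Formula :=
  exP 3 (allP 2 (ap (v 3 0) (v 2 0) ≤₀ tOne) ⋏
    allP 2 (exP 1 (ap (v 2 0) (v 1 0) =₀ tZero) ⟺ ap (v 3 0) (v 2 0) =₀ tZero))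

/-- `(κ₀³)`: `∃ κ³ ∀ Y² (κ(Y) = 0 ↔ ∃ f ∈ C (Y(f) > 0))`. -/
def Kappa0 : Formula :=
  exP 3 (allP 2 (ap (v 3 0) (v 2 0) =₀ tZero ⟺
    exP 1 (inCantor (v 1 0) ⋏ tZero <₀ ap (v 2 0) (v 1 0))))

/-- The intuitionistic fan functional. -/
def MUC : Formula := exP 3 (allP 2 hasModulus)

/-- The classical fan functional. -/
def FF : Formula := exP 3 (allP 2 (isCont ⟹ hasModulus))

/-- Twice the term `t`. -/
def tTwice (t : Term Ty.nat) : Term Ty.nat := (tOne +₀ tOne) *₀ t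

/-- For `T` the variable `v 1 0`: `T` is (the characteristic function of) a binary tree. The finite
binary sequence `⟨b₀, …, bₖ₋₁⟩` is coded by the positive number with binary digits
`1 b₀ … bₖ₋₁`, so `1` codes the empty sequence and if `c` codes `s` then `2c + b` codes the
extension of `s` by `b`; membership of `c` in `T` is `T(c) = 0`. A tree is closed under
initial segments. -/
def isBinaryTree : Formula :=
  allP 0 (tZero <₀ num 0 ⟹
    (ap (v 1 0) (tTwice (num 0)) =₀ tZero ⋎
      ap (v 1 0) (tTwice (num 0) +₀ tOne) =₀ tZero) ⟹
    ap (v 1 0) (num 0) =₀ tZero)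

/-- For `T` the variable `v 1 0`: the tree `T` is infinite, `∀ k ∃ c (k < c ∧ T(c) = 0)`. -/
def isInfiniteTree : Formula :=
  allP 0 (exP 0 (num 1 <₀ num 0 ⋏ ap (v 1 0) (num 0) =₀ tZero))

/-- For `T` the variable `v 1 0`: there is a path `f ∈ C` through `T`, i.e. for all `n` the code
`h(n)` of the initial segment of `f` of length `n` is in `T`. Inside the quantifiers `∃ f ∃ h`,
the variables `v 1 2, v 1 1, v 1 0` are `T, f, h`. -/
def hasPath : Formula :=
  exP 1 (inCantor (v 1 0) ⋏ exP 1 (ap (v 1 0) tZero =₀ tOne ⋏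
    allP 0 (ap (v 1 0) (num 0 +₀ tOne) =₀ tTwice (ap (v 1 0) (num 0)) +₀ ap (v 1 1) (num 0)) ⋏
    allP 0 (ap (v 1 2) (ap (v 1 0) (num 0)) =₀ tZero)))

/-- Weak König's lemma: every infinite binary tree has a path. -/
def WKL : Formula := allP 1 (isBinaryTree ⋏ isInfiniteTree ⟹ hasPath)

/-- `WKL₀^ω`. -/
def WKL0ω : Set Formula := RCA0ω ∪ {WKL}

end HOArith

/-! Derivability is reduced to truth in models. A Henkin construction gives a term model of the
axioms in which a given underivable formula fails. The extensionality axiom says that application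
respects pointwise equality, so one may pass to a quotient in which `=₀` is equality and functions
are determined by their values (`proves_of_forall_extensional`). It remains to verify the
equivalences in extensional models of the base theory. Their numbers may be nonstandard, so
induction, search and choice are available only for predicates whose characteristic function lies in
the model. The predicate `Rep` records this; the combinators make it closed under composition and
abstraction.

The mathematical core is a case distinction on `(∃²)`.

If `(∃²)` fails, every type-two functional is continuous on Baire space: by Grilliot's trick a
discontinuity would compute `(∃²)` (`continuous_of_not_hasExists2`). The continuity premise of `FF`
is then void, so `FF` yields `MUC`. Moreover `(κ₀³)` and `WKL` yield `MUC`: `(κ₀³)` decides the tree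
of those binary nodes above which `Y` takes two values. Without a modulus this tree is infinite, and
`Y` is discontinuous at any path through it (`exists_isModulus`). Being a modulus is also decidable
by `(κ₀³)`, so `QF-AC^{2,0}` selects moduli uniformly in `Y`.

If `(∃²)` holds, arithmetical predicates are decidable. Bisection then shows that a continuous
functional is uniformly continuous on Cantor space, and unbounded search finds a modulus, which
gives `FF` (`HasExists2.hasFF`). Following infinite subtrees gives `WKL`. With `(κ₀³)` one even
obtains `(∃³)`, because elements of Baire space are coded by their graphs in Cantor space
(`HasExists2.hasExists3`).

In the remaining directions, `MUC` reduces quantification over Cantor space to a finite search,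
whence `(κ₀³)`. It also bounds any functional on Cantor space, whence `WKL`: otherwise the level at
which a sequence leaves the tree would be bounded. -/

namespace HOArith

/-! ## Substitution calculus -/

/-- Composition of substitutions: first `s`, then `s'`. -/
def Subst.comp (s s' : Subst) : Subst := fun τ n => (s τ n).subst s'

theorem Term.subst_subst (s s' : Subst) {σ : Ty} (t : Term σ) :
    (t.subst s).subst s' = t.subst (s.comp s') := by
  induction t with
  | var => rfl
  | const => rfl
  | app t u iht ihu => simp only [Term.subst, iht, ihu]

theorem Term.subst_var {σ : Ty} (t : Term σ) : t.subst Term.var = t := by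
  induction t with
  | var => rfl
  | const => rfl
  | app t u iht ihu => simp only [Term.subst, iht, ihu]

theorem Subst.lift_zero (σ : Ty) (s : Subst) : s.lift σ σ 0 = .var σ 0 := by
  simp [Subst.lift]

theorem Subst.lift_succ (σ : Ty) (s : Subst) (n : ℕ) :
    s.lift σ σ (n + 1) = (s σ n).shift σ := by
  simp [Subst.lift]

theorem Subst.lift_of_ne {σ τ : Ty} (h : τ ≠ σ) (s : Subst) (n : ℕ) :
    s.lift σ τ n = (s τ n).shift σ := by
  simp [Subst.lift, h]

theorem Subst.cons_zero {σ : Ty} (t : Term σ) (s : Subst) : Subst.cons t s σ 0 = t := by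
  simp [Subst.cons]

theorem Subst.cons_succ {σ : Ty} (t : Term σ) (s : Subst) (n : ℕ) :
    Subst.cons t s σ (n + 1) = s σ n := by
  simp [Subst.cons]

theorem Subst.cons_of_ne {σ τ : Ty} (h : τ ≠ σ) (t : Term σ) (s : Subst) (n : ℕ) :
    Subst.cons t s τ n = s τ n := by
  simp [Subst.cons, h]

theorem Subst.shift_self (σ : Ty) (n : ℕ) : Subst.shift σ σ n = .var σ (n + 1) := by
  simp [Subst.shift]

theorem Subst.shift_of_ne {σ τ : Ty} (h : τ ≠ σ) (n : ℕ) : Subst.shift σ τ n = .var τ n := by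
  simp [Subst.shift, h]

/-- Case distinction for substitutions, by the variable `var σ 0`, the other variables of type `σ`
and the variables of other types. -/
theorem Subst.ext_cases (σ : Ty) {s s' : Subst} (h0 : s σ 0 = s' σ 0)
    (h1 : ∀ n, s σ (n + 1) = s' σ (n + 1)) (h2 : ∀ τ n, τ ≠ σ → s τ n = s' τ n) : s = s' := by
  funext τ n
  by_cases h : τ = σ
  · subst h
    cases n with
    | zero => exact h0
    | succ n => exact h1 n
  · exact h2 τ n h

theorem Subst.shift_comp_lift (σ : Ty) (s : Subst) :
    (Subst.shift σ).comp (s.lift σ) = s.comp (Subst.shift σ) := by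
  funext τ n
  by_cases h : τ = σ
  · subst h
    simp only [Subst.comp, Subst.shift_self, Term.subst, Subst.lift_succ, Term.shift]
  · simp only [Subst.comp, Subst.shift_of_ne h, Term.subst, Subst.lift_of_ne h, Term.shift]

theorem Term.shift_subst_lift (σ : Ty) {τ : Ty} (s : Subst) (t : Term τ) :
    (t.shift σ).subst (s.lift σ) = (t.subst s).shift σ := by
  simp only [Term.shift, Term.subst_subst, Subst.shift_comp_lift]

theorem Subst.shift_comp_cons {σ : Ty} (t : Term σ) (s : Subst) :
    (Subst.shift σ).comp (Subst.cons t s) = s := by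
  funext τ n
  by_cases h : τ = σ
  · subst h
    simp only [Subst.comp, Subst.shift_self, Term.subst, Subst.cons_succ]
  · simp only [Subst.comp, Subst.shift_of_ne h, Term.subst, Subst.cons_of_ne h]

theorem Subst.lift_comp (σ : Ty) (s s' : Subst) :
    (s.comp s').lift σ = (s.lift σ).comp (s'.lift σ) := by
  apply Subst.ext_cases σ
  · simp only [Subst.comp, Subst.lift_zero, Term.subst]
  · intro n
    rw [Subst.lift_succ, Subst.comp, Subst.comp, Subst.lift_succ, Term.shift_subst_lift]
  · intro τ n h
    rw [Subst.lift_of_ne h, Subst.comp, Subst.comp, Subst.lift_of_ne h, Term.shift_subst_lift]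

theorem Subst.lift_var (σ : Ty) : Subst.lift σ Term.var = Term.var := by
  apply Subst.ext_cases σ
  · rw [Subst.lift_zero]
  · intro n
    rw [Subst.lift_succ, Term.shift, Term.subst, Subst.shift_self]
  · intro τ n h
    rw [Subst.lift_of_ne h, Term.shift, Term.subst, Subst.shift_of_ne h]

theorem Subst.lift_comp_cons {σ : Ty} (t : Term σ) (s s' : Subst) :
    (s.lift σ).comp (Subst.cons t s') = Subst.cons t (s.comp s') := by
  apply Subst.ext_cases σ
  · simp only [Subst.comp, Subst.lift_zero, Subst.cons_zero, Term.subst]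
  · intro n
    simp only [Subst.comp, Subst.lift_succ, Subst.cons_succ, Term.shift, Term.subst_subst,
      Subst.shift_comp_cons]
  · intro τ n h
    simp only [Subst.comp, Subst.lift_of_ne h, Subst.cons_of_ne h, Term.shift, Term.subst_subst,
      Subst.shift_comp_cons]

theorem Subst.cons_comp {σ : Ty} (t : Term σ) (s s' : Subst) :
    (Subst.cons t s).comp s' = Subst.cons (t.subst s') (s.comp s') := by
  apply Subst.ext_cases σ
  · simp only [Subst.comp, Subst.cons_zero]
  · intro n
    simp only [Subst.comp, Subst.cons_succ]
  · intro τ n h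
    simp only [Subst.comp, Subst.cons_of_ne h]

theorem Subst.comp_var (s : Subst) : s.comp Term.var = s := by
  funext τ n
  exact Term.subst_var _

theorem Subst.var_comp (s : Subst) : Subst.comp Term.var s = s := rfl

theorem Formula.subst_subst (φ : Formula) (s s' : Subst) :
    (φ.subst s).subst s' = φ.subst (s.comp s') := by
  induction φ generalizing s s' with
  | falsum => rfl
  | eq => simp only [Formula.subst, Term.subst_subst]
  | lt => simp only [Formula.subst, Term.subst_subst]
  | imp φ ψ ihφ ihψ => simp only [Formula.subst, ihφ, ihψ]
  | all σ φ ih => simp only [Formula.subst, ih, Subst.lift_comp]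

theorem Formula.subst_var (φ : Formula) : φ.subst Term.var = φ := by
  induction φ with
  | falsum => rfl
  | eq => simp only [Formula.subst, Term.subst_var]
  | lt => simp only [Formula.subst, Term.subst_var]
  | imp φ ψ ihφ ihψ => simp only [Formula.subst, ihφ, ihψ]
  | all σ φ ih => simp only [Formula.subst, ih, Subst.lift_var]

theorem Formula.inst_subst {σ : Ty} (t : Term σ) (φ : Formula) (s : Subst) :
    (φ.inst t).subst s = (φ.subst (s.lift σ)).inst (t.subst s) := by
  simp only [Formula.inst, Formula.subst_subst, Subst.lift_comp_cons, Subst.cons_comp,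
    Subst.comp_var, Subst.var_comp]

theorem Formula.subst_lift_inst {σ : Ty} (t : Term σ) (φ : Formula) (s : Subst) :
    (φ.subst (s.lift σ)).inst t = φ.subst (Subst.cons t s) := by
  simp only [Formula.inst, Formula.subst_subst, Subst.lift_comp_cons, Subst.comp_var]

theorem Formula.shift_subst_lift (σ : Ty) (s : Subst) (φ : Formula) :
    (φ.shift σ).subst (s.lift σ) = (φ.subst s).shift σ := by
  simp only [Formula.shift, Formula.subst_subst, Subst.shift_comp_lift]

/-! ## Variables of terms and formulas -/

/-- A number above the indices of all variables. -/
def Term.bound : {σ : Ty} → Term σ → ℕ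
  | _, .var _ n => n + 1
  | _, .const _ => 0
  | _, .app t u => max t.bound u.bound

/-- The types of the variables. -/
def Term.varTypes : {σ : Ty} → Term σ → List Ty
  | _, .var σ _ => [σ]
  | _, .const _ => []
  | _, .app t u => t.varTypes ++ u.varTypes

/-- A number above the indices of all variables, free or bound. -/
def Formula.bound : Formula → ℕ
  | .falsum => 0
  | .eq t u => max t.bound u.bound
  | .lt t u => max t.bound u.bound
  | .imp φ ψ => max φ.bound ψ.bound
  | .all _ φ => φ.bound

/-- The types of the variables, free or bound. -/
def Formula.varTypes : Formula → List Ty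
  | .falsum => []
  | .eq t u => t.varTypes ++ u.varTypes
  | .lt t u => t.varTypes ++ u.varTypes
  | .imp φ ψ => φ.varTypes ++ ψ.varTypes
  | .all _ φ => φ.varTypes

theorem Term.subst_congr {s s' : Subst} {σ : Ty} (t : Term σ)
    (h : ∀ τ ∈ t.varTypes, ∀ n < t.bound, s τ n = s' τ n) : t.subst s = t.subst s' := by
  induction t with
  | var σ n => exact h σ (by simp [Term.varTypes]) n (by simp [Term.bound])
  | const => rfl
  | app t u iht ihu =>
    simp only [Term.varTypes, List.mem_append, Term.bound, lt_max_iff] at h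
    rw [Term.subst, Term.subst, iht fun τ hτ n hn => h τ (.inl hτ) n (.inl hn),
      ihu fun τ hτ n hn => h τ (.inr hτ) n (.inr hn)]

theorem Formula.subst_congr {s s' : Subst} (φ : Formula)
    (h : ∀ τ ∈ φ.varTypes, ∀ n < φ.bound, s τ n = s' τ n) : φ.subst s = φ.subst s' := by
  induction φ generalizing s s' with
  | falsum => rfl
  | eq t u =>
    simp only [Formula.varTypes, List.mem_append, Formula.bound, lt_max_iff] at h
    rw [Formula.subst, Formula.subst, t.subst_congr fun τ hτ n hn => h τ (.inl hτ) n (.inl hn),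
      u.subst_congr fun τ hτ n hn => h τ (.inr hτ) n (.inr hn)]
  | lt t u =>
    simp only [Formula.varTypes, List.mem_append, Formula.bound, lt_max_iff] at h
    rw [Formula.subst, Formula.subst, t.subst_congr fun τ hτ n hn => h τ (.inl hτ) n (.inl hn),
      u.subst_congr fun τ hτ n hn => h τ (.inr hτ) n (.inr hn)]
  | imp φ ψ ihφ ihψ =>
    simp only [Formula.varTypes, List.mem_append, Formula.bound, lt_max_iff] at h
    rw [Formula.subst, Formula.subst, ihφ fun τ hτ n hn => h τ (.inl hτ) n (.inl hn),
      ihψ fun τ hτ n hn => h τ (.inr hτ) n (.inr hn)]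
  | all σ φ ih =>
    simp only [Formula.varTypes, Formula.bound] at h
    rw [Formula.subst, Formula.subst, ih]
    intro τ hτ n hn
    by_cases e : τ = σ
    · subst e
      cases n with
      | zero => rw [Subst.lift_zero, Subst.lift_zero]
      | succ n => rw [Subst.lift_succ, Subst.lift_succ, h τ hτ n (by omega)]
    · rw [Subst.lift_of_ne e, Subst.lift_of_ne e, h τ hτ n hn]

/-- Quantification over a list of types, the head of the list outermost. -/
def Formula.alls (l : List Ty) (φ : Formula) : Formula := l.foldr Formula.all φ

/-- A substitution carried under several quantifiers. -/
def Subst.lifts (l : List Ty) (s : Subst) : Subst := l.foldl (fun s σ => s.lift σ) s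

theorem Formula.alls_subst (l : List Ty) (φ : Formula) (s : Subst) :
    (φ.alls l).subst s = (φ.subst (s.lifts l)).alls l := by
  induction l generalizing s with
  | nil => rfl
  | cons σ l ih =>
    change Formula.all σ ((φ.alls l).subst (s.lift σ)) = _
    rw [ih]
    rfl

/-- Every quantifier over `τ` protects one more variable of type `τ` from the substitution, so the
number of protected variables grows by the multiplicity of `τ` in the prefix. -/
theorem Subst.lifts_eq_var (l : List Ty) (s : Subst) (c : Ty → ℕ)
    (hs : ∀ τ, ∀ n < c τ, s τ n = .var τ n) :
    ∀ τ, ∀ n < c τ + l.count τ, s.lifts l τ n = .var τ n := by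
  induction l generalizing s c with
  | nil => simpa [Subst.lifts] using hs
  | cons σ l ih =>
    intro τ n hn
    refine ih (s.lift σ) (fun τ => c τ + if τ = σ then 1 else 0) ?_ τ n ?_
    · intro τ n hn
      by_cases e : τ = σ
      · subst e
        cases n with
        | zero => rw [Subst.lift_zero]
        | succ n =>
          rw [Subst.lift_succ, hs τ n (by simpa using hn), Term.shift, Term.subst,
            Subst.shift_self]
      · rw [Subst.lift_of_ne e, hs τ n (by simpa [e] using hn), Term.shift, Term.subst,
          Subst.shift_of_ne e]
    · rw [List.count_cons] at hn
      by_cases e : τ = σ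
      · subst e
        simp only [beq_self_eq_true, if_true] at hn ⊢
        omega
      · have : (σ == τ) = false := by simpa using fun h => e h.symm
        simp only [this, e, if_false] at hn ⊢
        simpa using hn

/-- For each type occurring in the formula, as many quantifiers as the bound on the indices capture
all free variables. -/
theorem Formula.exists_alls_closed (φ : Formula) :
    ∃ l : List Ty, ∀ s, (φ.alls l).subst s = φ.alls l := by
  refine ⟨φ.varTypes.flatMap fun σ => List.replicate φ.bound σ, fun s => ?_⟩
  rw [Formula.alls_subst]
  congr 1
  conv_rhs => rw [← φ.subst_var]
  refine φ.subst_congr fun τ hτ n hn => Subst.lifts_eq_var _ s (fun _ => 0) (by simp) τ n ?_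
  rw [zero_add]
  refine hn.trans_le ?_
  obtain ⟨l₁, l₂, h⟩ := List.append_of_mem hτ
  rw [h, List.flatMap_append, List.flatMap_cons]
  simp only [List.count_append, List.count_replicate_self]
  omega

/-! ## Admissible rules -/

variable {T : Set Formula} {Γ Δ : List Formula} {φ ψ : Formula}

theorem Derives.weaken (h : Derives T Γ φ) (hs : Γ ⊆ Δ) : Derives T Δ φ := by
  induction h generalizing Δ with
  | ax h => exact .ax h
  | hyp h => exact .hyp (hs h)
  | impI _ ih => exact .impI (ih (List.cons_subset_cons _ hs))
  | impE _ _ ih₁ ih₂ => exact .impE (ih₁ hs) (ih₂ hs)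
  | raa _ ih => exact .raa (ih (List.cons_subset_cons _ hs))
  | allI _ ih => exact .allI (ih (List.map_subset _ hs))
  | allE t _ ih => exact .allE t (ih hs)

theorem Derives.alls (h : Derives T [] φ) (l : List Ty) : Derives T [] (φ.alls l) := by
  induction l with
  | nil => exact h
  | cons σ l ih => exact .allI ih

theorem Derives.of_alls_subst (l : List Ty) (h : ∀ s, Derives T [] ((φ.alls l).subst s)) :
    ∀ s, Derives T [] (φ.subst s) := by
  induction l with
  | nil => exact h
  | cons σ l ih =>
    refine ih fun s => ?_
    have e : s = Subst.cons (s σ 0) (fun τ n => if τ = σ then s τ (n + 1) else s τ n) := by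
      apply Subst.ext_cases σ
      · rw [Subst.cons_zero]
      · intro n
        rw [Subst.cons_succ, if_pos rfl]
      · intro τ n h
        rw [Subst.cons_of_ne h, if_neg h]
    rw [e, ← Formula.subst_lift_inst]
    exact .allE _ (h _)

/-- The axioms need not be closed under substitution. Since their free variables may be generalised,
one passes to a closed formula, on which the substitution does nothing, and instantiates the
quantifiers again. -/
theorem Derives.subst_nil (h : Derives T [] φ) (s : Subst) : Derives T [] (φ.subst s) := by
  obtain ⟨l, hl⟩ := φ.exists_alls_closed
  exact Derives.of_alls_subst l (fun s => by rw [hl]; exact h.alls l) s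

theorem Derives.subst (h : Derives T Γ φ) (s : Subst) :
    Derives T (Γ.map (Formula.subst s)) (φ.subst s) := by
  induction h generalizing s with
  | ax h => exact (Derives.subst_nil (.ax h) s).weaken (List.nil_subset _)
  | hyp h => exact .hyp (List.mem_map_of_mem h)
  | impI _ ih => exact .impI (ih s)
  | impE _ _ ih₁ ih₂ => exact .impE (ih₁ s) (ih₂ s)
  | raa _ ih => exact .raa (ih s)
  | @allI Γ σ φ _ ih =>
    refine .allI ?_
    have := ih (s.lift σ)
    rw [List.map_map] at this ⊢
    convert this using 2
    funext ψ
    exact (Formula.shift_subst_lift σ s ψ).symm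
  | allE t _ ih =>
    rw [Formula.inst_subst]
    exact .allE _ (ih s)

/-- Generalisation over a variable that does not occur elsewhere. -/
theorem Derives.generalize {σ : Ty} {m : ℕ} (hΓ : ∀ ψ ∈ Γ, ψ.bound ≤ m) (hφ : φ.bound ≤ m)
    (h : Derives T Γ (φ.inst (.var σ m))) : Derives T Γ (.all σ φ) := by
  refine .allI ?_
  -- The eigenvariable becomes the newly bound variable and all other variables of type `σ` move up;
  -- on the hypotheses, where the eigenvariable is absent, this is the shift.
  let s : Subst := fun τ n =>
    if τ = σ then (if n = m then .var τ 0 else .var τ (n + 1)) else .var τ n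
  have := h.subst s
  convert this using 1
  · refine List.map_congr_left fun ψ hψ => ψ.subst_congr fun τ _ n hn => ?_
    have : n ≠ m := by have := hΓ ψ hψ; omega
    by_cases e : τ = σ
    · simp [s, e, this, Subst.shift]
    · simp [s, e, Subst.shift]
  · rw [Formula.inst, Formula.subst_subst, Subst.cons_comp]
    conv_lhs => rw [← φ.subst_var]
    refine φ.subst_congr fun τ _ n hn => ?_
    by_cases e : τ = σ
    · subst e
      cases n with
      | zero => simp [Subst.cons_zero, Term.subst, s]
      | succ n =>
        have : n ≠ m := by omega
        simp [Subst.cons_succ, Subst.var_comp, s, this]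
    · simp [Subst.cons_of_ne e, Subst.var_comp, s, e]


/-! ## The language is countable -/

instance : Countable Ty := by
  let d : Ty → ℕ := fun σ => Ty.rec (motive := fun _ => ℕ) 0 (fun _ _ a b => max a b + 1) σ
  have h : ∀ n, {σ : Ty | d σ ≤ n}.Countable := by
    intro n
    induction n with
    | zero =>
      refine (Set.countable_singleton Ty.nat).mono ?_
      rintro (_ | ⟨σ, τ⟩) hσ
      · rfl
      · exact absurd hσ (by simp [d])
    | succ n ih =>
      refine ((Set.countable_singleton Ty.nat).union (ih.image2 ih Ty.arr)).mono ?_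
      rintro (_ | ⟨σ, τ⟩) hσ
      · exact .inl rfl
      · have : max (d σ) (d τ) ≤ n := Nat.le_of_succ_le_succ hσ
        exact .inr ⟨σ, (le_max_left _ _).trans this, τ, (le_max_right _ _).trans this, rfl⟩
  rw [← Set.countable_univ_iff]
  refine (Set.countable_iUnion h).mono fun σ _ => ?_
  exact Set.mem_iUnion.2 ⟨d σ, le_refl (d σ)⟩

instance : Countable (Σ σ, Const σ) := by
  let f : (ℕ × Ty × Ty × Ty) → Σ σ, Const σ := fun p =>
    match p with
    | (0, _, _, _) => ⟨_, .zero⟩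
    | (1, _, _, _) => ⟨_, .one⟩
    | (2, _, _, _) => ⟨_, .add⟩
    | (3, _, _, _) => ⟨_, .mul⟩
    | (4, ρ, τ, _) => ⟨_, .combK ρ τ⟩
    | (5, δ, ρ, τ) => ⟨_, .combS δ ρ τ⟩
    | (_, σ, _, _) => ⟨_, .recursor σ⟩
  refine Function.Surjective.countable (f := f) ?_
  rintro ⟨_, _ | _ | _ | _ | ⟨ρ, τ⟩ | ⟨δ, ρ, τ⟩ | σ⟩
  · exact ⟨(0, .nat, .nat, .nat), rfl⟩
  · exact ⟨(1, .nat, .nat, .nat), rfl⟩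
  · exact ⟨(2, .nat, .nat, .nat), rfl⟩
  · exact ⟨(3, .nat, .nat, .nat), rfl⟩
  · exact ⟨(4, ρ, τ, .nat), rfl⟩
  · exact ⟨(5, δ, ρ, τ), rfl⟩
  · exact ⟨(6, σ, .nat, .nat), rfl⟩

def Term.depth : {σ : Ty} → Term σ → ℕ
  | _, .var _ _ => 0
  | _, .const _ => 0
  | _, .app t u => max t.depth u.depth + 1

theorem Term.countable_depth_le (n : ℕ) : ∀ σ, {t : Term σ | t.depth ≤ n}.Countable := by
  have base : ∀ σ, (Set.range (Term.var σ) ∪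
      {t : Term σ | ∃ c : Const σ, t = .const c}).Countable := by
    intro σ
    refine (Set.countable_range _).union ?_
    have : Countable (Const σ) :=
      Function.Injective.countable (f := fun c : Const σ => (⟨σ, c⟩ : Σ σ, Const σ))
        fun _ _ h => by simpa using h
    refine (Set.countable_range (fun c : Const σ => Term.const c)).mono ?_
    rintro _ ⟨c, rfl⟩
    exact ⟨c, rfl⟩
  induction n with
  | zero =>
    refine fun σ => (base σ).mono ?_
    rintro (⟨_, n⟩ | c | ⟨t, u⟩) ht
    · exact .inl ⟨n, rfl⟩
    · exact .inr ⟨c, rfl⟩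
    · exact absurd ht (by simp [Term.depth])
  | succ n ih =>
    intro σ
    refine ((base σ).union (Set.countable_iUnion fun τ : Ty =>
      (ih (τ ⇒ₜ σ)).image2 (ih τ) Term.app)).mono ?_
    rintro (⟨_, n⟩ | c | ⟨t, u⟩) ht
    · exact .inl (.inl ⟨n, rfl⟩)
    · exact .inl (.inr ⟨c, rfl⟩)
    · have : max t.depth u.depth ≤ n := Nat.le_of_succ_le_succ ht
      exact .inr (Set.mem_iUnion.2
        ⟨_, t, (le_max_left _ _).trans this, u, (le_max_right _ _).trans this, rfl⟩)

instance (σ : Ty) : Countable (Term σ) := by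
  rw [← Set.countable_univ_iff]
  refine (Set.countable_iUnion fun n => Term.countable_depth_le n σ).mono fun t _ => ?_
  exact Set.mem_iUnion.2 ⟨t.depth, le_refl t.depth⟩

def Formula.depth : Formula → ℕ
  | .falsum => 0
  | .eq _ _ => 0
  | .lt _ _ => 0
  | .imp φ ψ => max φ.depth ψ.depth + 1
  | .all _ φ => φ.depth + 1

theorem Formula.countable_depth_le (n : ℕ) : {φ : Formula | φ.depth ≤ n}.Countable := by
  have base : ({Formula.falsum} ∪ Set.range (fun p : Term .nat × Term .nat => p.1 =₀ p.2) ∪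
      Set.range (fun p : Term .nat × Term .nat => p.1 <₀ p.2)).Countable :=
    ((Set.countable_singleton _).union (Set.countable_range _)).union (Set.countable_range _)
  induction n with
  | zero =>
    refine base.mono ?_
    rintro (_ | ⟨s, t⟩ | ⟨s, t⟩ | ⟨φ, ψ⟩ | ⟨σ, φ⟩) h
    · exact .inl (.inl rfl)
    · exact .inl (.inr ⟨(s, t), rfl⟩)
    · exact .inr ⟨(s, t), rfl⟩
    · exact absurd h (by simp [Formula.depth])
    · exact absurd h (by simp [Formula.depth])
  | succ n ih =>
    refine ((base.union (ih.image2 ih Formula.imp)).union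
      (Set.countable_iUnion fun σ : Ty => ih.image (Formula.all σ))).mono ?_
    rintro (_ | ⟨s, t⟩ | ⟨s, t⟩ | ⟨φ, ψ⟩ | ⟨σ, φ⟩) h
    · exact .inl (.inl (.inl (.inl rfl)))
    · exact .inl (.inl (.inl (.inr ⟨(s, t), rfl⟩)))
    · exact .inl (.inl (.inr ⟨(s, t), rfl⟩))
    · have : max φ.depth ψ.depth ≤ n := Nat.le_of_succ_le_succ h
      exact .inl (.inr ⟨φ, (le_max_left _ _).trans this, ψ, (le_max_right _ _).trans this, rfl⟩)
    · exact .inr (Set.mem_iUnion.2 ⟨σ, φ, Nat.le_of_succ_le_succ h, rfl⟩)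

/-- Countability lets the Henkin construction treat one formula per stage. Every stage is a finite
list, so an unused variable remains available as a witness and no new constants are needed. -/
instance : Countable Formula := by
  rw [← Set.countable_univ_iff]
  refine (Set.countable_iUnion Formula.countable_depth_le).mono fun t _ => ?_
  exact Set.mem_iUnion.2 ⟨t.depth, le_refl t.depth⟩

/-! ## Henkin sets -/

section
variable {T : Set Formula} {Γ : List Formula} {φ ψ θ : Formula}

theorem Derives.exfalso (h : Derives T Γ .falsum) : Derives T Γ φ :=
  .raa (h.weaken (List.subset_cons_self _ _))

theorem exists_bound_le (Γ : List Formula) : ∃ m, ∀ ψ ∈ Γ, ψ.bound ≤ m := by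
  induction Γ with
  | nil => exact ⟨0, by simp⟩
  | cons φ Γ ih =>
    obtain ⟨m, hm⟩ := ih
    refine ⟨max φ.bound m, fun ψ hψ => ?_⟩
    rcases List.mem_cons.1 hψ with rfl | h
    · exact le_max_left _ _
    · exact (hm ψ h).trans (le_max_right _ _)

/-- One step of the construction of a Henkin set: `θ` is decided, with a witness if it is a false
universal formula. -/
theorem exists_henkin_step (hΓ : ¬ Derives T Γ .falsum) (θ : Formula) :
    ∃ Δ, Γ ⊆ Δ ∧ ¬ Derives T Δ .falsum ∧ (θ ∈ Δ ∨ (θ.neg ∈ Δ ∧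
      ∀ σ φ, θ = .all σ φ → ∃ t : Term σ, (φ.inst t).neg ∈ Δ)) := by
  by_cases h : Derives T (θ :: Γ) .falsum
  · have hn : Derives T Γ θ.neg := .impI h
    have h1 : ¬ Derives T (θ.neg :: Γ) .falsum := fun h' => hΓ (.impE (.impI h') hn)
    by_cases hq : ∃ σ φ, θ = .all σ φ
    · obtain ⟨σ, φ, rfl⟩ := hq
      -- The variable number `m` occurs in none of these formulas. If the instance at it could not
      -- be refuted consistently, it would be derivable, and generalisation would contradict the
      -- negated universal formula.
      obtain ⟨m, hm⟩ := exists_bound_le (φ :: (Formula.all σ φ).neg :: Γ)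
      refine ⟨(φ.inst (.var σ m)).neg :: (Formula.all σ φ).neg :: Γ,
        fun ψ hψ => List.mem_cons_of_mem _ (List.mem_cons_of_mem _ hψ), fun h' => h1 ?_,
        .inr ⟨by simp, ?_⟩⟩
      · refine .impE (.hyp (List.mem_cons_self)) (Derives.generalize (m := m)
          (fun ψ hψ => hm ψ (List.mem_cons_of_mem _ hψ)) (hm φ List.mem_cons_self) (.raa h'))
      · rintro _ _ ⟨⟩
        exact ⟨_, List.mem_cons_self⟩
    · refine ⟨θ.neg :: Γ, List.subset_cons_self _ _, h1, .inr ⟨List.mem_cons_self, ?_⟩⟩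
      exact fun σ φ e => absurd ⟨σ, φ, e⟩ hq
  · exact ⟨θ :: Γ, List.subset_cons_self _ _, h, .inl List.mem_cons_self⟩

/-- The truth set of a term model. -/
structure HenkinSet (T : Set Formula) (S : Set Formula) : Prop where
  of_derives {φ : Formula} : Derives T [] φ → φ ∈ S
  falsum : Formula.falsum ∉ S
  imp {φ ψ : Formula} : (φ ⟹ ψ) ∈ S ↔ (φ ∈ S → ψ ∈ S)
  all {σ : Ty} {φ : Formula} : Formula.all σ φ ∈ S ↔ ∀ t : Term σ, φ.inst t ∈ S

/-- The set is the union of the consistent stages. Finitely many of its members lie in a common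
stage, so it is consistent; it decides every formula, hence is deductively closed. The witnesses
added along the way give the clause for quantifiers. -/
theorem exists_henkinSet (h : ¬ Derives T [] φ) : ∃ S, HenkinSet T S ∧ φ ∉ S := by
  classical
  have h0 : ¬ Derives T [φ.neg] .falsum := fun h' => h (.raa h')
  have : Nonempty Formula := ⟨φ⟩
  obtain ⟨e, he⟩ := exists_surjective_nat Formula
  let step : {Γ // ¬ Derives T Γ .falsum} → ℕ → {Γ // ¬ Derives T Γ .falsum} := fun Γ n =>
    ⟨Classical.choose (exists_henkin_step Γ.2 (e n)),
      (Classical.choose_spec (exists_henkin_step Γ.2 (e n))).2.1⟩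
  have hstep : ∀ Γ n, Γ.1 ⊆ (step Γ n).1 ∧ (e n ∈ (step Γ n).1 ∨ ((e n).neg ∈ (step Γ n).1 ∧
      ∀ σ φ, e n = .all σ φ → ∃ t : Term σ, (φ.inst t).neg ∈ (step Γ n).1)) := fun Γ n =>
    let h := Classical.choose_spec (exists_henkin_step Γ.2 (e n))
    ⟨h.1, h.2.2⟩
  let G : ℕ → {Γ // ¬ Derives T Γ .falsum} := fun n => Nat.rec ⟨_, h0⟩ (fun n Γ => step Γ n) n
  have hG : ∀ n, G (n + 1) = step (G n) n := fun n => rfl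
  have mono : ∀ m n, m ≤ n → (G m).1 ⊆ (G n).1 := by
    intro m n hmn
    induction hmn with
    | refl => exact List.Subset.refl _
    | step _ ih => exact List.Subset.trans ih (hG _ ▸ (hstep _ _).1)
  let S : Set Formula := {ψ | ∃ n, ψ ∈ (G n).1}
  have dec : ∀ ψ, ψ ∈ S ∨ (ψ.neg ∈ S ∧
      ∀ σ φ, ψ = .all σ φ → ∃ t : Term σ, (φ.inst t).neg ∈ S) := by
    intro ψ
    obtain ⟨n, rfl⟩ := he ψ
    rcases (hstep (G n) n).2 with h | ⟨h, h'⟩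
    · exact .inl ⟨n + 1, hG n ▸ h⟩
    · refine .inr ⟨⟨n + 1, hG n ▸ h⟩, fun σ φ e => ?_⟩
      obtain ⟨t, ht⟩ := h' σ φ e
      exact ⟨t, n + 1, hG n ▸ ht⟩
  have fin : ∀ Δ : List Formula, (∀ ψ ∈ Δ, ψ ∈ S) → ∃ n, Δ ⊆ (G n).1 := by
    intro Δ
    induction Δ with
    | nil => exact fun _ => ⟨0, List.nil_subset _⟩
    | cons ψ Δ ih =>
      intro h
      obtain ⟨n, hn⟩ := ih fun ψ hψ => h ψ (List.mem_cons_of_mem _ hψ)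
      obtain ⟨m, hm⟩ := h ψ List.mem_cons_self
      exact ⟨max m n, List.cons_subset.2 ⟨mono _ _ (le_max_left _ _) hm,
        List.Subset.trans hn (mono _ _ (le_max_right _ _))⟩⟩
  have con : ∀ Δ : List Formula, (∀ ψ ∈ Δ, ψ ∈ S) → ¬ Derives T Δ .falsum := by
    intro Δ h hd
    obtain ⟨n, hn⟩ := fin Δ h
    exact (G n).2 (hd.weaken hn)
  have ded : ∀ (Δ : List Formula) ψ, (∀ ψ ∈ Δ, ψ ∈ S) → Derives T Δ ψ → ψ ∈ S := by
    intro Δ ψ h hd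
    rcases dec ψ with h' | ⟨h', _⟩
    · exact h'
    · refine absurd (Derives.impE (.hyp List.mem_cons_self)
        (hd.weaken (List.subset_cons_self _ _))) (con (ψ.neg :: Δ) ?_)
      intro θ hθ
      rcases List.mem_cons.1 hθ with rfl | hθ
      · exact h'
      · exact h θ hθ
  have cons : ∀ ψ, ψ.neg ∈ S → ψ ∉ S := fun ψ h h' =>
    con [ψ.neg, ψ] (by simp [h, h']) (.impE (φ := ψ) (.hyp (by simp [Formula.neg])) (.hyp (by simp)))
  refine ⟨S, ⟨fun h => ded [] _ (by simp) h, ?_, ?_, ?_⟩, cons φ ⟨0, List.mem_cons_self⟩⟩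
  · exact fun h => con [.falsum] (by simpa using h) (.hyp (by simp))
  · intro φ ψ
    refine ⟨fun h h' => ded [φ ⟹ ψ, φ] _ (by simp [h, h'])
      (.impE (φ := φ) (.hyp (by simp)) (.hyp (by simp))), fun h => ?_⟩
    rcases dec φ with h' | ⟨h', _⟩
    · exact ded [ψ] _ (by simpa using h h') (.impI (.hyp (by simp)))
    · exact ded [φ.neg] _ (by simpa using h')
        (.impI (Derives.exfalso (.impE (φ := φ) (.hyp (by simp [Formula.neg])) (.hyp (by simp)))))
  · intro σ φ
    refine ⟨fun h t => ded [.all σ φ] _ (by simpa using h) (.allE t (.hyp (by simp))),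
      fun h => ?_⟩
    rcases dec (.all σ φ) with h' | ⟨_, h'⟩
    · exact h'
    · obtain ⟨t, ht⟩ := h' σ φ rfl
      exact absurd (h t) (cons _ ht)

end

/-! ## Structures and satisfaction -/

/-- Structures for the language; `=₀` is interpreted by the relation `eq`. -/
structure Interp where
  D : Ty → Type
  app : {σ τ : Ty} → D (σ ⇒ₜ τ) → D σ → D τ
  const : {σ : Ty} → Const σ → D σ
  eq : D .nat → D .nat → Prop
  lt : D .nat → D .nat → Prop

namespace Interp

variable (M : Interp)

/-- Assignments of values to the variables. -/
abbrev Env : Type := (τ : Ty) → ℕ → M.D τ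

variable {M}

def Env.cons {σ : Ty} (x : M.D σ) (ρ : M.Env) : M.Env := fun τ n =>
  if h : τ = σ then
    match n with
    | 0 => h ▸ x
    | n + 1 => ρ τ n
  else ρ τ n

theorem Env.cons_zero {σ : Ty} (x : M.D σ) (ρ : M.Env) : ρ.cons x σ 0 = x := by
  simp [Env.cons]

theorem Env.cons_succ {σ : Ty} (x : M.D σ) (ρ : M.Env) (n : ℕ) :
    ρ.cons x σ (n + 1) = ρ σ n := by
  simp [Env.cons]

theorem Env.cons_of_ne {σ τ : Ty} (h : τ ≠ σ) (x : M.D σ) (ρ : M.Env) (n : ℕ) :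
    ρ.cons x τ n = ρ τ n := by
  simp [Env.cons, h]

theorem Env.ext_cases (σ : Ty) {ρ ρ' : M.Env} (h0 : ρ σ 0 = ρ' σ 0)
    (h1 : ∀ n, ρ σ (n + 1) = ρ' σ (n + 1)) (h2 : ∀ τ n, τ ≠ σ → ρ τ n = ρ' τ n) : ρ = ρ' := by
  funext τ n
  by_cases h : τ = σ
  · subst h
    cases n with
    | zero => exact h0
    | succ n => exact h1 n
  · exact h2 τ n h

def eval (ρ : M.Env) : {σ : Ty} → Term σ → M.D σ
  | _, .var σ n => ρ σ n
  | _, .const c => M.const c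
  | _, .app t u => M.app (eval ρ t) (eval ρ u)

def sat : M.Env → Formula → Prop
  | _, .falsum => False
  | ρ, .eq t u => M.eq (eval ρ t) (eval ρ u)
  | ρ, .lt t u => M.lt (eval ρ t) (eval ρ u)
  | ρ, .imp φ ψ => sat ρ φ → sat ρ ψ
  | ρ, .all σ φ => ∀ x : M.D σ, sat (ρ.cons x) φ

theorem eval_subst (ρ : M.Env) (s : Subst) {σ : Ty} (t : Term σ) :
    eval ρ (t.subst s) = eval (fun τ n => eval ρ (s τ n)) t := by
  induction t with
  | var => rfl
  | const => rfl
  | app t u iht ihu => simp only [Term.subst, eval, iht, ihu]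

theorem eval_shift {σ τ : Ty} (x : M.D σ) (ρ : M.Env) (t : Term τ) :
    eval (ρ.cons x) (t.shift σ) = eval ρ t := by
  rw [Term.shift, eval_subst]
  congr 1
  funext τ n
  by_cases h : τ = σ
  · subst h
    rw [Subst.shift_self, eval, Env.cons_succ]
  · rw [Subst.shift_of_ne h, eval, Env.cons_of_ne h]

theorem sat_subst (ρ : M.Env) (s : Subst) (φ : Formula) :
    sat ρ (φ.subst s) ↔ sat (fun τ n => eval ρ (s τ n)) φ := by
  induction φ generalizing ρ s with
  | falsum => rfl
  | eq => simp only [Formula.subst, sat, eval_subst]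
  | lt => simp only [Formula.subst, sat, eval_subst]
  | imp φ ψ ihφ ihψ => simp only [Formula.subst, sat, ihφ, ihψ]
  | all σ φ ih =>
    simp only [Formula.subst, sat, ih]
    refine forall_congr' fun x => ?_
    have : (fun τ n => eval (ρ.cons x) (s.lift σ τ n)) =
        Env.cons x (fun τ n => eval ρ (s τ n)) := by
      apply Env.ext_cases σ
      · rw [Subst.lift_zero, Env.cons_zero, eval, Env.cons_zero]
      · intro n
        rw [Subst.lift_succ, Env.cons_succ, eval_shift]
      · intro τ n h
        rw [Subst.lift_of_ne h, Env.cons_of_ne h, eval_shift]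
    rw [this]

theorem eval_cons {σ : Ty} (ρ : M.Env) (t : Term σ) (s : Subst) :
    (fun τ n => eval ρ (Subst.cons t s τ n)) = Env.cons (eval ρ t) (fun τ n => eval ρ (s τ n)) := by
  apply Env.ext_cases σ
  · rw [Subst.cons_zero, Env.cons_zero]
  · intro n
    rw [Subst.cons_succ, Env.cons_succ]
  · intro τ n h
    rw [Subst.cons_of_ne h, Env.cons_of_ne h]

theorem eval_var (ρ : M.Env) : (fun τ n => eval ρ (Term.var τ n)) = ρ := rfl

theorem eval_subst_shift {σ : Ty} (x : M.D σ) (ρ : M.Env) :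
    (fun τ n => eval (ρ.cons x) (Subst.shift σ τ n)) = ρ := by
  funext τ n
  exact eval_shift x ρ (Term.var τ n)

theorem sat_inst {σ : Ty} (ρ : M.Env) (t : Term σ) (φ : Formula) :
    sat ρ (φ.inst t) ↔ sat (ρ.cons (eval ρ t)) φ := by
  rw [Formula.inst, sat_subst, eval_cons, eval_var]

theorem sat_neg {ρ : M.Env} {φ : Formula} : sat ρ φ.neg ↔ ¬ sat ρ φ := Iff.rfl

theorem sat_imp {ρ : M.Env} {φ ψ : Formula} : sat ρ (φ ⟹ ψ) ↔ (sat ρ φ → sat ρ ψ) := Iff.rfl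

theorem sat_or {ρ : M.Env} {φ ψ : Formula} : sat ρ (φ ⋎ ψ) ↔ (sat ρ φ ∨ sat ρ ψ) := by
  simp only [Formula.or, sat_imp, sat_neg]
  tauto

theorem sat_and {ρ : M.Env} {φ ψ : Formula} : sat ρ (φ ⋏ ψ) ↔ (sat ρ φ ∧ sat ρ ψ) := by
  simp only [Formula.and, sat_imp, sat_neg]
  tauto

theorem sat_iff {ρ : M.Env} {φ ψ : Formula} : sat ρ (φ ⟺ ψ) ↔ (sat ρ φ ↔ sat ρ ψ) := by
  simp only [Formula.iff, sat_and, sat_imp]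
  tauto

theorem sat_all {ρ : M.Env} {σ : Ty} {φ : Formula} :
    sat ρ (.all σ φ) ↔ ∀ x : M.D σ, sat (ρ.cons x) φ := Iff.rfl

theorem sat_ex {ρ : M.Env} {σ : Ty} {φ : Formula} :
    sat ρ (.ex σ φ) ↔ ∃ x : M.D σ, sat (ρ.cons x) φ := by
  simp only [Formula.ex, sat_neg, sat_all, not_forall, not_not]

theorem sat_eq {ρ : M.Env} {s t : Term .nat} : sat ρ (s =₀ t) ↔ M.eq (eval ρ s) (eval ρ t) :=
  Iff.rfl

theorem sat_lt {ρ : M.Env} {s t : Term .nat} : sat ρ (s <₀ t) ↔ M.lt (eval ρ s) (eval ρ t) :=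
  Iff.rfl

/-- Satisfaction of a theory, under all assignments. -/
def Models (M : Interp) (T : Set Formula) : Prop := ∀ φ ∈ T, ∀ ρ : M.Env, sat ρ φ

/-- Pointwise equality. -/
def EqAt (M : Interp) : (σ : Ty) → M.D σ → M.D σ → Prop
  | .nat, x, y => M.eq x y
  | .arr ρ τ, f, g => ∀ x : M.D ρ, EqAt M τ (M.app f x) (M.app g x)

theorem sat_eqAt (ρ : M.Env) {σ : Ty} (s t : Term σ) :
    sat ρ (eqAt σ s t) ↔ M.EqAt σ (eval ρ s) (eval ρ t) := by
  induction σ generalizing ρ with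
  | nat => rfl
  | arr σ τ _ ih =>
    rw [eqAt, sat_all]
    refine forall_congr' fun x => ?_
    rw [ih]
    simp only [eval, eval_shift, Env.cons_zero]

end Interp

/-! ## The term model -/

/-- The term model of a Henkin set. -/
abbrev termInterp (S : Set Formula) : Interp where
  D := Term
  app := Term.app
  const := Term.const
  eq s t := (s =₀ t) ∈ S
  lt s t := (s <₀ t) ∈ S

theorem termInterp_eval (S : Set Formula) (ρ : Subst) {σ : Ty} (t : Term σ) :
    Interp.eval (M := termInterp S) ρ t = t.subst ρ := by
  induction t with
  | var => rfl
  | const => rfl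
  | app t u iht ihu =>
    exact congrArg₂ Term.app iht ihu

/-- The truth lemma. Assignments into the term model are substitutions, and quantifiers range over
terms, which is exactly what the quantifier clause of a Henkin set asks for. -/
theorem termInterp_sat {T S : Set Formula} (hS : HenkinSet T S) (ρ : Subst) (φ : Formula) :
    Interp.sat (M := termInterp S) ρ φ ↔ φ.subst ρ ∈ S := by
  induction φ generalizing ρ with
  | falsum => exact ⟨False.elim, hS.falsum⟩
  | eq s t => rw [Interp.sat_eq, termInterp_eval, termInterp_eval]; rfl
  | lt s t => rw [Interp.sat_lt, termInterp_eval, termInterp_eval]; rfl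
  | imp φ ψ ihφ ihψ => rw [Interp.sat_imp, ihφ, ihψ, Formula.subst, hS.imp]
  | all σ φ ih =>
    rw [Interp.sat_all, Formula.subst, hS.all]
    refine forall_congr' fun t => ?_
    rw [Formula.subst_lift_inst, ← ih]
    rfl

theorem exists_interp_of_not_proves {T : Set Formula} {φ : Formula} (h : ¬ T ⊢ₜ φ) :
    ∃ M : Interp, M.Models T ∧ ∃ ρ : M.Env, ¬ Interp.sat ρ φ := by
  obtain ⟨S, hS, hφ⟩ := exists_henkinSet h
  refine ⟨termInterp S, fun ψ hψ ρ => ?_, Term.var, fun h => hφ ?_⟩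
  -- Axioms may be open and must hold under all assignments, so all their substitution instances are
  -- needed in `S`.
  · exact (termInterp_sat hS ρ ψ).2 (hS.of_derives (Derives.subst_nil (.ax hψ) ρ))
  · rw [← φ.subst_var]
    exact (termInterp_sat hS Term.var φ).1 h

/-! ## The extensional quotient -/

/-- Structures in which `=₀` is equality and functions with the same values are equal. -/
structure Interp.Extensional (M : Interp) : Prop where
  eq_iff {x y : M.D .nat} : M.eq x y ↔ x = y
  ext {σ τ : Ty} {f g : M.D (σ ⇒ₜ τ)} : (∀ x, M.app f x = M.app g x) → f = g

namespace Interp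

/-- The properties of `=₀` needed for the passage to the extensional quotient. -/
structure Congr (M : Interp) : Prop where
  refl (x : M.D .nat) : M.eq x x
  symm {x y : M.D .nat} : M.eq x y → M.eq y x
  trans {x y z : M.D .nat} : M.eq x y → M.eq y z → M.eq x z
  lt {x y z w : M.D .nat} : M.eq x y → M.eq z w → M.lt x z → M.lt y w
  app {σ τ : Ty} (f : M.D (σ ⇒ₜ τ)) {x y : M.D σ} :
    M.EqAt σ x y → M.EqAt τ (M.app f x) (M.app f y)

variable {M : Interp}

/-- The assignment of `x₀, x₁, x₂, x₃` to the first variables of type `σ`. -/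
def Env.cons4 {σ : Ty} (x₀ x₁ x₂ x₃ : M.D σ) (ρ : M.Env) : M.Env :=
  (((ρ.cons x₃).cons x₂).cons x₁).cons x₀

theorem Env.cons4_zero {σ : Ty} (x₀ x₁ x₂ x₃ : M.D σ) (ρ : M.Env) :
    ρ.cons4 x₀ x₁ x₂ x₃ σ 0 = x₀ := Env.cons_zero _ _

theorem Env.cons4_one {σ : Ty} (x₀ x₁ x₂ x₃ : M.D σ) (ρ : M.Env) :
    ρ.cons4 x₀ x₁ x₂ x₃ σ 1 = x₁ := by
  rw [Env.cons4, Env.cons_succ, Env.cons_zero]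

theorem Env.cons4_two {σ : Ty} (x₀ x₁ x₂ x₃ : M.D σ) (ρ : M.Env) :
    ρ.cons4 x₀ x₁ x₂ x₃ σ 2 = x₂ := by
  rw [Env.cons4, Env.cons_succ, Env.cons_succ, Env.cons_zero]

theorem Env.cons4_three {σ : Ty} (x₀ x₁ x₂ x₃ : M.D σ) (ρ : M.Env) :
    ρ.cons4 x₀ x₁ x₂ x₃ σ 3 = x₃ := by
  rw [Env.cons4, Env.cons_succ, Env.cons_succ, Env.cons_succ, Env.cons_zero]

/-- Every domain is inhabited as soon as the domain of numbers is. -/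
noncomputable def defaultEnv (M : Interp) : M.Env := fun τ _ =>
  Ty.rec (motive := M.D) (M.const .zero) (fun σ τ _ y => M.app (M.const (.combK τ σ)) y) τ

theorem Models.basic {T : Set Formula} (hM : M.Models T) (hT : RCA0ω ⊆ T) {φ : Formula}
    (h : BasicAxiom φ) (ρ : M.Env) : sat ρ φ :=
  hM φ (hT (.inl (.inl (.inl (.inl (.inl h)))))) ρ

theorem Models.ext {T : Set Formula} (hM : M.Models T) (hT : RCA0ω ⊆ T) {σ τ : Ty} (x y : Term σ)
    (f : Term (σ ⇒ₜ τ)) (ρ : M.Env) : sat ρ (extAxiom σ τ x y f) :=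
  hM _ (hT (.inl (.inl (.inr ⟨σ, τ, x, y, f, rfl⟩)))) ρ

theorem Models.congr {T : Set Formula} (hM : M.Models T) (hT : RCA0ω ⊆ T) : M.Congr where
  refl x := by
    have := hM.basic hT .eq_refl (M.defaultEnv.cons4 x x x x)
    simpa only [sat_eq, eval, num, Env.cons4_zero] using this
  symm {x y} h := by
    have := hM.basic hT .eq_symm (M.defaultEnv.cons4 x y x x)
    simp only [sat_imp, sat_eq, eval, num, Env.cons4_zero, Env.cons4_one] at this
    exact this h
  trans {x y z} h h' := by
    have := hM.basic hT .eq_trans (M.defaultEnv.cons4 x y z x)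
    simp only [sat_imp, sat_eq, eval, num, Env.cons4_zero, Env.cons4_one, Env.cons4_two] at this
    exact this h h'
  lt {x y z w} h h' h'' := by
    have := hM.basic hT .lt_congr (M.defaultEnv.cons4 x y z w)
    simp only [sat_imp, sat_eq, sat_lt, eval, num, Env.cons4_zero, Env.cons4_one, Env.cons4_two,
      Env.cons4_three] at this
    exact this h h' h''
  app {σ τ} f {x y} h := by
    -- The values of `f` and `x` are assigned to variables with the same index; they do not collide
    -- because no type equals a function type built from it.
    by_cases hne : σ = σ ⇒ₜ τ
    · exact absurd (congrArg sizeOf hne) (by simp; omega)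
    have := hM.ext hT (.var σ 0) (.var σ 1) (.var (σ ⇒ₜ τ) 0)
      (((M.defaultEnv.cons f).cons y).cons x)
    rw [extAxiom, sat_imp, sat_eqAt, sat_eqAt] at this
    simp only [eval, Env.cons_zero, Env.cons_of_ne (Ne.symm hne)] at this
    have e : Env.cons x (Env.cons y (Env.cons f M.defaultEnv)) σ 1 = y := by
      rw [Env.cons_succ, Env.cons_zero]
    rw [e] at this
    exact this h

namespace Congr

variable (hM : M.Congr)
include hM

theorem eqAt_refl : ∀ {σ : Ty} (x : M.D σ), M.EqAt σ x x
  | .nat, x => hM.refl x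
  | .arr _ _, _ => fun _ => eqAt_refl _

theorem eqAt_symm : ∀ {σ : Ty} {x y : M.D σ}, M.EqAt σ x y → M.EqAt σ y x
  | .nat, _, _ => hM.symm
  | .arr _ _, _, _ => fun h x => eqAt_symm (h x)

theorem eqAt_trans : ∀ {σ : Ty} {x y z : M.D σ}, M.EqAt σ x y → M.EqAt σ y z → M.EqAt σ x z
  | .nat, _, _, _ => hM.trans
  | .arr _ _, _, _, _ => fun h h' x => eqAt_trans (h x) (h' x)

def setoid (σ : Ty) : Setoid (M.D σ) where
  r := M.EqAt σ
  iseqv := ⟨hM.eqAt_refl, hM.eqAt_symm, hM.eqAt_trans⟩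

/-- The quotient by pointwise equality. -/
abbrev quotient : Interp where
  D σ := Quotient (hM.setoid σ)
  -- Compatibility in the argument is the extensionality axiom; in the function it is the definition
  -- of pointwise equality.
  app := Quotient.map₂ M.app fun _ _ hf _ x' hx =>
    hM.eqAt_trans (hM.app _ hx) (hf x')
  const c := Quotient.mk _ (M.const c)
  eq x y := x = y
  lt := Quotient.lift₂ M.lt fun _ _ _ _ h h' => propext
    ⟨hM.lt h h', hM.lt (hM.symm h) (hM.symm h')⟩

theorem quotient_extensional : hM.quotient.Extensional where
  eq_iff := Iff.rfl
  ext {σ τ f g} := by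
    refine Quotient.inductionOn₂ f g fun f g h => ?_
    exact Quotient.sound (s := hM.setoid _) fun x =>
      Quotient.exact (s := hM.setoid τ) (h (Quotient.mk _ x))

/-- The assignment in the quotient. -/
def quotEnv (ρ : M.Env) : hM.quotient.Env := fun τ n => Quotient.mk _ (ρ τ n)

theorem eval_quotEnv (ρ : M.Env) {σ : Ty} (t : Term σ) :
    eval (hM.quotEnv ρ) t = Quotient.mk (hM.setoid σ) (eval ρ t) := by
  induction t with
  | var => rfl
  | const => rfl
  | app t u iht ihu =>
    rw [eval, iht, ihu]
    rfl

theorem quotEnv_cons (ρ : M.Env) {σ : Ty} (x : M.D σ) :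
    hM.quotEnv (ρ.cons x) = (hM.quotEnv ρ).cons (Quotient.mk (hM.setoid σ) x) := by
  apply Env.ext_cases σ
  · rw [Env.cons_zero, quotEnv, Env.cons_zero]
  · intro n
    rw [Env.cons_succ, quotEnv, Env.cons_succ]
    rfl
  · intro τ n h
    rw [Env.cons_of_ne h, quotEnv, Env.cons_of_ne h]
    rfl

theorem sat_quotEnv (ρ : M.Env) (φ : Formula) : sat (hM.quotEnv ρ) φ ↔ sat ρ φ := by
  induction φ generalizing ρ with
  | falsum => rfl
  | eq s t =>
    rw [sat_eq, sat_eq, eval_quotEnv, eval_quotEnv]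
    exact ⟨Quotient.exact (s := hM.setoid .nat), Quotient.sound (s := hM.setoid .nat)⟩
  | lt s t =>
    rw [sat_lt, sat_lt, eval_quotEnv, eval_quotEnv]
    rfl
  | imp φ ψ ihφ ihψ => rw [sat_imp, sat_imp, ihφ, ihψ]
  | all σ φ ih =>
    rw [sat_all, sat_all]
    constructor
    · intro h x
      rw [← ih, quotEnv_cons]
      exact h _
    · intro h x
      induction x using Quotient.inductionOn with
      | h x =>
        rw [← quotEnv_cons, ih]
        exact h x

end Congr

end Interp

/-- Completeness for extensional structures. -/
theorem proves_of_forall_extensional {T : Set Formula} (hT : RCA0ω ⊆ T) {φ : Formula}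
    (h : ∀ M : Interp, M.Extensional → M.Models T → ∀ ρ : M.Env, Interp.sat ρ φ) : T ⊢ₜ φ := by
  by_contra hφ
  obtain ⟨M, hM, ρ, hρ⟩ := exists_interp_of_not_proves hφ
  have hc := hM.congr hT
  refine hρ ((hc.sat_quotEnv ρ φ).1 (h _ hc.quotient_extensional ?_ _))
  intro ψ hψ ρ'
  -- Every assignment in the quotient comes from one of representatives, so the axioms transfer.
  have : ρ' = hc.quotEnv fun τ n => (ρ' τ n).out := by
    funext τ n
    exact (Quotient.out_eq _).symm
  rw [this, hc.sat_quotEnv]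
  exact hM ψ hψ _


/-! ## Models of `RCA₀^ω` -/

/-- Extensional models of `RCA₀^ω`. -/
class Interp.IsRCA (M : Interp) : Prop where
  extensional : M.Extensional
  models : M.Models RCA0ω

namespace Interp

variable {M : Interp}

theorem ty_ne_arr_left (σ τ : Ty) : σ ⇒ₜ τ ≠ σ := fun h =>
  absurd (congrArg sizeOf h) (by simp; omega)

theorem sat_choiceAxiom {σ τ : Ty} {A : Formula} {ρ : M.Env} (h : sat ρ (choiceAxiom σ τ A))
    (hA : ∀ x : M.D σ, ∃ y : M.D τ, sat ((ρ.cons x).cons y) A) :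
    ∃ Y : M.D (σ ⇒ₜ τ), ∀ x, sat ((ρ.cons x).cons (M.app Y x)) A := by
  rw [choiceAxiom, sat_imp, sat_all, sat_ex] at h
  obtain ⟨Y, hY⟩ := h fun x => sat_ex.2 (hA x)
  refine ⟨Y, fun x => ?_⟩
  have := hY x
  rw [sat_subst, eval_cons] at this
  convert this using 2
  · rw [eval, eval, eval, Env.cons_zero, Env.cons_of_ne (ty_ne_arr_left σ τ), Env.cons_zero]
  · apply Env.ext_cases σ
    · rw [Env.cons_zero, Subst.lift_zero, eval, Env.cons_zero]
    · intro n
      rw [Env.cons_succ, Subst.lift_succ, eval_shift]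
      exact (congrFun (congrFun (eval_subst_shift Y ρ) σ) n).symm
    · intro τ' n hτ
      rw [Env.cons_of_ne hτ, Subst.lift_of_ne hτ, eval_shift]
      exact (congrFun (congrFun (eval_subst_shift Y ρ) τ') n).symm

theorem sat_inductionAxiom {A : Formula} {ρ : M.Env} (h : sat ρ (inductionAxiom A))
    (h0 : sat (ρ.cons (M.const .zero)) A)
    (hs : ∀ n : M.D .nat, sat (ρ.cons n) A →
      sat (ρ.cons (M.app (M.app (M.const .add) n) (M.const .one))) A) (n : M.D .nat) :
    sat (ρ.cons n) A := by
  rw [inductionAxiom, sat_imp, sat_and, sat_inst, sat_all, sat_all] at h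
  refine h ⟨h0, fun n hn => ?_⟩ n
  rw [sat_subst, eval_cons, eval_subst_shift]
  simpa only [eval, tAdd, tOne, num, Env.cons_zero] using hs n hn

instance : Zero (M.D .nat) := ⟨M.const .zero⟩
instance : One (M.D .nat) := ⟨M.const .one⟩
instance : Add (M.D .nat) := ⟨fun a b => M.app (M.app (M.const .add) a) b⟩
instance : Mul (M.D .nat) := ⟨fun a b => M.app (M.app (M.const .mul) a) b⟩
instance : LT (M.D .nat) := ⟨M.lt⟩
-- This form matches the unfolding of `≤₀`, so that the sentences translate into the order of the
-- model without further argument.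
instance : LE (M.D .nat) := ⟨fun a b => a < b ∨ a = b⟩

theorem const_zero : M.const .zero = 0 := rfl
theorem const_one : M.const .one = 1 := rfl
theorem app_add (a b : M.D .nat) : M.app (M.app (M.const .add) a) b = a + b := rfl
theorem app_mul (a b : M.D .nat) : M.app (M.app (M.const .mul) a) b = a * b := rfl
theorem lt_def (a b : M.D .nat) : M.lt a b ↔ a < b := Iff.rfl

variable [hM : M.IsRCA]

theorem eq_iff {x y : M.D .nat} : M.eq x y ↔ x = y := hM.extensional.eq_iff

theorem fun_ext {σ τ : Ty} {f g : M.D (σ ⇒ₜ τ)} (h : ∀ x, M.app f x = M.app g x) : f = g :=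
  hM.extensional.ext h

theorem eqAt_iff {σ : Ty} {x y : M.D σ} : M.EqAt σ x y ↔ x = y := by
  induction σ with
  | nat => exact eq_iff
  | arr σ τ _ ih => exact ⟨fun h => fun_ext fun z => ih.1 (h z), fun h z => ih.2 (h ▸ rfl)⟩

theorem app_combK {ρ τ : Ty} (x : M.D ρ) (y : M.D τ) :
    M.app (M.app (M.const (.combK ρ τ)) x) y = x := by
  by_cases h : ρ = τ
  · subst h
    have := hM.models _ (.inl (.inl (.inl (.inl (.inr
      (.combK ρ ρ (.var ρ 0) (.var ρ 1))))))) (M.defaultEnv.cons4 x y x x)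
    rw [sat_eqAt, eqAt_iff] at this
    simpa only [eval, Env.cons4_zero, Env.cons4_one] using this
  · have := hM.models _ (.inl (.inl (.inl (.inl (.inr
      (.combK ρ τ (.var ρ 0) (.var τ 0))))))) ((M.defaultEnv.cons x).cons y)
    rw [sat_eqAt, eqAt_iff] at this
    simpa only [eval, Env.cons_zero, Env.cons_of_ne h] using this

theorem app_combS {δ ρ τ : Ty} (x : M.D (δ ⇒ₜ ρ ⇒ₜ τ)) (y : M.D (δ ⇒ₜ ρ)) (z : M.D δ) :
    M.app (M.app (M.app (M.const (.combS δ ρ τ)) x) y) z = M.app (M.app x z) (M.app y z) := by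
  -- an assignment taking the three given values at the variables number 0, 1, 2
  let ρ' : M.Env := fun σ n =>
    if h : n = 0 ∧ σ = (δ ⇒ₜ ρ ⇒ₜ τ) then h.2 ▸ x
    else if h : n = 1 ∧ σ = (δ ⇒ₜ ρ) then h.2 ▸ y
    else if h : n = 2 ∧ σ = δ then h.2 ▸ z
    else M.defaultEnv σ n
  have := hM.models _ (.inl (.inl (.inl (.inl (.inr
    (.combS δ ρ τ (.var _ 0) (.var _ 1) (.var _ 2))))))) ρ'
  rw [sat_eqAt, eqAt_iff] at this
  simpa [eval, ρ'] using this

/-! ### Numbers -/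

theorem sat_basic {φ : Formula} (h : BasicAxiom φ) (a b c : M.D .nat) :
    sat (M.defaultEnv.cons4 a b c a) φ :=
  hM.models.basic (fun _ h => h) h _

instance : CommSemiring (M.D .nat) where
  add_assoc a b c := by
    have := sat_basic .add_assoc a b c
    simpa only [sat_eq, eq_iff, eval, num, tAdd, Env.cons4_zero, Env.cons4_one, Env.cons4_two,
      app_add] using this
  add_comm a b := by
    have := sat_basic .add_comm a b a
    simpa only [sat_eq, eq_iff, eval, num, tAdd, Env.cons4_zero, Env.cons4_one, Env.cons4_two,
      app_add] using this
  add_zero a := by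
    have := sat_basic .add_zero a a a
    simpa only [sat_eq, eq_iff, eval, num, tAdd, tZero, Env.cons4_zero, app_add, const_zero] using this
  zero_add a := by
    have h := sat_basic .add_zero a a a
    have h' := sat_basic .add_comm a 0 a
    simp only [sat_eq, eq_iff, eval, num, tAdd, tZero, Env.cons4_zero, Env.cons4_one,
      app_add] at h h'
    exact h'.symm.trans h
  nsmul := nsmulRec
  mul_assoc a b c := by
    have := sat_basic .mul_assoc a b c
    simpa only [sat_eq, eq_iff, eval, num, tMul, Env.cons4_zero, Env.cons4_one, Env.cons4_two,
      app_mul] using this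
  mul_comm a b := by
    have := sat_basic .mul_comm a b a
    simpa only [sat_eq, eq_iff, eval, num, tMul, Env.cons4_zero, Env.cons4_one, Env.cons4_two,
      app_mul] using this
  mul_one a := by
    have := sat_basic .mul_one a a a
    simpa only [sat_eq, eq_iff, eval, num, tMul, tOne, Env.cons4_zero, app_mul, const_one] using this
  one_mul a := by
    have h := sat_basic .mul_one a a a
    have h' := sat_basic .mul_comm a 1 a
    simp only [sat_eq, eq_iff, eval, num, tMul, tOne, Env.cons4_zero, Env.cons4_one,
      app_mul] at h h'
    exact h'.symm.trans h
  mul_zero a := by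
    have := sat_basic .mul_zero a a a
    simpa only [sat_eq, eq_iff, eval, num, tMul, tZero, Env.cons4_zero, app_mul, const_zero] using this
  zero_mul a := by
    have h := sat_basic .mul_zero a a a
    have h' := sat_basic .mul_comm a 0 a
    simp only [sat_eq, eq_iff, eval, num, tMul, tZero, Env.cons4_zero, Env.cons4_one,
      app_mul] at h h'
    exact h'.symm.trans h
  left_distrib a b c := by
    have := sat_basic .mul_add a b c
    simpa only [sat_eq, eq_iff, eval, num, tMul, tAdd, Env.cons4_zero, Env.cons4_one,
      Env.cons4_two, app_mul, app_add] using this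
  right_distrib a b c := by
    have h := sat_basic .mul_add c a b
    have h1 := sat_basic .mul_comm (a + b) c a
    have h2 := sat_basic .mul_comm a c a
    have h3 := sat_basic .mul_comm b c a
    simp only [sat_eq, eq_iff, eval, num, tMul, tAdd, Env.cons4_zero, Env.cons4_one,
      Env.cons4_two, app_mul, app_add] at h h1 h2 h3
    rw [h1, h, h2, h3]

theorem nat_lt_irrefl (a : M.D .nat) : ¬ a < a := by
  have := sat_basic .lt_irrefl a a a
  simpa only [sat_neg, sat_lt, lt_def, eval, num, Env.cons4_zero] using this

theorem nat_lt_trans {a b c : M.D .nat} : a < b → b < c → a < c := by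
  have := sat_basic .lt_trans a b c
  simpa only [sat_imp, sat_lt, lt_def, eval, num, Env.cons4_zero, Env.cons4_one,
    Env.cons4_two] using this

theorem nat_lt_trichotomy (a b : M.D .nat) : a < b ∨ a = b ∨ b < a := by
  have := sat_basic .lt_trichotomy a b a
  simpa only [sat_or, sat_lt, sat_eq, eq_iff, lt_def, eval, num, Env.cons4_zero,
    Env.cons4_one] using this

noncomputable instance : LinearOrder (M.D .nat) where
  le_refl a := .inr rfl
  le_trans a b c := by
    rintro (h | rfl) (h' | rfl)
    · exact .inl (nat_lt_trans h h')
    · exact .inl h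
    · exact .inl h'
    · exact .inr rfl
  lt_iff_le_not_ge a b := by
    constructor
    · intro h
      refine ⟨.inl h, ?_⟩
      rintro (h' | rfl)
      · exact nat_lt_irrefl _ (nat_lt_trans h h')
      · exact nat_lt_irrefl _ h
    · rintro ⟨h | rfl, h'⟩
      · exact h
      · exact absurd (.inr rfl) h'
  le_antisymm a b := by
    rintro (h | rfl) (h' | h')
    · exact absurd (nat_lt_trans h h') (nat_lt_irrefl _)
    · exact h'.symm
    · rfl
    · rfl
  le_total a b := by
    rcases nat_lt_trichotomy a b with h | h | h
    · exact .inl (.inl h)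
    · exact .inl (.inr h)
    · exact .inr (.inl h)
  toDecidableLE := Classical.decRel _

theorem nat_add_lt_add {a b : M.D .nat} (h : a < b) (c : M.D .nat) : a + c < b + c := by
  have := sat_basic .add_lt_add a b c
  simp only [sat_imp, sat_lt, lt_def, eval, num, tAdd, Env.cons4_zero, Env.cons4_one,
    Env.cons4_two, app_add] at this
  exact this h

theorem nat_mul_lt_mul {a b c : M.D .nat} (h : a < b) (hc : 0 < c) : a * c < b * c := by
  have := sat_basic .mul_lt_mul a b c
  simp only [sat_imp, sat_lt, lt_def, eval, num, tMul, tZero, Env.cons4_zero, Env.cons4_one,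
    Env.cons4_two, app_mul, const_zero] at this
  exact this h hc

theorem nat_zero_lt_one : (0 : M.D .nat) < 1 := by
  have := sat_basic .zero_lt_one (0 : M.D .nat) 0 0
  simpa only [sat_lt, lt_def, eval, tZero, tOne, const_zero, const_one] using this

theorem nat_not_lt_zero (a : M.D .nat) : ¬ a < 0 := by
  have := sat_basic .not_lt_zero a a a
  simpa only [sat_neg, sat_lt, lt_def, eval, tZero, num, Env.cons4_zero, const_zero] using this

theorem lt_add_one_iff {a b : M.D .nat} : a < b + 1 ↔ a ≤ b := by
  have := sat_basic .lt_succ a b a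
  change _ ↔ (a < b ∨ a = b)
  simpa only [sat_iff, Formula.le, sat_or, sat_eq, eq_iff, sat_lt, lt_def, eval, tAdd, tOne, num,
    Env.cons4_zero, Env.cons4_one, const_one, app_add] using this

instance : IsOrderedCancelAddMonoid (M.D .nat) where
  add_le_add_left a b h c := by
    rcases h with h | rfl
    · exact .inl (nat_add_lt_add h c)
    · exact le_rfl
  le_of_add_le_add_left a b c h := by
    by_contra h'
    have := nat_add_lt_add (not_le.1 h') a
    rw [add_comm c, add_comm b] at this
    exact absurd h (not_le.2 this)

instance : IsStrictOrderedRing (M.D .nat) where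
  zero_le_one := nat_zero_lt_one.le
  exists_pair_ne := ⟨0, 1, nat_zero_lt_one.ne⟩
  mul_lt_mul_of_pos_left a h b c h' := by
    simp only [mul_comm a]
    exact nat_mul_lt_mul h' h
  mul_lt_mul_of_pos_right := by
    intro a h b c h'
    exact nat_mul_lt_mul h' h

theorem nat_zero_le (a : M.D .nat) : 0 ≤ a := not_lt.1 (nat_not_lt_zero a)

theorem app_recursor_zero (f : M.D (.nat ⇒ₜ .nat)) (m : M.D .nat) :
    M.app (M.app (M.app (M.const (.recursor .nat)) f) m) 0 = m := by
  have := hM.models _ (.inl (.inl (.inl (.inr (.zero (.var _ 0) (.var _ 0))))))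
    ((M.defaultEnv.cons f).cons m)
  rw [sat_eq, eq_iff] at this
  simpa [eval, tZero, const_zero, Env.cons_zero, Env.cons_of_ne] using this

theorem app_recursor_succ (f : M.D (.nat ⇒ₜ .nat)) (m n : M.D .nat) :
    M.app (M.app (M.app (M.const (.recursor .nat)) f) m) (n + 1) =
      M.app f (M.app (M.app (M.app (M.const (.recursor .nat)) f) m) n) := by
  have := hM.models _ (.inl (.inl (.inl (.inr (.succ (.var _ 0) (.var _ 0) (.var _ 1))))))
    (((M.defaultEnv.cons f).cons n).cons m)
  rw [sat_eq, eq_iff] at this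
  simpa [eval, tOne, tAdd, const_one, app_add, Env.cons_zero, Env.cons_succ, Env.cons_of_ne]
    using this

/-! ## Representable functions -/

section
variable (M : Interp)

/-- Tuples of elements of the domains. -/
def Ctx : List Ty → Type
  | [] => Unit
  | σ :: l => Ctx l × M.D σ

/-- The function of several variables is given by an element of the model. -/
def RepCtx : (l : List Ty) → {τ : Ty} → (M.Ctx l → M.D τ) → Prop
  | [], _, _ => True
  | σ :: l, τ, F => ∃ G : M.Ctx l → M.D (σ ⇒ₜ τ), RepCtx l G ∧ ∀ c x, M.app (G c) x = F (c, x)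

end

section
variable {M : Interp} [hM : M.IsRCA]

theorem RepCtx.const (l : List Ty) {τ : Ty} (a : M.D τ) : M.RepCtx l fun _ => a := by
  induction l generalizing τ with
  | nil => trivial
  | cons σ l ih => exact ⟨_, ih (M.app (M.const (.combK _ _)) a), fun c x => app_combK _ _⟩

/-- Bracket abstraction: `λ x, F x (G x)` is the combinator `combS` applied to `λ x, F x` and `λ x,
G x`, for one variable of the context after another. With constants and projections this is
combinatory completeness. -/
theorem RepCtx.app {l : List Ty} {σ τ : Ty} {F : M.Ctx l → M.D (σ ⇒ₜ τ)} {G : M.Ctx l → M.D σ}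
    (hF : M.RepCtx l F) (hG : M.RepCtx l G) : M.RepCtx l fun c => M.app (F c) (G c) := by
  induction l generalizing σ τ with
  | nil => trivial
  | cons ρ l ih =>
    obtain ⟨F', hF, eF⟩ := hF
    obtain ⟨G', hG, eG⟩ := hG
    refine ⟨_, ih (ih (RepCtx.const l (M.const (.combS ρ σ τ))) hF) hG, fun c x => ?_⟩
    rw [app_combS, eF, eG]

theorem RepCtx.weak {l : List Ty} {σ τ : Ty} {F : M.Ctx l → M.D τ} (hF : M.RepCtx l F) :
    M.RepCtx (σ :: l) fun c => F c.1 :=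
  ⟨_, (RepCtx.const l (M.const (.combK τ σ))).app hF, fun _ _ => app_combK _ _⟩

theorem RepCtx.snd (l : List Ty) (σ : Ty) : M.RepCtx (σ :: l) fun c => c.2 :=
  ⟨_, RepCtx.const l (M.app (M.app (M.const (.combS σ (σ ⇒ₜ σ) σ))
    (M.const (.combK σ (σ ⇒ₜ σ)))) (M.const (.combK σ σ))), fun c x => by
      rw [app_combS, app_combK]⟩

end

/-- The types between which we consider representable functions. A space is determined by its
plots, the representable families of elements. -/
class Space (M : Interp) (X : Type) where
  plot : (l : List Ty) → (M.Ctx l → X) → Prop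
  const (l : List Ty) (x : X) : plot l fun _ => x
  weak {l : List Ty} {σ : Ty} {p : M.Ctx l → X} : plot l p → plot (σ :: l) fun c => p c.1

/-- Representable functions. For functions into `Prop` this means that the characteristic function
is representable. -/
@[fun_prop]
def Rep (M : Interp) {X Y : Type} [Space M X] [Space M Y] (f : X → Y) : Prop :=
  ∀ l (p : M.Ctx l → X), Space.plot l p → Space.plot l fun c => f (p c)

section
variable {M : Interp} {X Y Z : Type} [Space M X] [Space M Y] [Space M Z]

@[fun_prop]
theorem Rep.id : Rep M fun x : X => x := fun _ _ h => h

@[fun_prop]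
theorem Rep.const (y : Y) : Rep M fun _ : X => y := fun _ _ _ => Space.const _ _

@[fun_prop]
theorem Rep.comp {f : Y → Z} {g : X → Y} (hf : Rep M f) (hg : Rep M g) :
    Rep M fun x => f (g x) := fun _ _ h => hf _ _ (hg _ _ h)

instance : Space M (X × Y) where
  plot l p := Space.plot l (fun c => (p c).1) ∧ Space.plot l (fun c => (p c).2)
  const _ _ := ⟨Space.const _ _, Space.const _ _⟩
  weak h := ⟨Space.weak h.1, Space.weak h.2⟩

@[fun_prop]
theorem Rep.prodMk {f : X → Y} {g : X → Z} (hf : Rep M f) (hg : Rep M g) :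
    Rep M fun x => (f x, g x) := fun _ _ h => ⟨hf _ _ h, hg _ _ h⟩

@[fun_prop]
theorem Rep.fst : Rep M (Prod.fst : X × Y → X) := fun _ _ h => h.1

@[fun_prop]
theorem Rep.snd : Rep M (Prod.snd : X × Y → Y) := fun _ _ h => h.2

end

section
variable {M : Interp}

open Classical in
/-- The element of the model representing a function. -/
noncomputable def lam {σ τ : Ty} (F : M.D σ → M.D τ) : M.D (σ ⇒ₜ τ) :=
  if h : ∃ f, ∀ x, M.app f x = F x then h.choose else M.defaultEnv _ 0

theorem app_lam_of_exists {σ τ : Ty} {F : M.D σ → M.D τ} (h : ∃ f, ∀ x, M.app f x = F x)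
    (x : M.D σ) : M.app (lam F) x = F x := by
  rw [lam, dif_pos h]
  exact h.choose_spec x

variable [hM : M.IsRCA] {X Y : Type} [Space M X] [Space M Y]

instance (τ : Ty) : Space M (M.D τ) where
  plot l := M.RepCtx l
  const l x := RepCtx.const l x
  weak h := h.weak

instance : Space M Prop where
  plot l P := ∃ F : M.Ctx l → M.D .nat, M.RepCtx l F ∧ ∀ c, P c ↔ F c = 0
  const l P := by
    by_cases h : P
    · exact ⟨_, RepCtx.const l 0, by simp [h]⟩
    · exact ⟨_, RepCtx.const l 1, by simp [h]⟩
  weak := fun ⟨F, hF, h⟩ => ⟨_, hF.weak, fun c => h c.1⟩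

@[fun_prop]
theorem Rep.app {σ τ : Ty} {f : X → M.D (σ ⇒ₜ τ)} {g : X → M.D σ} (hf : Rep M f)
    (hg : Rep M g) : Rep M fun x => M.app (f x) (g x) :=
  fun _ _ h => RepCtx.app (hf _ _ h) (hg _ _ h)

theorem Rep.exists_app {σ τ : Ty} {F : M.D σ → M.D τ} (hF : Rep M F) :
    ∃ f, ∀ x, M.app f x = F x := by
  obtain ⟨G, _, h⟩ := hF [σ] (fun c => c.2) (RepCtx.snd [] σ)
  exact ⟨G (), fun x => h () x⟩

theorem app_lam {σ τ : Ty} {F : M.D σ → M.D τ} (hF : Rep M F) (x : M.D σ) :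
    M.app (lam F) x = F x := app_lam_of_exists hF.exists_app x

-- Abstracting the last variable of the context gives some representing family. By extensionality a
-- representing element is unique, so the arbitrary choice made in `lam` agrees with it.
@[fun_prop]
theorem Rep.lam {σ τ : Ty} {F : X → M.D σ → M.D τ} (hF : Rep M fun p : X × M.D σ => F p.1 p.2) :
    Rep M fun x => lam (F x) := by
  intro l p hp
  obtain ⟨G, hG, e⟩ := hF (σ :: l) (fun c => (p c.1, c.2)) ⟨Space.weak hp, RepCtx.snd l σ⟩
  have : (fun c => Interp.lam (F (p c))) = G := by
    funext c
    refine fun_ext fun x => ?_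
    rw [app_lam_of_exists ⟨G c, e c⟩, e]
  change M.RepCtx l _
  rw [this]
  exact hG

@[fun_prop]
theorem Rep.add {f g : X → M.D .nat} (hf : Rep M f) (hg : Rep M g) :
    Rep M fun x => f x + g x :=
  ((Rep.const (M.const .add)).app hf).app hg

@[fun_prop]
theorem Rep.mul {f g : X → M.D .nat} (hf : Rep M f) (hg : Rep M g) :
    Rep M fun x => f x * g x :=
  ((Rep.const (M.const .mul)).app hf).app hg

/-- Iteration. -/
noncomputable def iter (f : M.D .nat → M.D .nat) (m n : M.D .nat) : M.D .nat :=
  M.app (M.app (M.app (M.const (.recursor .nat)) (lam f)) m) n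

@[fun_prop]
theorem Rep.iter {f : X → M.D .nat → M.D .nat} {m n : X → M.D .nat}
    (hf : Rep M fun p : X × M.D .nat => f p.1 p.2) (hm : Rep M m) (hn : Rep M n) :
    Rep M fun x => iter (f x) (m x) (n x) := by
  unfold Interp.iter
  fun_prop

theorem iter_zero (f : M.D .nat → M.D .nat) (m : M.D .nat) : iter f m 0 = m :=
  app_recursor_zero _ _

theorem iter_succ {f : M.D .nat → M.D .nat} (hf : Rep M f) (m n : M.D .nat) :
    iter f m (n + 1) = f (iter f m n) := by
  rw [iter, app_recursor_succ, app_lam hf, iter]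

theorem iter_one {f : M.D .nat → M.D .nat} (hf : Rep M f) (m : M.D .nat) :
    iter f m 1 = f m := by
  conv_lhs => rw [← zero_add 1]
  rw [iter_succ hf, iter_zero]

theorem exists_choice_of_qf {A : Formula} (hA : A.QF) (ρ : M.Env)
    (h : ∀ x : M.D (.nat ⇒ₜ .nat), ∃ y : M.D .nat, sat ((ρ.cons x).cons y) A) :
    ∃ Y : M.D ((.nat ⇒ₜ .nat) ⇒ₜ .nat), ∀ x, sat ((ρ.cons x).cons (M.app Y x)) A :=
  sat_choiceAxiom (hM.models _ (.inr ⟨A, hA, rfl⟩) ρ) h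

/-- A function with the values `a, b` at `0, 1`. -/
noncomputable def tuple (a b : M.D .nat) : M.D (.nat ⇒ₜ .nat) :=
  lam fun n => iter (fun _ => b) a n

@[fun_prop]
theorem Rep.tuple {f g : X → M.D .nat} (hf : Rep M f) (hg : Rep M g) :
    Rep M fun x => tuple (f x) (g x) := by
  unfold Interp.tuple
  fun_prop

theorem tuple_zero (a b : M.D .nat) : M.app (tuple a b) 0 = a := by
  rw [tuple, app_lam (by fun_prop), iter_zero]

theorem tuple_one (a b : M.D .nat) : M.app (tuple a b) 1 = b := by
  rw [tuple, app_lam (by fun_prop), iter_one (by fun_prop)]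

/-- Quantifier-free relations have characteristic functions. -/
theorem exists_char {R : M.D .nat → M.D .nat → Prop} (e : Term .nat → Term .nat → Formula)
    (hQF : ∀ s t, (e s t).QF)
    (hR : ∀ (ρ : M.Env) s t, sat ρ (e s t) ↔ R (eval ρ s) (eval ρ t)) :
    ∃ E : M.D (.nat ⇒ₜ .nat ⇒ₜ .nat), ∀ x y,
      (R x y → M.app (M.app E x) y = 0) ∧ (¬ R x y → M.app (M.app E x) y = 1) := by
  -- The available choice schema has a single function argument, so the two numbers are packed as
  -- its values at `0` and `1`.
  let t : Term (.nat ⇒ₜ .nat) := .var _ 0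
  let A : Formula := (e (t ⬝ₜ tZero) (t ⬝ₜ tOne) ⟹ num 0 =₀ tZero) ⋏
    ((e (t ⬝ₜ tZero) (t ⬝ₜ tOne)).neg ⟹ num 0 =₀ tOne)
  have hsat : ∀ (x : M.D (.nat ⇒ₜ .nat)) (y : M.D .nat), sat ((M.defaultEnv.cons x).cons y) A ↔
      ((R (M.app x 0) (M.app x 1) → y = 0) ∧ (¬ R (M.app x 0) (M.app x 1) → y = 1)) := by
    intro x y
    simp [A, t, sat_and, sat_imp, sat_eq, eq_iff, sat_neg, eval, tZero, tOne, Env.cons_zero,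
      Env.cons_of_ne, const_zero, const_one, hR]
  obtain ⟨Y, hY⟩ := exists_choice_of_qf (A := A)
    (by simp [A, Formula.and, Formula.neg, Formula.QF, hQF]) M.defaultEnv fun x => by
      by_cases h : R (M.app x 0) (M.app x 1)
      · exact ⟨0, (hsat _ _).2 ⟨fun _ => rfl, fun h' => absurd h h'⟩⟩
      · exact ⟨1, (hsat _ _).2 ⟨fun h' => absurd h' h, fun _ => rfl⟩⟩
  refine ⟨lam fun a => lam fun b => M.app Y (tuple a b), fun a b => ?_⟩
  rw [app_lam (by fun_prop), app_lam (by fun_prop)]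
  have := (hsat _ _).1 (hY (tuple a b))
  rwa [tuple_zero, tuple_one] at this

/-- The characteristic function of equality. -/
noncomputable def eqChar (a b : M.D .nat) : M.D .nat :=
  M.app (M.app (exists_char (M := M) (R := Eq) Formula.eq (fun _ _ => trivial)
    fun _ _ _ => eq_iff).choose a) b

@[fun_prop]
theorem Rep.eqChar {f g : X → M.D .nat} (hf : Rep M f) (hg : Rep M g) :
    Rep M fun x => eqChar (f x) (g x) := by
  unfold Interp.eqChar
  fun_prop

open Classical in
theorem eqChar_eq (a b : M.D .nat) : eqChar a b = if a = b then 0 else 1 := by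
  have := (exists_char (M := M) (R := Eq) Formula.eq (fun _ _ => trivial)
    fun _ _ _ => eq_iff).choose_spec a b
  split_ifs with h
  · exact this.1 h
  · exact this.2 h

theorem eqChar_eq_zero {a b : M.D .nat} : eqChar a b = 0 ↔ a = b := by
  rw [eqChar_eq]
  split_ifs with h <;> simp [h]

/-! ### Decidable predicates -/

theorem Rep.exists_char {P : X → Prop} (hP : Rep M P) {l : List Ty} {p : M.Ctx l → X}
    (hp : Space.plot l p) : ∃ F : M.Ctx l → M.D .nat, M.RepCtx l F ∧ ∀ c, P (p c) ↔ F c = 0 :=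
  hP l p hp

@[fun_prop]
theorem Rep.eq {f g : X → M.D .nat} (hf : Rep M f) (hg : Rep M g) :
    Rep M fun x => f x = g x :=
  fun l p hp => ⟨_, (hf.eqChar hg) l p hp, fun _ => eqChar_eq_zero.symm⟩

@[fun_prop]
theorem Rep.lt {f g : X → M.D .nat} (hf : Rep M f) (hg : Rep M g) :
    Rep M fun x => f x < g x := by
  obtain ⟨E, hE⟩ := Interp.exists_char (M := M) (R := fun a b => a < b) Formula.lt (fun _ _ => trivial)
    fun _ _ _ => Iff.rfl
  have : ∀ a b, a < b ↔ M.app (M.app E a) b = 0 := fun a b =>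
    ⟨(hE a b).1, fun h => by_contra fun h' => by simp [(hE a b).2 h'] at h⟩
  simp only [this]
  fun_prop

@[fun_prop]
theorem Rep.not {P : X → Prop} (hP : Rep M P) : Rep M fun x => ¬ P x := by
  intro l p hp
  obtain ⟨F, hF, e⟩ := hP.exists_char hp
  have h : Rep M fun a : M.D .nat => Interp.eqChar (Interp.eqChar a 0) 1 := by fun_prop
  refine ⟨_, h l F hF, fun c => ?_⟩
  change ¬ P (p c) ↔ Interp.eqChar (Interp.eqChar (F c) 0) 1 = 0
  rw [eqChar_eq_zero, eqChar_eq, e]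
  split_ifs with h' <;> simp [h']

@[fun_prop]
theorem Rep.and {P Q : X → Prop} (hP : Rep M P) (hQ : Rep M Q) : Rep M fun x => P x ∧ Q x := by
  intro l p hp
  obtain ⟨F, hF, e⟩ := hP.exists_char hp
  obtain ⟨G, hG, e'⟩ := hQ.exists_char hp
  have h : Rep M fun a : M.D .nat × M.D .nat => a.1 + a.2 := by fun_prop
  refine ⟨_, h l (fun c => (F c, G c)) ⟨hF, hG⟩, fun c => ?_⟩
  change P (p c) ∧ Q (p c) ↔ F c + G c = 0
  rw [e, e', add_eq_zero_iff_of_nonneg (nat_zero_le _) (nat_zero_le _)]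

@[fun_prop]
theorem Rep.or {P Q : X → Prop} (hP : Rep M P) (hQ : Rep M Q) : Rep M fun x => P x ∨ Q x := by
  simp only [or_iff_not_and_not]
  fun_prop

@[fun_prop]
theorem Rep.imp {P Q : X → Prop} (hP : Rep M P) (hQ : Rep M Q) : Rep M fun x => P x → Q x := by
  simp only [imp_iff_not_or]
  fun_prop

@[fun_prop]
theorem Rep.ne {f g : X → M.D .nat} (hf : Rep M f) (hg : Rep M g) :
    Rep M fun x => f x ≠ g x := (hf.eq hg).not

@[fun_prop]
theorem Rep.le {f g : X → M.D .nat} (hf : Rep M f) (hg : Rep M g) :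
    Rep M fun x => f x ≤ g x := by
  simp only [← not_lt]
  fun_prop

@[fun_prop]
theorem Rep.ite {P : X → Prop} [∀ x, Decidable (P x)] {f g : X → M.D .nat} (hP : Rep M P)
    (hf : Rep M f) (hg : Rep M g) : Rep M fun x => if P x then f x else g x := by
  intro l p hp
  obtain ⟨F, hF, e⟩ := hP.exists_char hp
  have h : Rep M fun a : M.D .nat × M.D .nat × M.D .nat =>
      Interp.iter (fun _ => a.2.2) a.2.1 (Interp.eqChar a.1 0) := by fun_prop
  have := h l (fun c => (F c, f (p c), g (p c))) ⟨hF, hf l p hp, hg l p hp⟩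
  convert this using 1
  funext c
  change (if P (p c) then f (p c) else g (p c)) =
    Interp.iter (fun _ => g (p c)) (f (p c)) (Interp.eqChar (F c) 0)
  rw [eqChar_eq]
  by_cases h' : F c = 0
  · rw [if_pos ((e c).2 h'), if_pos h', iter_zero]
  · rw [if_neg (mt (e c).1 h'), if_neg h', iter_one (by fun_prop)]

theorem Rep.exists_char₁ {σ : Ty} {P : M.D σ → Prop} (hP : Rep M P) :
    ∃ f : M.D (σ ⇒ₜ .nat), ∀ x, P x ↔ M.app f x = 0 := by
  classical
  have h : Rep M fun x => if P x then (0 : M.D .nat) else 1 := by fun_prop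
  refine ⟨Interp.lam fun x => if P x then 0 else 1, fun x => ?_⟩
  rw [app_lam h]
  split_ifs with h' <;> simp [h']

theorem Rep.exists_char₂ {σ τ : Ty} {P : M.D σ → M.D τ → Prop}
    (hP : Rep M fun p : M.D σ × M.D τ => P p.1 p.2) :
    ∃ f : M.D (σ ⇒ₜ τ ⇒ₜ .nat), ∀ x y, P x y ↔ M.app (M.app f x) y = 0 := by
  classical
  have h : Rep M fun p : M.D σ × M.D τ => if P p.1 p.2 then (0 : M.D .nat) else 1 := by fun_prop
  refine ⟨Interp.lam fun x => Interp.lam fun y => if P x y then 0 else 1, fun x y => ?_⟩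
  rw [app_lam (by fun_prop), app_lam (by fun_prop)]
  split_ifs with h' <;> simp [h']

/-- The characteristic function enters as a parameter and makes `P` an atomic formula, to which
quantifier-free induction applies. Numbers may be nonstandard, so representability cannot be
dropped. -/
theorem nat_induction {P : M.D .nat → Prop} (hP : Rep M P) (h0 : P 0)
    (hs : ∀ n, P n → P (n + 1)) (n : M.D .nat) : P n := by
  obtain ⟨f, hf⟩ := hP.exists_char₁
  let A : Formula := .var (.nat ⇒ₜ .nat) 0 ⬝ₜ num 0 =₀ tZero
  have hA : ∀ n, sat ((M.defaultEnv.cons f).cons n) A ↔ P n := by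
    intro n
    simp [A, sat_eq, eq_iff, eval, tZero, Env.cons_zero, Env.cons_of_ne, hf, const_zero]
  rw [← hA]
  refine sat_inductionAxiom (hM.models _ (.inl (.inr ⟨A, trivial, rfl⟩)) _) ((hA _).2 h0)
    (fun n hn => (hA _).2 (hs n ((hA n).1 hn))) n

/-- Again the characteristic function serves as a parameter of an atomic formula. Both quantified
variables have index `0`; `σ ≠ .nat` keeps them apart. -/
theorem exists_choice_of_models {σ : Ty} (hσ : σ ≠ .nat) (hQ : M.Models (QFAC σ .nat))
    {P : M.D σ → M.D .nat → Prop} (hP : Rep M fun p : M.D σ × M.D .nat => P p.1 p.2)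
    (h : ∀ x, ∃ y, P x y) : ∃ Y : M.D (σ ⇒ₜ .nat), ∀ x, P x (M.app Y x) := by
  obtain ⟨f, hf⟩ := hP.exists_char₂
  let A : Formula := .var (σ ⇒ₜ .nat ⇒ₜ .nat) 0 ⬝ₜ .var σ 0 ⬝ₜ num 0 =₀ tZero
  have hA : ∀ x y, sat (((M.defaultEnv.cons f).cons x).cons y) A ↔ P x y := by
    intro x y
    have h1 : (σ ⇒ₜ .nat ⇒ₜ .nat) ≠ σ := ty_ne_arr_left _ _
    simp [A, sat_eq, eq_iff, eval, tZero, Env.cons_zero, Env.cons_of_ne, hf, const_zero, h1, hσ]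
  obtain ⟨Y, hY⟩ := sat_choiceAxiom (hQ _ ⟨A, trivial, rfl⟩ (M.defaultEnv.cons f)) fun x =>
    (h x).imp fun y hy => (hA x y).2 hy
  exact ⟨Y, fun x => (hA _ _).1 (hY x)⟩

theorem exists_choice {P : M.D (.nat ⇒ₜ .nat) → M.D .nat → Prop}
    (hP : Rep M fun p : M.D (.nat ⇒ₜ .nat) × M.D .nat => P p.1 p.2)
    (h : ∀ x, ∃ y, P x y) : ∃ Y : M.D ((.nat ⇒ₜ .nat) ⇒ₜ .nat), ∀ x, P x (M.app Y x) :=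
  exists_choice_of_models (by simp [Ty.pure]) (fun φ hφ => hM.models φ (.inr hφ)) hP h

/-- A number is coded by the constant function with that value, which reduces choice for numbers to
choice for functions. -/
theorem exists_choice_nat {P : M.D .nat → M.D .nat → Prop}
    (hP : Rep M fun p : M.D .nat × M.D .nat => P p.1 p.2)
    (h : ∀ x, ∃ y, P x y) : ∃ Y : M.D .nat → M.D .nat, Rep M Y ∧ ∀ x, P x (Y x) := by
  obtain ⟨Y, hY⟩ := exists_choice (P := fun f y => P (M.app f 0) y) (by fun_prop) fun f => h _
  refine ⟨fun n => M.app Y (Interp.lam fun _ => n), by fun_prop, fun n => ?_⟩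
  have := hY (Interp.lam fun _ => n)
  rwa [app_lam (by fun_prop)] at this

theorem exists_choice_nat₂ {P : M.D .nat → M.D .nat → M.D .nat → Prop}
    (hP : Rep M fun p : M.D .nat × M.D .nat × M.D .nat => P p.1 p.2.1 p.2.2)
    (h : ∀ x y, ∃ z, P x y z) : ∃ Y : M.D .nat → M.D .nat → M.D .nat,
      (Rep M fun p : M.D .nat × M.D .nat => Y p.1 p.2) ∧ ∀ x y, P x y (Y x y) := by
  obtain ⟨Y, hY⟩ := exists_choice (P := fun f y => P (M.app f 0) (M.app f 1) y) (by fun_prop)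
    fun f => h _ _
  refine ⟨fun m n => M.app Y (tuple m n), by fun_prop, fun m n => ?_⟩
  have := hY (tuple m n)
  rwa [tuple_zero, tuple_one] at this

end
/-- The numbers of the model. -/
abbrev Num (M : Interp) : Type := M.D .nat

/-- The number-theoretic functions of the model. -/
abbrev Fn (M : Interp) : Type := M.D (.nat ⇒ₜ .nat)

/-- The functionals of type two of the model. -/
abbrev Fnl (M : Interp) : Type := M.D ((.nat ⇒ₜ .nat) ⇒ₜ .nat)

/-! ### Arithmetic -/

section
variable {M : Interp} [hM : M.IsRCA] {X : Type} [Space M X]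

theorem add_one_le_iff {a b : M.Num} : a + 1 ≤ b ↔ a < b := by
  rw [← lt_add_one_iff, add_lt_add_iff_right]

/-- A discrete intermediate value principle: otherwise `F k ≤ n` would propagate to all `k` by
induction. It supplies differences, halves and square roots. -/
theorem exists_floor {F : M.Num → M.Num} (hF : Rep M F) {n m : M.Num} (h0 : F 0 ≤ n)
    (hm : n < F m) : ∃ k, F k ≤ n ∧ n < F (k + 1) := by
  by_contra! h
  exact absurd hm (not_lt.2 (nat_induction (P := fun k => F k ≤ n) (by fun_prop) h0 h m))

theorem exists_eq_add_of_le {a b : M.Num} (h : a ≤ b) : ∃ c, b = a + c := by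
  obtain ⟨c, h1, h2⟩ := exists_floor (F := fun c => a + c) (by fun_prop) (n := b) (m := b + 1)
    (by rwa [add_zero]) (lt_add_one_iff.2 (by
      have := add_le_add_left (nat_zero_le a) b
      rwa [zero_add] at this) |>.trans_eq (add_assoc _ _ _))
  rw [← add_assoc, lt_add_one_iff] at h2
  exact ⟨c, le_antisymm h2 h1⟩

instance : CanonicallyOrderedAdd (M.D .nat) where
  exists_add_of_le := exists_eq_add_of_le
  le_add_self a b := by
    have := add_le_add_left (nat_zero_le b) a
    rwa [zero_add] at this
  le_self_add a b := by
    have := add_le_add_right (nat_zero_le b) a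
    rwa [add_zero] at this

theorem exists_sub : ∃ Y : M.Num → M.Num → M.Num,
    (Rep M fun p : M.Num × M.Num => Y p.1 p.2) ∧
      ∀ a b, a = b + Y a b ∨ (a < b ∧ Y a b = 0) := by
  refine exists_choice_nat₂ (P := fun a b c => a = b + c ∨ (a < b ∧ c = 0)) (by fun_prop)
    fun a b => ?_
  rcases lt_or_ge a b with h | h
  · exact ⟨0, .inr ⟨h, rfl⟩⟩
  · exact (exists_eq_add_of_le h).imp fun _ => .inl

noncomputable instance : Sub (M.D .nat) := ⟨exists_sub.choose⟩

@[fun_prop]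
theorem Rep.sub {f g : X → M.Num} (hf : Rep M f) (hg : Rep M g) : Rep M fun x => f x - g x :=
  exists_sub.choose_spec.1.comp (hf.prodMk hg)

instance : OrderedSub (M.D .nat) where
  tsub_le_iff_right a b c := by
    rcases exists_sub.choose_spec.2 a b with h | ⟨h, h'⟩
    · change a = b + (a - b) at h
      conv_rhs => rw [h, add_comm, add_le_add_iff_right]
    · change a - b = 0 at h'
      rw [h']
      exact ⟨fun _ => h.le.trans le_add_self, fun _ => nat_zero_le _⟩

theorem eq_zero_or_eq_add_one (n : M.Num) : n = 0 ∨ ∃ k, n = k + 1 := by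
  rcases (nat_zero_le n).eq_or_lt with h | h
  · exact .inl h.symm
  · obtain ⟨c, hc⟩ := exists_eq_add_of_le (add_one_le_iff.2 h)
    exact .inr ⟨c, by rw [hc, zero_add, add_comm]⟩

theorem le_one_iff {n : M.Num} : n ≤ 1 ↔ n = 0 ∨ n = 1 := by
  constructor
  · intro h
    rcases eq_zero_or_eq_add_one n with h' | ⟨k, rfl⟩
    · exact .inl h'
    · have : k ≤ 0 := by
        rw [← add_le_add_iff_right 1, zero_add]
        exact h
      exact .inr (by rw [le_antisymm this (nat_zero_le _), zero_add])
  · rintro (rfl | rfl)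
    · exact nat_zero_le _
    · exact le_rfl

/-! ### Halves -/

theorem exists_half : ∃ Y : M.Num → M.Num, Rep M Y ∧ ∀ n, n = 2 * Y n ∨ n = 2 * Y n + 1 := by
  refine exists_choice_nat (P := fun n k => n = 2 * k ∨ n = 2 * k + 1) (by fun_prop) fun n => ?_
  obtain ⟨k, h1, h2⟩ := exists_floor (F := fun k : M.Num => 2 * k) (by fun_prop) (n := n)
    (m := n + 1) (by simp) (by
      have := nat_zero_le n
      have := nat_zero_lt_one (M := M)
      simp only [two_mul]
      generalize (1 : M.Num) = u at *
      grind)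
  have h2' : n < 2 * k + 1 + 1 := by
    simp only [two_mul] at *
    grind
  rw [lt_add_one_iff] at h2'
  rcases h2'.eq_or_lt with h | h
  · exact ⟨k, .inr h⟩
  · exact ⟨k, .inl (le_antisymm (lt_add_one_iff.1 h) h1)⟩

noncomputable def half (n : M.Num) : M.Num := exists_half.choose n

@[fun_prop]
theorem Rep.half : Rep M (half : M.Num → M.Num) := exists_half.choose_spec.1

theorem half_spec (n : M.Num) : n = 2 * half n ∨ n = 2 * half n + 1 :=
  exists_half.choose_spec.2 n

theorem two_mul_ne {a b : M.Num} : 2 * a ≠ 2 * b + 1 := by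
  intro h
  have := nat_zero_lt_one (M := M)
  have h' := add_one_le_iff (a := b) (b := a)
  simp only [two_mul] at h
  generalize (1 : M.Num) = u at *
  rcases le_or_gt a b <;> grind

theorem half_two_mul (n : M.Num) : half (2 * n) = n := by
  rcases half_spec (2 * n) with h | h
  · grind
  · exact absurd h two_mul_ne

theorem half_two_mul_add_one (n : M.Num) : half (2 * n + 1) = n := by
  rcases half_spec (2 * n + 1) with h | h
  · exact absurd h.symm two_mul_ne
  · grind

/-! ### Pairs -/

theorem exists_sqrt : ∃ Y : M.Num → M.Num, Rep M Y ∧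
    ∀ n, Y n * Y n ≤ n ∧ n < (Y n + 1) * (Y n + 1) :=
  exists_choice_nat (P := fun n k => k * k ≤ n ∧ n < (k + 1) * (k + 1)) (by fun_prop) fun n =>
    exists_floor (F := fun k : M.Num => k * k) (by fun_prop) (n := n) (m := n + 1)
      (by simp) (by
        have h := nat_zero_le n
        have h' := nat_zero_le (n * n)
        have := nat_zero_lt_one (M := M)
        simp only [mul_add, add_mul, mul_one, one_mul]
        generalize (1 : M.Num) = u at *
        grind)

/-- The code lies between `(a + b)²` and `(a + b + 1)²`, so its integer square root recovers `a +
b`, and then both components. -/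
noncomputable def pair (a b : M.Num) : M.Num := (a + b) * (a + b) + a
noncomputable def unpairSum (n : M.Num) : M.Num := exists_sqrt.choose n
noncomputable def ufst (n : M.Num) : M.Num := n - unpairSum n * unpairSum n
noncomputable def usnd (n : M.Num) : M.Num := unpairSum n - ufst n

@[fun_prop]
theorem Rep.pair {f g : X → M.Num} (hf : Rep M f) (hg : Rep M g) :
    Rep M fun x => pair (f x) (g x) := by
  unfold Interp.pair
  fun_prop

@[fun_prop]
theorem Rep.unpairSum : Rep M (unpairSum : M.Num → M.Num) := exists_sqrt.choose_spec.1

@[fun_prop]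
theorem Rep.ufst : Rep M (ufst : M.Num → M.Num) := by
  unfold Interp.ufst
  fun_prop

@[fun_prop]
theorem Rep.usnd : Rep M (usnd : M.Num → M.Num) := by
  unfold Interp.usnd
  fun_prop

theorem unpairSum_pair (a b : M.Num) : unpairSum (pair a b) = a + b := by
  obtain ⟨h1, h2⟩ := exists_sqrt.choose_spec.2 (pair a b)
  change unpairSum (pair a b) * unpairSum (pair a b) ≤ pair a b at h1
  change pair a b < (unpairSum (pair a b) + 1) * (unpairSum (pair a b) + 1) at h2
  generalize unpairSum (pair a b) = s at h1 h2
  unfold pair at h1 h2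
  apply le_antisymm
  · rw [← lt_add_one_iff]
    refine lt_of_mul_self_lt_mul_self₀ (nat_zero_le _) (h1.trans_lt ?_)
    have := nat_zero_le a
    have := nat_zero_le b
    have := nat_zero_lt_one (M := M)
    simp only [mul_add, add_mul, mul_one, one_mul]
    generalize (1 : M.Num) = u at *
    grind
  · rw [← lt_add_one_iff]
    exact lt_of_mul_self_lt_mul_self₀ (nat_zero_le _) (le_self_add.trans_lt h2)

theorem ufst_pair (a b : M.Num) : ufst (pair a b) = a := by
  rw [ufst, unpairSum_pair, pair, add_tsub_cancel_left]

theorem usnd_pair (a b : M.Num) : usnd (pair a b) = b := by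
  rw [usnd, ufst_pair, unpairSum_pair, add_tsub_cancel_left]

theorem pair_le_pair {a b a' b' : M.Num} (ha : a ≤ a') (hb : b ≤ b') :
    pair a b ≤ pair a' b' :=
  add_le_add (mul_le_mul' (add_le_add ha hb) (add_le_add ha hb)) ha

/-! ### Bounded search -/

open Classical in
/-- The least `i < m` with `P i` if there is one, `m` otherwise. -/
noncomputable def bmin (P : M.Num → Prop) (m : M.Num) : M.Num :=
  iter (fun b => if P b then b else b + 1) 0 m

@[fun_prop]
theorem Rep.bmin {P : X → M.Num → Prop} {m : X → M.Num}
    (hP : Rep M fun p : X × M.Num => P p.1 p.2) (hm : Rep M m) :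
    Rep M fun x => bmin (P x) (m x) := by
  unfold Interp.bmin
  fun_prop

section
variable {P : M.Num → Prop}

theorem bmin_zero : bmin P 0 = 0 := iter_zero _ _

variable (hP : Rep M P)
include hP


open Classical in
theorem bmin_succ (m : M.Num) :
    bmin P (m + 1) = if P (bmin P m) then bmin P m else bmin P m + 1 :=
  iter_succ (by fun_prop) _ _

theorem bmin_spec (m : M.Num) :
    bmin P m ≤ m ∧ (bmin P m < m → P (bmin P m)) := by
  refine nat_induction (P := fun m => bmin P m ≤ m ∧ (bmin P m < m → P (bmin P m)))
    (by fun_prop) ?_ ?_ m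
  · rw [bmin_zero]
    exact ⟨le_rfl, fun h => absurd h (lt_irrefl _)⟩
  · rintro m ⟨h1, h2⟩
    rw [bmin_succ hP]
    split_ifs with h
    · exact ⟨h1.trans (lt_add_one_iff.2 le_rfl).le, fun _ => h⟩
    · have : bmin P m = m := h1.eq_or_lt.resolve_right fun h' => h (h2 h')
      rw [this]
      exact ⟨le_rfl, fun h => absurd h (lt_irrefl _)⟩

theorem bmin_le (m : M.Num) : bmin P m ≤ m := (bmin_spec hP m).1

theorem of_bmin_lt {m : M.Num} (h : bmin P m < m) : P (bmin P m) := (bmin_spec hP m).2 h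

theorem not_of_lt_bmin {i m : M.Num} (h : i < bmin P m) : ¬ P i := by
  refine nat_induction (P := fun m => i < bmin P m → ¬ P i) (by fun_prop) ?_ ?_ m h
  · rw [bmin_zero]
    exact fun h => absurd h (nat_not_lt_zero _)
  · intro m hm
    rw [bmin_succ hP]
    split_ifs with h
    · exact hm
    · intro hi
      rcases (lt_add_one_iff.1 hi).eq_or_lt with e | h'
      · rwa [e]
      · exact hm h'

theorem bmin_lt_iff {m : M.Num} : bmin P m < m ↔ ∃ i < m, P i :=
  ⟨fun h => ⟨_, h, of_bmin_lt hP h⟩, fun ⟨_, hi, h⟩ =>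
    lt_of_le_of_lt (not_lt.1 fun h' => not_of_lt_bmin hP h' h) hi⟩

theorem exists_least {n : M.Num} (h : P n) : ∃ m, P m ∧ ∀ i < m, ¬ P i := by
  refine ⟨bmin P (n + 1), of_bmin_lt hP ((bmin_lt_iff hP).2 ⟨n, ?_, h⟩), fun i =>
    not_of_lt_bmin hP⟩
  exact lt_add_one_iff.2 le_rfl

end

theorem Rep.section_right {P : X → M.Num → Prop} (hP : Rep M fun p : X × M.Num => P p.1 p.2)
    (x : X) : Rep M (P x) := by
  have := hP.comp ((Rep.const (M := M) x).prodMk (Rep.id (M := M) (X := M.Num)))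
  exact this

/-- Bounded search decides it: a witness exists exactly when the search stops before its bound. -/
theorem Rep.bex {P : X → M.Num → Prop} {m : X → M.Num}
    (hP : Rep M fun p : X × M.Num => P p.1 p.2) (hm : Rep M m) :
    Rep M fun x => ∃ i < m x, P x i := by
  simp only [← bmin_lt_iff (hP.section_right _)]
  fun_prop

theorem Rep.ball {P : X → M.Num → Prop} {m : X → M.Num}
    (hP : Rep M fun p : X × M.Num => P p.1 p.2) (hm : Rep M m) :
    Rep M fun x => ∀ i < m x, P x i := by
  have := (Rep.bex (P := fun x i => ¬ P x i) hP.not hm).not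
  simpa only [not_exists, not_and, not_not] using this

/-! ### Primitive recursion -/

/-- Primitive recursion: `prec f m 0 = m`, `prec f m (n + 1) = f n (prec f m n)`. -/
noncomputable def prec (f : M.Num → M.Num → M.Num) (m n : M.Num) : M.Num :=
  usnd (iter (fun p => pair (ufst p + 1) (f (ufst p) (usnd p))) (pair 0 m) n)

@[fun_prop]
theorem Rep.prec {f : X → M.Num → M.Num → M.Num} {m n : X → M.Num}
    (hf : Rep M fun p : X × M.Num × M.Num => f p.1 p.2.1 p.2.2) (hm : Rep M m) (hn : Rep M n) :
    Rep M fun x => prec (f x) (m x) (n x) := by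
  unfold Interp.prec
  have : Rep M fun p : X × M.Num => f p.1 (Interp.ufst p.2) (Interp.usnd p.2) :=
    hf.comp (g := fun p : X × M.Num => (p.1, Interp.ufst p.2, Interp.usnd p.2)) (by fun_prop)
  fun_prop

theorem prec_zero (f : M.Num → M.Num → M.Num) (m : M.Num) : prec f m 0 = m := by
  rw [prec, iter_zero, usnd_pair]

theorem prec_succ {f : M.Num → M.Num → M.Num} (hf : Rep M fun p : M.Num × M.Num => f p.1 p.2)
    (m n : M.Num) : prec f m (n + 1) = f n (prec f m n) := by
  have hs : Rep M fun p => pair (ufst p + 1) (f (ufst p) (usnd p)) := by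
    have : Rep M fun p : M.Num => f (ufst p) (usnd p) :=
      hf.comp (g := fun p : M.Num => (Interp.ufst p, Interp.usnd p)) (by fun_prop)
    fun_prop
  -- The first component of the iterated state counts the steps, so the recursion function receives
  -- the right index.
  have h : ∀ n, ufst (iter (fun p => pair (ufst p + 1) (f (ufst p) (usnd p))) (pair 0 m) n) = n :=
    nat_induction (by fun_prop) (by rw [iter_zero, ufst_pair]) fun n hn => by
      rw [iter_succ hs, ufst_pair, hn]
  rw [prec, iter_succ hs, usnd_pair, h, prec]

/-! ### Dense sequences -/

/-- The entry number `i` of the sequence coded by `s`. -/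
noncomputable def entry (s i : M.Num) : M.Num := ufst (iter usnd s i)

@[fun_prop]
theorem Rep.entry {f g : X → M.Num} (hf : Rep M f) (hg : Rep M g) :
    Rep M fun x => entry (f x) (g x) := by
  unfold Interp.entry
  fun_prop

/-- The largest code of a binary sequence of length `n`. -/
noncomputable def codeBound (n : M.Num) : M.Num := iter (pair 1) 0 n

@[fun_prop]
theorem Rep.codeBound : Rep M (codeBound : M.Num → M.Num) := by
  unfold Interp.codeBound
  fun_prop

/-- The code is built from the last entry backwards: `c k` codes the final `k` of the `N` values, so
removing `i` heads leaves `c (N - i)`. As pairing is monotone, the sequence of ones has the largest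
code among binary sequences. -/
theorem exists_code {f : M.Num → M.Num} (hf : Rep M f) (N : M.Num) :
    ∃ s, (∀ i < N, entry s i = f i) ∧ ((∀ i, f i ≤ 1) → s ≤ codeBound N) := by
  have hg : Rep M fun p : M.Num × M.Num => pair (f (N - p.1 - 1)) p.2 := by fun_prop
  let c : M.Num → M.Num := prec (fun k r => pair (f (N - k - 1)) r) 0
  have hc : Rep M c := by fun_prop
  have c0 : c 0 = 0 := prec_zero _ _
  have cs : ∀ k, c (k + 1) = pair (f (N - k - 1)) (c k) := fun k => prec_succ hg _ _
  refine ⟨c N, fun i hi => ?_, fun h => ?_⟩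
  · have key : ∀ i, i ≤ N → iter usnd (c N) i = c (N - i) := by
      refine nat_induction (by fun_prop) ?_ ?_
      · rw [iter_zero, tsub_zero]
        exact fun _ => rfl
      · intro i ih hi
        have hi' : i < N := add_one_le_iff.1 hi
        obtain ⟨d, rfl⟩ := exists_eq_add_of_le hi
        have e : i + 1 + d - i = d + 1 := by
          rw [add_assoc, add_tsub_cancel_left, add_comm]
        rw [iter_succ (by fun_prop), ih hi'.le, e, cs, usnd_pair, add_tsub_cancel_left]
    obtain ⟨d, rfl⟩ := exists_eq_add_of_le (add_one_le_iff.2 hi)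
    have e : i + 1 + d - i = d + 1 := by
      rw [add_assoc, add_tsub_cancel_left, add_comm]
    rw [entry, key i hi.le, e, cs, ufst_pair, add_tsub_cancel_right, add_tsub_cancel_right]
  · refine nat_induction (P := fun n => c n ≤ codeBound n) (by fun_prop) ?_ ?_ N
    · rw [c0]
      exact nat_zero_le _
    · intro n hn
      rw [cs, codeBound, iter_succ (by fun_prop)]
      exact pair_le_pair (h _) hn

end
/-! ## The sentences in a model -/

section
variable (M : Interp) [hM : M.IsRCA]

/-- Membership in Cantor space. -/
def InC {M : Interp} [M.IsRCA] (f : M.Fn) : Prop := ∀ n, M.app f n ≤ 1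

/-- Agreement of initial segments. -/
def Agree {M : Interp} [M.IsRCA] (f g : M.Fn) (N : M.Num) : Prop :=
  ∀ i < N, M.app f i = M.app g i

def Continuous {M : Interp} [M.IsRCA] (Y : M.Fnl) : Prop :=
  ∀ f, ∃ N, ∀ g, Agree f g N → M.app Y f = M.app Y g

/-- `N` is a modulus of uniform continuity of `Y` on Cantor space. -/
def IsModulus {M : Interp} [M.IsRCA] (Y : M.Fnl) (N : M.Num) : Prop :=
  ∀ f g : M.Fn, InC f ∧ InC g → Agree f g N → M.app Y f = M.app Y g

def HasExists2 : Prop :=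
  ∃ φ : M.Fnl, (∀ f, M.app φ f ≤ 1) ∧ ∀ f, (∃ n, M.app f n = 0) ↔ M.app φ f = 0

def HasExists3 : Prop :=
  ∃ E : M.D (((.nat ⇒ₜ .nat) ⇒ₜ .nat) ⇒ₜ .nat),
    (∀ Y, M.app E Y ≤ 1) ∧ ∀ Y, (∃ f, M.app Y f = 0) ↔ M.app E Y = 0

def HasKappa0 : Prop :=
  ∃ κ : M.D (((.nat ⇒ₜ .nat) ⇒ₜ .nat) ⇒ₜ .nat),
    ∀ Y, M.app κ Y = 0 ↔ ∃ f, InC f ∧ 0 < M.app Y f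

def HasMUC : Prop :=
  ∃ Ω : M.D (((.nat ⇒ₜ .nat) ⇒ₜ .nat) ⇒ₜ .nat), ∀ Y, IsModulus Y (M.app Ω Y)

def HasFF : Prop :=
  ∃ Φ : M.D (((.nat ⇒ₜ .nat) ⇒ₜ .nat) ⇒ₜ .nat), ∀ Y, Continuous Y → IsModulus Y (M.app Φ Y)

def IsBinaryTree {M : Interp} [M.IsRCA] (T : M.Fn) : Prop :=
  ∀ c, 0 < c → (M.app T (2 * c) = 0 ∨ M.app T (2 * c + 1) = 0) → M.app T c = 0

def IsInfiniteTree {M : Interp} [M.IsRCA] (T : M.Fn) : Prop :=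
  ∀ k, ∃ c, k < c ∧ M.app T c = 0

def HasPath {M : Interp} [M.IsRCA] (T : M.Fn) : Prop :=
  ∃ f : M.Fn, InC f ∧ ∃ h : M.Fn, M.app h 0 = 1 ∧
    (∀ n, M.app h (n + 1) = 2 * M.app h n + M.app f n) ∧ ∀ n, M.app T (M.app h n) = 0

def HasWKL : Prop := ∀ T : M.Fn, IsBinaryTree T ∧ IsInfiniteTree T → HasPath T

end

section
variable {M : Interp} [hM : M.IsRCA] (ρ : M.Env)

theorem sat_Exists2 : sat ρ Exists2 ↔ M.HasExists2 := by
  simp only [Exists2, exP, allP, sat_ex, sat_and, sat_iff, Formula.le, sat_or, sat_all, sat_eq,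
    sat_lt, eq_iff]
  exact Iff.rfl

theorem sat_Exists3 : sat ρ Exists3 ↔ M.HasExists3 := by
  simp only [Exists3, exP, allP, sat_ex, sat_and, sat_iff, Formula.le, sat_or, sat_all, sat_eq,
    sat_lt, eq_iff]
  exact Iff.rfl

theorem sat_Kappa0 : sat ρ Kappa0 ↔ M.HasKappa0 := by
  simp only [Kappa0, exP, allP, sat_ex, sat_and, sat_iff, Formula.le, sat_or, sat_all, sat_eq,
    sat_lt, eq_iff, inCantor]
  exact Iff.rfl

theorem sat_MUC : sat ρ MUC ↔ M.HasMUC := by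
  simp only [MUC, hasModulus, exP, allP, sat_ex, sat_and, Formula.le, sat_or, sat_all,
    sat_eq, sat_lt, eq_iff, inCantor, sat_imp, agree]
  exact Iff.rfl

theorem sat_FF : sat ρ FF ↔ M.HasFF := by
  simp only [FF, isCont, hasModulus, exP, allP, sat_ex, sat_and, Formula.le, sat_or,
    sat_all, sat_eq, sat_lt, eq_iff, inCantor, sat_imp, agree]
  exact Iff.rfl

theorem sat_WKL : sat ρ WKL ↔ M.HasWKL := by
  simp only [WKL, isBinaryTree, isInfiniteTree, hasPath, exP, allP, sat_ex, sat_and,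
    Formula.le, sat_or, sat_all, sat_eq, sat_lt, eq_iff, inCantor, sat_imp]
  have two : (2 : M.Num) = 1 + 1 := one_add_one_eq_two.symm
  unfold HasWKL IsBinaryTree IsInfiniteTree HasPath
  rw [two]
  exact Iff.rfl

end
section
variable {M : Interp} [hM : M.IsRCA] {X : Type} [Space M X]

/-! ## Dense sequences in Baire space and Cantor space -/

theorem le_add_one_self (n : M.Num) : n < n + 1 := lt_add_one_iff.2 le_rfl

@[fun_prop]
theorem Rep.agree {f g : X → M.Fn} {N : X → M.Num} (hf : Rep M f) (hg : Rep M g) (hN : Rep M N) :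
    Rep M fun x => Agree (f x) (g x) (N x) := by
  unfold Agree
  exact Rep.ball (P := fun x i => M.app (f x) i = M.app (g x) i) (by fun_prop) hN

theorem Agree.symm {f g : M.Fn} {N : M.Num} (h : Agree f g N) : Agree g f N :=
  fun i hi => (h i hi).symm

theorem Agree.trans {f g h : M.Fn} {N : M.Num} (h₁ : Agree f g N) (h₂ : Agree g h N) :
    Agree f h N := fun i hi => (h₁ i hi).trans (h₂ i hi)

theorem Agree.mono {f g : M.Fn} {m n : M.Num} (h : Agree f g n) (hmn : m ≤ n) : Agree f g m :=
  fun i hi => h i (hi.trans_le hmn)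

theorem agree_zero (f g : M.Fn) : Agree f g 0 := fun i hi => absurd hi (nat_not_lt_zero i)

open Classical in
noncomputable def bit (n : M.Num) : M.Num := if n = 0 then 0 else 1

@[fun_prop]
theorem Rep.bit : Rep M (bit : M.Num → M.Num) := by
  unfold Interp.bit
  fun_prop

theorem bit_le_one (n : M.Num) : bit n ≤ 1 := by
  unfold bit
  split_ifs
  · exact nat_zero_le _
  · exact le_rfl

theorem bit_eq {n : M.Num} (h : n ≤ 1) : bit n = n := by
  rcases le_one_iff.1 h with rfl | rfl <;> simp [bit]

noncomputable def dseq (s : M.Num) : M.Fn := lam fun i => entry s i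

noncomputable def bseq (s : M.Num) : M.Fn := lam fun i => bit (entry s i)

/-- A retraction of Baire space onto Cantor space, used to extend functionals on the latter. -/
noncomputable def trunc (f : M.Fn) : M.Fn := lam fun i => bit (M.app f i)

@[fun_prop]
theorem Rep.dseq : Rep M (dseq : M.Num → M.Fn) := by
  unfold Interp.dseq
  fun_prop

@[fun_prop]
theorem Rep.bseq : Rep M (bseq : M.Num → M.Fn) := by
  unfold Interp.bseq
  fun_prop

@[fun_prop]
theorem Rep.trunc : Rep M (trunc : M.Fn → M.Fn) := by
  unfold Interp.trunc
  fun_prop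

theorem app_dseq (s i : M.Num) : M.app (dseq s) i = entry s i := app_lam (by fun_prop) _

theorem app_bseq (s i : M.Num) : M.app (bseq s) i = bit (entry s i) := app_lam (by fun_prop) _

theorem inC_bseq (s : M.Num) : InC (bseq s) := fun i => by
  rw [app_bseq]
  exact bit_le_one _

theorem inC_trunc (f : M.Fn) : InC (trunc f) := fun i => by
  rw [trunc, app_lam (by fun_prop)]
  exact bit_le_one _

theorem trunc_eq {f : M.Fn} (hf : InC f) : trunc f = f := fun_ext fun i => by
  rw [trunc, app_lam (by fun_prop), bit_eq (hf i)]

theorem exists_dseq (f : M.Fn) (N : M.Num) : ∃ s, Agree f (dseq s) N := by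
  obtain ⟨s, hs, _⟩ := exists_code (f := fun i => M.app f i) (by fun_prop) N
  exact ⟨s, fun i hi => by rw [app_dseq, hs i hi]⟩

/-- The bound on `s` is what turns a search through Cantor space, up to a given precision, into a
bounded search through numbers. -/
theorem exists_bseq {f : M.Fn} (hf : InC f) (N : M.Num) :
    ∃ s, s < codeBound N + 1 ∧ Agree f (bseq s) N := by
  obtain ⟨s, hs, hs'⟩ := exists_code (f := fun i => M.app f i) (by fun_prop) N
  exact ⟨s, lt_add_one_iff.2 (hs' hf), fun i hi => by rw [app_bseq, hs i hi, bit_eq (hf i)]⟩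

/-! ## Consequences of `(∃²)` -/

theorem HasExists2.rep_exists (h : M.HasExists2) {P : X → M.Num → Prop}
    (hP : Rep M fun p : X × M.Num => P p.1 p.2) : Rep M fun x => ∃ n, P x n := by
  classical
  obtain ⟨φ, -, hφ⟩ := h
  have h1 : ∀ x, (∃ n, P x n) ↔ M.app φ (lam fun n => if P x n then 0 else 1) = 0 := by
    intro x
    have := hP.section_right x
    rw [← hφ]
    refine exists_congr fun n => ?_
    rw [app_lam (by fun_prop)]
    split_ifs with h <;> simp [h]
  simp only [h1]
  fun_prop

theorem HasExists2.rep_forall (h : M.HasExists2) {P : X → M.Num → Prop}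
    (hP : Rep M fun p : X × M.Num => P p.1 p.2) : Rep M fun x => ∀ n, P x n := by
  have := (h.rep_exists (P := fun x n => ¬ P x n) hP.not).not
  simpa only [not_exists, not_not] using this

/-- Feferman's search functional. -/
theorem HasExists2.exists_mu (h : M.HasExists2) :
    ∃ μ : M.Fnl, ∀ g, (∃ n, M.app g n = 0) → M.app g (M.app μ g) = 0 := by
  have h1 : Rep M fun g : M.Fn => ∃ n, M.app g n = 0 := h.rep_exists (by fun_prop)
  refine exists_choice (P := fun g n => (∃ n, M.app g n = 0) → M.app g n = 0) ?_ ?_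
  · exact (h1.comp Rep.fst).imp (by fun_prop)
  · intro g
    by_cases hg : ∃ n, M.app g n = 0
    · exact hg.imp fun n hn _ => hn
    · exact ⟨0, fun h => absurd h hg⟩

/-- Grilliot's trick. -/
theorem hasExists2_of_sequence {Y : M.Fnl} {f : M.Fn}
    (h : ∀ N, ∃ s, Agree f (dseq s) N ∧ M.app Y f ≠ M.app Y (dseq s)) : M.HasExists2 := by
  classical
  obtain ⟨s, hs, hY⟩ := exists_choice_nat
    (P := fun N s => Agree f (dseq s) N ∧ M.app Y f ≠ M.app Y (dseq s)) (by fun_prop) h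
  let m : M.Fn → M.Num → M.Num := fun h k => bmin (fun i => M.app h i = 0) (k + 1)
  have hm : Rep M fun p : M.Fn × M.Num => m p.1 p.2 := by fun_prop
  -- `J h` copies `f` until the first zero `n` of `h` and then follows the approximation with index
  -- `n`. While no zero has appeared, `m h k = k + 1`, and the approximation with index `k + 1` is
  -- correct at position `k`. So `J h` is `f` or a sequence that `Y` separates from `f`, according
  -- to whether `h` has a zero.
  let J : M.Fn → M.Fn := fun h => lam fun k => entry (s (m h k)) k
  have hJ : Rep M J := by fun_prop
  have hJapp : ∀ h k, M.app (J h) k = entry (s (m h k)) k := fun h k =>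
    app_lam (by fun_prop) k
  have hsf : ∀ {N i}, i < N → entry (s N) i = M.app f i := fun {N i} hi => by
    rw [← app_dseq]
    exact ((hY N).1 i hi).symm
  have hP : ∀ h : M.Fn, Rep M fun i => M.app h i = 0 := fun h => by fun_prop
  have h1 : ∀ h : M.Fn, (∃ n, M.app h n = 0) → M.app Y f ≠ M.app Y (J h) := by
    rintro h ⟨n, hn⟩
    obtain ⟨n, hn, hn'⟩ := exists_least (hP h) hn
    have : J h = dseq (s n) := by
      refine fun_ext fun k => ?_
      rw [hJapp, app_dseq]
      rcases lt_or_ge k n with hk | hk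
      · have : m h k = k + 1 := le_antisymm (bmin_le (hP h) _) <| not_lt.1 fun h' =>
          hn' _ ((lt_add_one_iff.1 h').trans_lt hk) (of_bmin_lt (hP h) h')
        rw [this, hsf (le_add_one_self k), hsf hk]
      · have h' : m h k < k + 1 := (bmin_lt_iff (hP h)).2 ⟨n, lt_add_one_iff.2 hk, hn⟩
        have : m h k = n := le_antisymm (not_lt.1 fun h'' => not_of_lt_bmin (hP h) h'' hn)
          (not_lt.1 fun h'' => hn' _ h'' (of_bmin_lt (hP h) h'))
        rw [this]
    rw [this]
    exact (hY n).2
  have h2 : ∀ h : M.Fn, (¬ ∃ n, M.app h n = 0) → J h = f := by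
    intro h hn
    refine fun_ext fun k => ?_
    have : m h k = k + 1 := le_antisymm (bmin_le (hP h) _) <| not_lt.1 fun h' =>
      hn ⟨_, of_bmin_lt (hP h) h'⟩
    rw [hJapp, this, hsf (le_add_one_self k)]
  refine ⟨lam fun h => if M.app Y f ≠ M.app Y (J h) then 0 else 1, fun h => ?_, fun h => ?_⟩
  · rw [app_lam (by fun_prop)]
    split_ifs
    · exact nat_zero_le _
    · exact le_rfl
  · rw [app_lam (by fun_prop)]
    by_cases hn : ∃ n, M.app h n = 0
    · simp [hn, h1 h hn]
    · simp [hn, h2 h hn]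

/-- Grilliot's trick gives continuity along the dense sequence only. For arbitrary `g`, a member of
the sequence close to `g` beyond the moduli at both `f` and `g` links the two values. -/
theorem continuous_of_not_hasExists2 (h : ¬ M.HasExists2) (Y : M.Fnl) : Continuous Y := by
  have key : ∀ f, ∃ N, ∀ s, Agree f (dseq s) N → M.app Y f = M.app Y (dseq s) := by
    by_contra! h'
    obtain ⟨f, hf⟩ := h'
    exact h (hasExists2_of_sequence hf)
  intro f
  obtain ⟨N, hN⟩ := key f
  refine ⟨N, fun g hg => ?_⟩
  obtain ⟨N', hN'⟩ := key g
  obtain ⟨s, hs⟩ := exists_dseq g (max N N')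
  rw [hN' s (hs.mono (le_max_right _ _)), hN s (hg.trans (hs.mono (le_max_left _ _)))]

/-! ### Uniform continuity of continuous functionals under `(∃²)` -/

section
variable (Y : M.Fnl)

/-- `Y` has no modulus of uniform continuity on the initial segment of length `k` of `bseq r`. -/
def Splits (r k : M.Num) : Prop :=
  ∀ N, ∃ s t, Agree (bseq r) (bseq s) k ∧ Agree (bseq r) (bseq t) k ∧
    Agree (bseq s) (bseq t) N ∧ M.app Y (bseq s) ≠ M.app Y (bseq t)

variable {Y}

open Classical in
theorem exists_bseq_extension (r k : M.Num) {b : M.Num} (hb : b ≤ 1) :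
    ∃ r', Agree (bseq r) (bseq r') k ∧ M.app (bseq r') k = b := by
  let f : M.Fn := lam fun i => if i < k then M.app (bseq r) i else b
  have hf : ∀ i, M.app f i = if i < k then M.app (bseq r) i else b := fun i =>
    app_lam (by fun_prop) i
  have hC : InC f := fun i => by
    rw [hf]
    split_ifs
    · exact inC_bseq r i
    · exact hb
  obtain ⟨r', -, h⟩ := exists_bseq hC (k + 1)
  refine ⟨r', fun i hi => ?_, ?_⟩
  · rw [← h i (hi.trans (le_add_one_self k)), hf, if_pos hi]
  · rw [← h k (le_add_one_self k), hf, if_neg (lt_irrefl k)]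

theorem agree_add_one {f g : M.Fn} {k : M.Num} :
    Agree f g (k + 1) ↔ Agree f g k ∧ M.app f k = M.app g k := by
  refine ⟨fun h => ⟨h.mono (le_add_one_self k).le, h k (le_add_one_self k)⟩, fun h i hi => ?_⟩
  rcases (lt_add_one_iff.1 hi).eq_or_lt with rfl | hi
  · exact h.2
  · exact h.1 i hi

/-- Bisection: if both one-bit extensions had moduli, their maximum with `k + 1` would be a modulus
below the node, since two sequences agreeing that far share the bit at `k`. -/
theorem Splits.exists_extension {r k : M.Num} (h : Splits Y r k) :
    ∃ r', Agree (bseq r) (bseq r') k ∧ Splits Y r' (k + 1) := by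
  by_contra! h'
  obtain ⟨r₀, h₀, e₀⟩ := exists_bseq_extension r k (nat_zero_le (1 : M.Num))
  obtain ⟨r₁, h₁, e₁⟩ := exists_bseq_extension r k (le_refl (1 : M.Num))
  have h₀' := h' r₀ h₀
  have h₁' := h' r₁ h₁
  unfold Splits at h₀' h₁'
  push Not at h₀' h₁'
  obtain ⟨N₀, h₀'⟩ := h₀'
  obtain ⟨N₁, h₁'⟩ := h₁'
  obtain ⟨s, t, hs, ht, hst, hne⟩ := h (max (k + 1) (max N₀ N₁))
  have hk : M.app (bseq s) k = M.app (bseq t) k :=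
    hst k ((le_add_one_self k).trans_le (le_max_left _ _))
  rcases le_one_iff.1 (inC_bseq s k) with e | e
  · exact hne (h₀' s t (agree_add_one.2 ⟨h₀.symm.trans hs, e₀.trans e.symm⟩)
      (agree_add_one.2 ⟨h₀.symm.trans ht, e₀.trans (hk ▸ e.symm)⟩)
      (hst.mono ((le_max_left _ _).trans (le_max_right _ _))))
  · exact hne (h₁' s t (agree_add_one.2 ⟨h₁.symm.trans hs, e₁.trans e.symm⟩)
      (agree_add_one.2 ⟨h₁.symm.trans ht, e₁.trans (hk ▸ e.symm)⟩)
      (hst.mono ((le_max_right _ _).trans (le_max_right _ _))))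

theorem HasExists2.rep_splits (h : M.HasExists2) :
    Rep M fun p : M.Num × M.Num => Splits Y p.1 p.2 := by
  unfold Splits
  refine h.rep_forall (h.rep_exists (h.rep_exists ?_))
  fun_prop

/-- Under `(∃²)`, continuous functionals are uniformly continuous on Cantor space. -/
theorem HasExists2.exists_modulus (h : M.HasExists2) (hY : Continuous Y) :
    ∃ N, ∀ s t, Agree (bseq s) (bseq t) N → M.app Y (bseq s) = M.app Y (bseq t) := by
  by_contra! h0
  have hU := h.rep_splits (Y := Y)
  obtain ⟨next, hn, hnext⟩ := exists_choice_nat₂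
    (P := fun k r r' => Splits Y r k → Agree (bseq r) (bseq r') k ∧ Splits Y r' (k + 1))
    (by
      have h1 : Rep M fun p : M.Num × M.Num × M.Num => Splits Y p.2.1 p.1 :=
        hU.comp (g := fun p : M.Num × M.Num × M.Num => (p.2.1, p.1)) (by fun_prop)
      have h2 : Rep M fun p : M.Num × M.Num × M.Num => Splits Y p.2.2 (p.1 + 1) :=
        hU.comp (g := fun p : M.Num × M.Num × M.Num => (p.2.2, p.1 + 1)) (by fun_prop)
      fun_prop)
    fun k r => by
      by_cases hr : Splits Y r k
      · exact hr.exists_extension.imp fun _ h _ => h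
      · exact ⟨0, fun h => absurd h hr⟩
  let r : M.Num → M.Num := prec next 0
  have hr : Rep M r := by
    have : Rep M fun p : M.Num × M.Num × M.Num => next p.2.1 p.2.2 :=
      hn.comp (g := fun p : M.Num × M.Num × M.Num => (p.2.1, p.2.2)) (by fun_prop)
    exact Rep.prec (f := fun _ => next) this (Rep.const 0) Rep.id
  have rs : ∀ k, r (k + 1) = next k (r k) := fun k => prec_succ hn _ _
  have hUr : ∀ k, Splits Y (r k) k := by
    refine nat_induction ?_ ?_ ?_
    · exact hU.comp (g := fun k => (r k, k)) (by fun_prop)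
    · intro N
      obtain ⟨s, t, h1, h2⟩ := h0 N
      exact ⟨s, t, agree_zero _ _, agree_zero _ _, h1, h2⟩
    · intro k hk
      rw [rs]
      exact (hnext k _ hk).2
  -- The bit at `i` is settled from `r (i + 1)` on, so this is the limit of the nested segments.
  let f : M.Fn := lam fun i => M.app (bseq (r (i + 1))) i
  have hf : ∀ i, M.app f i = M.app (bseq (r (i + 1))) i := fun i => app_lam (by fun_prop) i
  have hfr : ∀ k, Agree f (bseq (r k)) k := by
    refine nat_induction (by fun_prop) (agree_zero _ _) fun k hk => ?_
    refine agree_add_one.2 ⟨hk.trans ?_, hf k⟩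
    rw [rs]
    exact (hnext k _ (hUr k)).1
  obtain ⟨N, hN⟩ := hY f
  -- Only agreement with `f` up to `N` is needed, so the required agreement of `s` and `t` with each
  -- other is taken trivial.
  obtain ⟨s, t, hs, ht, -, hne⟩ := hUr N 0
  exact hne ((hN _ ((hfr N).trans hs)).symm.trans (hN _ ((hfr N).trans ht)))

end

/-- Being a modulus on the sequences `bseq s` is arithmetical, hence decidable here, and the search
functional finds one. Continuity carries it over to all of Cantor space by approximation. -/
theorem HasExists2.hasFF (h : M.HasExists2) : M.HasFF := by
  classical
  obtain ⟨μ, hμ⟩ := h.exists_mu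
  let G : M.Fnl → M.Num → Prop := fun Y N =>
    ∀ s t, Agree (bseq s) (bseq t) N → M.app Y (bseq s) = M.app Y (bseq t)
  have hG : Rep M fun p : M.Fnl × M.Num => G p.1 p.2 :=
    h.rep_forall (h.rep_forall (by fun_prop))
  refine ⟨lam fun Y => M.app μ (lam fun N => if G Y N then 0 else 1), fun Y hY f g ⟨hf, hg⟩ => ?_⟩
  rw [app_lam (by fun_prop)]
  have hGY := hG.section_right Y
  have key : G Y (M.app μ (lam fun N => if G Y N then 0 else 1)) := by
    obtain ⟨N, hN⟩ := h.exists_modulus hY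
    have := hμ (lam fun N => if G Y N then 0 else 1) ⟨N, by
      rw [app_lam (by fun_prop), if_pos hN]⟩
    rw [app_lam (by fun_prop)] at this
    by_contra h'
    rw [if_neg h'] at this
    exact one_ne_zero this
  generalize M.app μ (lam fun N => if G Y N then 0 else 1) = N at key
  intro hfg
  obtain ⟨N₁, h₁⟩ := hY f
  obtain ⟨N₂, h₂⟩ := hY g
  obtain ⟨s, -, hs⟩ := exists_bseq hf (max N N₁)
  obtain ⟨t, -, ht⟩ := exists_bseq hg (max N N₂)
  rw [h₁ _ (hs.mono (le_max_right _ _)), h₂ _ (ht.mono (le_max_right _ _))]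
  exact key s t (((hs.mono (le_max_left _ _)).symm.trans hfg).trans (ht.mono (le_max_left _ _)))

/-! ## Relations between the functionals -/

theorem HasMUC.hasFF (h : M.HasMUC) : M.HasFF := h.imp fun _ h Y _ => h Y

theorem HasFF.hasExists2_or_hasMUC (h : M.HasFF) : M.HasExists2 ∨ M.HasMUC := by
  by_cases h2 : M.HasExists2
  · exact .inl h2
  · exact .inr (h.imp fun _ h Y => h Y (continuous_of_not_hasExists2 h2 Y))

/-- Up to the modulus, Cantor space is exhausted by boundedly many `bseq s`, so a bounded search
decides whether `Y` is positive somewhere. -/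
theorem HasMUC.hasKappa0 (h : M.HasMUC) : M.HasKappa0 := by
  classical
  obtain ⟨Ω, hΩ⟩ := h
  have hP : Rep M fun Y : M.Fnl => ∃ s < codeBound (M.app Ω Y) + 1, 0 < M.app Y (bseq s) :=
    Rep.bex (P := fun Y s => 0 < M.app Y (bseq s)) (by fun_prop) (by fun_prop)
  refine ⟨lam fun Y => if ∃ s < codeBound (M.app Ω Y) + 1, 0 < M.app Y (bseq s) then 0 else 1,
    fun Y => ?_⟩
  rw [app_lam (by fun_prop)]
  have : (∃ s < codeBound (M.app Ω Y) + 1, 0 < M.app Y (bseq s)) ↔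
      ∃ f, InC f ∧ 0 < M.app Y f := by
    constructor
    · rintro ⟨s, -, hs⟩
      exact ⟨_, inC_bseq s, hs⟩
    · rintro ⟨f, hf, h⟩
      obtain ⟨s, hs, hfs⟩ := exists_bseq hf (M.app Ω Y)
      exact ⟨s, hs, hΩ Y f _ ⟨hf, inC_bseq s⟩ hfs ▸ h⟩
  rw [← this]
  split_ifs with h <;> simp [h]

theorem HasExists3.hasKappa0 (h : M.HasExists3) : M.HasKappa0 := by
  classical
  obtain ⟨E, -, hE⟩ := h
  refine ⟨lam fun Y => M.app E (lam fun f => if 0 < M.app Y (trunc f) then 0 else 1),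
    fun Y => ?_⟩
  rw [app_lam (by fun_prop), ← hE]
  constructor
  · rintro ⟨f, hf⟩
    rw [app_lam (by fun_prop)] at hf
    refine ⟨trunc f, inC_trunc f, ?_⟩
    by_contra h
    rw [if_neg h] at hf
    exact one_ne_zero hf
  · rintro ⟨f, hf, h⟩
    refine ⟨f, ?_⟩
    rw [app_lam (by fun_prop), trunc_eq hf, if_pos h]

/-- A number quantifier is a function quantifier that looks only at the value at `0`. -/
theorem HasExists3.hasExists2 (h : M.HasExists3) : M.HasExists2 := by
  obtain ⟨E, hE1, hE⟩ := h
  have h1 : ∀ h : M.Fn, M.app (lam fun h : M.Fn => M.app E (lam fun f : M.Fn =>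
      M.app h (M.app f 0))) h = M.app E (lam fun f : M.Fn => M.app h (M.app f 0)) :=
    fun h => app_lam (by fun_prop) h
  refine ⟨lam fun h : M.Fn => M.app E (lam fun f : M.Fn => M.app h (M.app f 0)), fun h => ?_,
    fun h => ?_⟩
  · rw [h1]
    exact hE1 _
  · rw [h1, ← hE]
    constructor
    · rintro ⟨n, hn⟩
      refine ⟨lam fun _ => n, ?_⟩
      rwa [app_lam (by fun_prop), app_lam (by fun_prop)]
    · rintro ⟨f, hf⟩
      rw [app_lam (by fun_prop)] at hf
      exact ⟨_, hf⟩

/-- The search functional decodes any `f` from the characteristic function of its graph, an element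
of Cantor space. Searching Cantor space through this decoding therefore searches all of Baire space.
-/
theorem HasExists2.hasExists3 (h : M.HasExists2) (hκ : M.HasKappa0) : M.HasExists3 := by
  classical
  obtain ⟨μ, hμ⟩ := h.exists_mu
  obtain ⟨κ, hκ⟩ := hκ
  -- the function with graph `{(n, m) | h(n, m) = 0}`
  let dec : M.Fn → M.Fn := fun h => lam fun n => M.app μ (lam fun m => M.app h (pair n m))
  have hdec : Rep M dec := by fun_prop
  have dec_surj : ∀ f, ∃ h, InC h ∧ dec h = f := by
    intro f
    let h : M.Fn := lam fun i => if M.app f (ufst i) = usnd i then 0 else 1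
    have hh : ∀ i, M.app h i = if M.app f (ufst i) = usnd i then 0 else 1 := fun i =>
      app_lam (by fun_prop) i
    refine ⟨h, fun i => ?_, fun_ext fun n => ?_⟩
    · rw [hh]
      split_ifs
      · exact nat_zero_le _
      · exact le_rfl
    · have hp : ∀ m, M.app (lam fun m => M.app h (pair n m)) m =
          if M.app f n = m then 0 else 1 := fun m => by
        rw [app_lam (by fun_prop), hh, ufst_pair, usnd_pair]
      have := hμ (lam fun m => M.app h (pair n m)) ⟨M.app f n, by rw [hp, if_pos rfl]⟩
      rw [hp] at this
      rw [app_lam (by fun_prop)]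
      by_contra h'
      rw [if_neg (Ne.symm h')] at this
      exact one_ne_zero this
  let K : M.Fnl → M.Num := fun Y =>
    M.app κ (lam fun h => if M.app Y (dec h) = 0 then 1 else 0)
  have hK : Rep M K := by fun_prop
  have key : ∀ Y, K Y = 0 ↔ ∃ f, M.app Y f = 0 := by
    intro Y
    rw [hκ]
    constructor
    · rintro ⟨h, -, hh⟩
      rw [app_lam (by fun_prop)] at hh
      refine ⟨dec h, ?_⟩
      by_contra h'
      rw [if_neg h'] at hh
      exact lt_irrefl _ hh
    · rintro ⟨f, hf⟩
      obtain ⟨h, hC, rfl⟩ := dec_surj f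
      refine ⟨h, hC, ?_⟩
      rw [app_lam (by fun_prop), if_pos hf]
      exact nat_zero_lt_one
  refine ⟨lam fun Y => if K Y = 0 then 0 else 1, fun Y => ?_, fun Y => ?_⟩
  · rw [app_lam (by fun_prop)]
    split_ifs
    · exact nat_zero_le _
    · exact le_rfl
  · rw [app_lam (by fun_prop), ← key]
    split_ifs with h <;> simp [h]

end
section
variable {M : Interp} [hM : M.IsRCA] {X : Type} [Space M X]

/-! ## Binary trees -/

theorem half_zero : half (0 : M.Num) = 0 := by
  conv_lhs => rw [← mul_zero 2]
  exact half_two_mul 0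

theorem add_one_le_two_mul {n : M.Num} (h : 0 < n) : n + 1 ≤ 2 * n := by
  rw [two_mul]
  have := add_one_le_iff.2 h
  rw [zero_add] at this
  exact add_le_add_right this n

theorem iter_half_succ (c n : M.Num) : iter half c (n + 1) = half (iter half c n) :=
  iter_succ (by fun_prop) _ _

/-- If `1` is never reached, all iterates stay above `1` and every halving loses at least `1`; after
`c` of them nothing is left. -/
theorem exists_iter_half_eq_one {c : M.Num} (hc : 0 < c) : ∃ n, iter half c n = 1 := by
  by_contra! h
  have key : ∀ n, 1 < iter half c n ∧ iter half c n + n ≤ c := by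
    refine nat_induction (by fun_prop) ?_ ?_
    · have := h 0
      rw [iter_zero] at this ⊢
      refine ⟨lt_of_le_of_ne ?_ this.symm, by rw [add_zero]⟩
      have := add_one_le_iff.2 hc
      rwa [zero_add] at this
    · rintro n ⟨h1, h2⟩
      have h3 := h (n + 1)
      rw [iter_half_succ] at h3 ⊢
      have hs := half_spec (iter half c n)
      generalize iter half c n = x at *
      have hpos : 0 < half x := by
        rcases (nat_zero_le (half x)).eq_or_lt with e | e
        · rw [← e] at hs
          rcases hs with rfl | rfl
          · rw [mul_zero] at h1
            exact absurd h1 (nat_not_lt_zero _)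
          · rw [mul_zero, zero_add] at h1
            exact absurd h1 (lt_irrefl _)
        · exact e
      have h4 : half x + 1 ≤ x := by
        refine (add_one_le_two_mul hpos).trans ?_
        rcases hs with hs | hs
        · exact hs.ge
        · conv_rhs => rw [hs]
          exact (le_add_one_self _).le
      refine ⟨lt_of_le_of_ne ?_ h3.symm, ?_⟩
      · have := add_one_le_iff.2 hpos
        rwa [zero_add] at this
      · rw [add_comm n, ← add_assoc]
        exact (add_le_add_left h4 n).trans h2
  obtain ⟨h1, h2⟩ := key c
  have : iter half c c ≤ 0 := by
    rw [← add_le_add_iff_right c, zero_add]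
    exact h2
  exact absurd (h1.trans_le this) (nat_not_lt_zero _)

/-- Halving a code deletes the last bit, so this is closure under arbitrary initial segments.
Positivity excludes `0`, which codes no sequence. -/
theorem IsBinaryTree.iter_half {T : M.Fn} (hT : IsBinaryTree T) {c : M.Num}
    (hc : M.app T c = 0) (n : M.Num) :
    0 < iter half c n → M.app T (iter half c n) = 0 := by
  refine nat_induction (P := fun n => 0 < iter half c n → M.app T (iter half c n) = 0)
    (by fun_prop) ?_ ?_ n
  · rw [iter_zero]
    exact fun _ => hc
  · intro n ih h
    rw [iter_half_succ] at h ⊢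
    have hs := half_spec (iter half c n)
    generalize iter half c n = x at *
    have hx : 0 < x := by
      rcases (nat_zero_le x).eq_or_lt with e | e
      · rw [← e, half_zero] at h
        exact absurd h (lt_irrefl _)
      · exact e
    have := ih hx
    refine hT _ h ?_
    rcases hs with hs | hs
    · left
      rwa [← hs]
    · right
      rwa [← hs]

/-- There are nodes of the tree `T` of arbitrary length above the node `c`. -/
def InfiniteAbove (T : M.Fn) (c : M.Num) : Prop :=
  ∀ k, ∃ c', k < c' ∧ M.app T c' = 0 ∧ ∃ n, iter half c' n = c

theorem InfiniteAbove.mem {T : M.Fn} (hT : IsBinaryTree T) {c : M.Num} (hc : 0 < c)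
    (h : InfiniteAbove T c) : M.app T c = 0 := by
  obtain ⟨c', -, h', n, rfl⟩ := h 0
  exact hT.iter_half h' n hc

theorem InfiniteAbove.extend {T : M.Fn} {c : M.Num} (h : InfiniteAbove T c)
    (h' : ¬ InfiniteAbove T (2 * c)) : InfiniteAbove T (2 * c + 1) := by
  by_contra h''
  unfold InfiniteAbove at h' h''
  push Not at h' h''
  obtain ⟨k₀, h₀⟩ := h'
  obtain ⟨k₁, h₁⟩ := h''
  -- Requiring `c' > c` rules out `c' = c`, so `c'` passes through one of the two children, and
  -- there it exceeds that child's bound.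
  obtain ⟨c', hk, hc', n, hn⟩ := h (max c (max k₀ k₁))
  rcases eq_zero_or_eq_add_one n with rfl | ⟨n, rfl⟩
  · rw [iter_zero] at hn
    rw [hn] at hk
    exact absurd (hk.trans_le' (le_max_left _ _)) (lt_irrefl _)
  · rw [iter_half_succ] at hn
    have hs := half_spec (iter half c' n)
    rw [hn] at hs
    rcases hs with hs | hs
    · exact h₀ c' (hk.trans_le' ((le_max_left _ _).trans (le_max_right _ _))) hc' n hs
    · exact h₁ c' (hk.trans_le' ((le_max_right _ _).trans (le_max_right _ _))) hc' n hs

/-- Having nodes of unbounded size above is arithmetical, hence decidable, and passes to a child.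
The leftmost such branch is defined by iteration. -/
theorem HasExists2.hasWKL (h : M.HasExists2) : M.HasWKL := by
  classical
  rintro T ⟨hT, hinf⟩
  have hU : Rep M fun c => InfiniteAbove T c := by
    unfold InfiniteAbove
    have h1 : Rep M fun p : (M.Num × M.Num) × M.Num => ∃ n, iter half p.2 n = p.1.1 :=
      h.rep_exists (by fun_prop)
    exact h.rep_forall (h.rep_exists (by fun_prop))
  let step : M.Num → M.Num := fun c => if InfiniteAbove T (2 * c) then 2 * c else 2 * c + 1
  have hstep : Rep M step := by fun_prop
  let p : M.Num → M.Num := fun n => iter step 1 n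
  have hp : Rep M p := by fun_prop
  have p0 : p 0 = 1 := iter_zero _ _
  have ps : ∀ n, p (n + 1) = if InfiniteAbove T (2 * p n) then 2 * p n else 2 * p n + 1 :=
    fun n => iter_succ hstep _ _
  have key : ∀ n, 0 < p n ∧ InfiniteAbove T (p n) := by
    refine nat_induction (by fun_prop) ?_ ?_
    · rw [p0]
      refine ⟨nat_zero_lt_one, fun k => ?_⟩
      obtain ⟨c, hc, hc'⟩ := hinf k
      exact ⟨c, hc, hc', exists_iter_half_eq_one ((nat_zero_le k).trans_lt hc)⟩
    · rintro n ⟨h1, h2⟩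
      have h3 : 0 < 2 * p n := (nat_zero_le _).trans_lt (add_one_le_iff.1 (add_one_le_two_mul h1))
      rw [ps]
      split_ifs with h'
      · exact ⟨h3, h'⟩
      · exact ⟨h3.trans (le_add_one_self _), h2.extend h'⟩
  refine ⟨lam fun n => if InfiniteAbove T (2 * p n) then 0 else 1, fun n => ?_,
    lam p, ?_, fun n => ?_, fun n => ?_⟩
  · rw [app_lam (by fun_prop)]
    split_ifs
    · exact nat_zero_le _
    · exact le_rfl
  · rw [app_lam hp, p0]
  · rw [app_lam hp, app_lam hp, app_lam (by fun_prop), ps]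
    split_ifs
    · rw [add_zero]
    · rfl
  · rw [app_lam hp]
    exact (key n).2.mem hT (key n).1

/-! ### Codes of initial segments -/

/-- The code of the initial segment of `f` of length `n`. -/
noncomputable def node (f : M.Fn) (n : M.Num) : M.Num :=
  prec (fun k r => 2 * r + M.app f k) 1 n

@[fun_prop]
theorem Rep.node {f : X → M.Fn} {n : X → M.Num} (hf : Rep M f) (hn : Rep M n) :
    Rep M fun x => node (f x) (n x) := by
  unfold Interp.node
  fun_prop

theorem node_zero (f : M.Fn) : node f 0 = 1 := prec_zero _ _

theorem node_succ (f : M.Fn) (n : M.Num) : node f (n + 1) = 2 * node f n + M.app f n :=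
  prec_succ (f := fun k r => 2 * r + M.app f k) (by fun_prop) _ _

theorem add_one_le_node (f : M.Fn) (n : M.Num) : n + 1 ≤ node f n := by
  refine nat_induction (P := fun n => n + 1 ≤ node f n) (by fun_prop) ?_ ?_ n
  · rw [node_zero, zero_add]
  · intro n hn
    rw [node_succ]
    exact (add_le_add_left hn 1).trans ((add_one_le_two_mul
      ((nat_zero_le n).trans_lt (add_one_le_iff.1 hn))).trans le_self_add)

theorem node_pos (f : M.Fn) (n : M.Num) : 0 < node f n :=
  (nat_zero_le n).trans_lt (add_one_le_iff.1 (add_one_le_node f n))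

theorem half_node_succ {f : M.Fn} (hf : InC f) (n : M.Num) : half (node f (n + 1)) = node f n := by
  rw [node_succ]
  rcases le_one_iff.1 (hf n) with e | e
  · rw [e, add_zero, half_two_mul]
  · rw [e, half_two_mul_add_one]

theorem iter_half_node {f : M.Fn} (hf : InC f) (n m : M.Num) :
    iter half (node f (n + m)) m = node f n := by
  have key : ∀ i, i ≤ m → iter half (node f (n + m)) i = node f (n + m - i) := by
    refine nat_induction (by fun_prop) ?_ ?_
    · rw [iter_zero, tsub_zero]
      exact fun _ => rfl
    · intro i ih hi
      obtain ⟨d, rfl⟩ := exists_eq_add_of_le hi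
      rw [iter_half_succ, ih ((le_add_one_self i).le.trans le_self_add)]
      have e1 : n + (i + 1 + d) - i = (n + d) + 1 := by
        rw [show n + (i + 1 + d) = i + ((n + d) + 1) by ring, add_tsub_cancel_left]
      have e2 : n + (i + 1 + d) - (i + 1) = n + d := by
        rw [show n + (i + 1 + d) = (i + 1) + (n + d) by ring, add_tsub_cancel_left]
      rw [e1, e2, half_node_succ hf]
  rw [key m le_rfl, add_tsub_cancel_right]

theorem Agree.node_eq {f g : M.Fn} {n : M.Num} (h : Agree f g n) : node f n = node g n := by
  refine nat_induction (P := fun m => m ≤ n → node f m = node g m) (by fun_prop) ?_ ?_ n le_rfl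
  · rw [node_zero, node_zero]
    exact fun _ => rfl
  · intro m ih hm
    have hm' := add_one_le_iff.1 hm
    rw [node_succ, node_succ, ih hm'.le, h m hm']

theorem agree_of_node_eq {f g : M.Fn} (hf : InC f) (hg : InC g) {n : M.Num}
    (h : node f n = node g n) : Agree f g n := by
  intro i hi
  obtain ⟨d, rfl⟩ := exists_eq_add_of_le (add_one_le_iff.2 hi)
  have h1 : node f (i + 1) = node g (i + 1) := by
    rw [← iter_half_node hf (i + 1) d, h, iter_half_node hg]
  have h2 : node f i = node g i := by
    rw [← half_node_succ hf, h1, half_node_succ hg]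
  rw [node_succ, node_succ, h2] at h1
  exact add_left_cancel h1

/-- Deleting `n` bits from both sides leaves the root `1` on one side and a nonempty sequence, with
code above `1`, on the other. -/
theorem not_lt_of_node_eq {f g : M.Fn} (hf : InC f) (hg : InC g) {n m : M.Num}
    (h : node f n = node g m) : ¬ n < m := by
  intro hnm
  obtain ⟨d, rfl⟩ := exists_eq_add_of_le (add_one_le_iff.2 hnm)
  have h1 := iter_half_node hf 0 n
  have h2 := iter_half_node hg (1 + d) n
  rw [zero_add, node_zero] at h1
  rw [show 1 + d + n = n + 1 + d by ring, ← h, h1] at h2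
  have h3 := add_one_le_node g (1 + d)
  rw [← h2] at h3
  have h4 := add_one_le_iff.1 h3
  exact absurd (h4.trans_le' le_self_add) (lt_irrefl _)

theorem eq_of_node_eq {f g : M.Fn} (hf : InC f) (hg : InC g) {n m : M.Num}
    (h : node f n = node g m) : n = m :=
  le_antisymm (not_lt.1 (not_lt_of_node_eq hg hf h.symm)) (not_lt.1 (not_lt_of_node_eq hf hg h))

theorem hasPath_of_node {T f : M.Fn} (hf : InC f) (h : ∀ n, M.app T (node f n) = 0) :
    HasPath T := by
  have hn : ∀ n, M.app (lam fun n => node f n) n = node f n := fun n => app_lam (by fun_prop) n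
  refine ⟨f, hf, lam fun n => node f n, ?_, fun n => ?_, fun n => ?_⟩
  · rw [hn, node_zero]
  · rw [hn, hn, node_succ]
  · rw [hn, h]

theorem HasPath.exists_node {T : M.Fn} (h : HasPath T) :
    ∃ f : M.Fn, InC f ∧ ∀ n, M.app T (node f n) = 0 := by
  obtain ⟨f, hf, p, p0, ps, hT⟩ := h
  refine ⟨f, hf, fun n => ?_⟩
  have : M.app p n = node f n := by
    refine nat_induction (P := fun n => M.app p n = node f n) (by fun_prop) ?_ ?_ n
    · rw [p0, node_zero]
    · intro n hn
      rw [ps, hn, node_succ]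
  rw [← this, hT]

open Classical in
/-- Every positive number is the code of a binary sequence. -/
theorem exists_node_eq {c : M.Num} (hc : 0 < c) : ∃ f : M.Fn, InC f ∧ ∃ n, node f n = c := by
  obtain ⟨L, hL⟩ := exists_iter_half_eq_one hc
  -- As `L` halvings reach the root, `L - i` of them leave the initial segment of length `i`; the
  -- next bit is read off by comparing consecutive segments.
  let f : M.Fn := lam fun i =>
    if iter half c (L - (i + 1)) = 2 * iter half c (L - i) then 0 else 1
  have hf : ∀ i, M.app f i =
      if iter half c (L - (i + 1)) = 2 * iter half c (L - i) then 0 else 1 := fun i =>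
    app_lam (by fun_prop) i
  refine ⟨f, fun i => ?_, L, ?_⟩
  · rw [hf]
    split_ifs
    · exact nat_zero_le _
    · exact le_rfl
  · have key : ∀ n, n ≤ L → node f n = iter half c (L - n) := by
      refine nat_induction (by fun_prop) ?_ ?_
      · rw [node_zero, tsub_zero, hL]
        exact fun _ => rfl
      · intro n ih hn
        obtain ⟨d, rfl⟩ := exists_eq_add_of_le hn
        rw [node_succ, ih ((le_add_one_self n).le.trans le_self_add), hf]
        have e1 : n + 1 + d - n = d + 1 := by
          rw [show n + 1 + d = n + (d + 1) by ring, add_tsub_cancel_left]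
        rw [e1, add_tsub_cancel_left, iter_half_succ]
        have hs := half_spec (iter half c d)
        split_ifs with h
        · rw [add_zero, ← h]
        · exact (hs.resolve_left h).symm
    rw [key L le_rfl, tsub_self, iter_zero]

/-! ### Weak König's lemma from uniform continuity -/

/-- The largest code of a binary sequence of length `n`. -/
noncomputable def maxNode (n : M.Num) : M.Num := iter (fun r => 2 * r + 1) 1 n

theorem maxNode_succ (n : M.Num) : maxNode (n + 1) = 2 * maxNode n + 1 :=
  iter_succ (f := fun r => 2 * r + 1) (by fun_prop) _ _

theorem node_le_maxNode {f : M.Fn} (hf : InC f) (n : M.Num) : node f n ≤ maxNode n := by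
  refine nat_induction (P := fun n => node f n ≤ maxNode n) (by unfold maxNode; fun_prop) ?_ ?_ n
  · rw [node_zero, maxNode, iter_zero]
  · intro n hn
    rw [node_succ, maxNode_succ]
    exact add_le_add (mul_le_mul' le_rfl hn) (hf n)

theorem maxNode_mono {m n : M.Num} (h : m ≤ n) : maxNode m ≤ maxNode n := by
  obtain ⟨d, rfl⟩ := exists_eq_add_of_le h
  refine nat_induction (P := fun d => maxNode m ≤ maxNode (m + d)) (by unfold maxNode; fun_prop)
    ?_ ?_ d
  · rw [add_zero]
  · intro d hd
    rw [← add_assoc, maxNode_succ, two_mul, add_assoc]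
    exact hd.trans le_self_add

/-- The running sum is a bound that primitive recursion produces, with no maximum needed. -/
theorem exists_bound {g : M.Num → M.Num} (hg : Rep M g) (B : M.Num) :
    ∃ K, ∀ s < B, g s ≤ K := by
  let K : M.Num → M.Num := prec (fun k r => r + g k) 0
  have hK : Rep M K := by fun_prop
  have hh : Rep M fun p : M.Num × M.Num => p.2 + g p.1 := by fun_prop
  have Ks : ∀ n, K (n + 1) = K n + g n := fun n => prec_succ (f := fun k r => r + g k) hh _ _
  refine ⟨K B, nat_induction (P := fun B => ∀ s < B, g s ≤ K B) ?_ ?_ ?_ B⟩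
  · exact Rep.ball (P := fun B s => g s ≤ K B) (by fun_prop) Rep.id
  · exact fun s hs => absurd hs (nat_not_lt_zero s)
  · intro n hn s hs
    rw [Ks]
    rcases (lt_add_one_iff.1 hs).eq_or_lt with rfl | hs
    · exact le_add_self
    · exact (hn s hs).trans le_self_add

/-- Without a path, choice gives a functional naming a length at which each sequence is outside `T`.
Its modulus makes it bounded on Cantor space, by `K` say, and a node of `T` of length at least `K`
contradicts closure under initial segments. -/
theorem HasMUC.hasWKL (h : M.HasMUC) : M.HasWKL := by
  rintro T ⟨hT, hinf⟩
  by_contra hpath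
  obtain ⟨Ω, hΩ⟩ := h
  obtain ⟨Y, hY⟩ := exists_choice (P := fun f n => M.app T (node (trunc f) n) ≠ 0)
    (by fun_prop) fun f => by
      by_contra! h
      exact hpath (hasPath_of_node (inC_trunc f) h)
  obtain ⟨K, hK⟩ := exists_bound (g := fun s => M.app Y (bseq s)) (by fun_prop)
    (codeBound (M.app Ω Y) + 1)
  -- Infinity of the tree speaks of codes; a code above `maxNode K` forces length at least `K`.
  obtain ⟨c, hc, hTc⟩ := hinf (maxNode K)
  obtain ⟨f, hf, L, rfl⟩ := exists_node_eq ((nat_zero_le _).trans_lt hc)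
  have hYf : M.app Y f ≤ K := by
    obtain ⟨s, hs, hfs⟩ := exists_bseq hf (M.app Ω Y)
    rw [hΩ Y f _ ⟨hf, inC_bseq s⟩ hfs]
    exact hK s hs
  have hKL : K ≤ L := not_lt.1 fun h =>
    absurd (hc.trans_le ((node_le_maxNode hf L).trans (maxNode_mono h.le))) (lt_irrefl _)
  obtain ⟨d, rfl⟩ := exists_eq_add_of_le (hYf.trans hKL)
  refine hY f ?_
  rw [trunc_eq hf, ← iter_half_node hf _ d]
  refine hT.iter_half hTc d ?_
  rw [iter_half_node hf]
  exact node_pos _ _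

/-! ## Uniform continuity from `(κ₀³)` and weak König's lemma -/

/-- `(κ₀³)` makes quantifiers over Cantor space decidable, as `(∃²)` does for number quantifiers. -/
theorem HasKappa0.rep_exists (h : M.HasKappa0) {P : X → M.Fn → Prop}
    (hP : Rep M fun p : X × M.Fn => P p.1 p.2) : Rep M fun x => ∃ f, InC f ∧ P x f := by
  classical
  obtain ⟨κ, hκ⟩ := h
  have h1 : ∀ x, (∃ f, InC f ∧ P x f) ↔ M.app κ (lam fun f => if P x f then 1 else 0) = 0 := by
    intro x
    have : Rep M (P x) := hP.comp ((Rep.const (M := M) x).prodMk (Rep.id (M := M) (X := M.Fn)))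
    rw [hκ]
    refine exists_congr fun f => and_congr_right fun _ => ?_
    rw [app_lam (by fun_prop)]
    split_ifs with h <;> simp [h]
  simp only [h1]
  fun_prop

theorem exists_isModulus (hκ : M.HasKappa0) (hW : M.HasWKL) {Y : M.Fnl} (hY : Continuous Y) :
    ∃ N, IsModulus Y N := by
  classical
  by_contra! h
  -- the nodes above which `Y` takes different values
  let Q : M.Num → M.Fn → M.Fn → Prop := fun c f g =>
    ∃ n < c + 1, ∃ m < c + 1, node f n = c ∧ node g m = c ∧ M.app Y f ≠ M.app Y g
  -- A code exceeds the length of its sequence, so the lengths can be bounded by `c`. Hence `Q` is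
  -- representable although `(∃²)` may fail.
  have hQ : Rep M fun p : (M.Num × M.Fn) × M.Fn => Q p.1.1 p.1.2 p.2 :=
    Rep.bex (P := fun (p : (M.Num × M.Fn) × M.Fn) n => ∃ m < p.1.1 + 1, node p.1.2 n = p.1.1 ∧ node p.2 m = p.1.1 ∧
      M.app Y p.1.2 ≠ M.app Y p.2)
      (Rep.bex (P := fun (q : ((M.Num × M.Fn) × M.Fn) × M.Num) m =>
        node q.1.1.2 q.2 = q.1.1.1 ∧ node q.1.2 m = q.1.1.1 ∧
          M.app Y q.1.1.2 ≠ M.app Y q.1.2) (by fun_prop) (by fun_prop)) (by fun_prop)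
  let R : M.Num → Prop := fun c => ∃ f, InC f ∧ ∃ g, InC g ∧ Q c f g
  have hR : Rep M R := hκ.rep_exists (P := fun c f => ∃ g, InC g ∧ Q c f g)
    (hκ.rep_exists (P := fun (p : M.Num × M.Fn) g => Q p.1 p.2 g) hQ)
  have hRn : ∀ {f g : M.Fn} {c : M.Num} {n m : M.Num}, InC f → InC g → node f n = c →
      node g m = c → M.app Y f ≠ M.app Y g → R c := by
    intro f g c n m hf hg hn hm hne
    refine ⟨f, hf, g, hg, n, ?_, m, ?_, hn, hm, hne⟩
    · rw [← hn]
      exact (add_one_le_iff.1 (add_one_le_node f n)).trans (le_add_one_self _)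
    · rw [← hm]
      exact (add_one_le_iff.1 (add_one_le_node g m)).trans (le_add_one_self _)
  let T : M.Fn := lam fun c => if R c then 0 else 1
  have hT : ∀ c, M.app T c = 0 ↔ R c := by
    intro c
    rw [app_lam (by fun_prop)]
    split_ifs with h <;> simp [h]
  have htree : IsBinaryTree T := by
    intro c hc hT'
    simp only [hT] at hT' ⊢
    have key : ∀ {f : M.Fn} {n : M.Num}, InC f → node f n = 2 * c ∨ node f n = 2 * c + 1 →
        ∃ m, node f m = c := by
      intro f n hf h
      rcases eq_zero_or_eq_add_one n with rfl | ⟨n, rfl⟩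
      · rw [node_zero] at h
        have h4 : (1 : M.Num) < 2 * c := by
          refine add_one_le_iff.1 ((add_le_add_left ?_ 1).trans (add_one_le_two_mul hc))
          simpa using add_one_le_iff.2 hc
        rcases h with h | h
        · exact absurd h h4.ne
        · exact absurd h (h4.trans (le_add_one_self _)).ne
      · refine ⟨n, ?_⟩
        rw [← half_node_succ hf]
        rcases h with h | h
        · rw [h, half_two_mul]
        · rw [h, half_two_mul_add_one]
    rcases hT' with ⟨f, hf, g, hg, n, -, m, -, hn, hm, hne⟩ |
      ⟨f, hf, g, hg, n, -, m, -, hn, hm, hne⟩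
    · obtain ⟨n', hn'⟩ := key hf (.inl hn)
      obtain ⟨m', hm'⟩ := key hg (.inl hm)
      exact hRn hf hg hn' hm' hne
    · obtain ⟨n', hn'⟩ := key hf (.inr hn)
      obtain ⟨m', hm'⟩ := key hg (.inr hm)
      exact hRn hf hg hn' hm' hne
  have hinf : IsInfiniteTree T := by
    intro k
    have := h k
    unfold IsModulus at this
    push Not at this
    obtain ⟨f, g, ⟨hf, hg⟩, hfg, hne⟩ := this
    exact ⟨node f k, add_one_le_iff.1 (add_one_le_node f k), (hT _).2
      (hRn hf hg rfl hfg.node_eq.symm hne)⟩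
  obtain ⟨f, hf, hpath⟩ := (hW T ⟨htree, hinf⟩).exists_node
  obtain ⟨N, hN⟩ := hY f
  obtain ⟨f₁, h₁, f₂, h₂, n, -, m, -, hn, hm, hne⟩ := (hT _).1 (hpath N)
  -- Codes determine lengths, so both witnesses agree with `f` up to `N`, where continuity at `f`
  -- forces equal values.
  obtain rfl := eq_of_node_eq h₁ hf hn
  obtain rfl := eq_of_node_eq h₂ hf hm
  exact hne ((hN _ (agree_of_node_eq hf h₁ hn.symm)).symm.trans
    (hN _ (agree_of_node_eq hf h₂ hm.symm)))

/-- Each functional is continuous and so has a modulus. `(κ₀³)` makes being a modulus decidable,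
which is what quantifier-free choice at type two needs to pick one for every `Y`. -/
theorem HasKappa0.hasMUC (hκ : M.HasKappa0) (hW : M.HasWKL) (h2 : ¬ M.HasExists2)
    (hQ : M.Models (QFAC (Ty.pure 2) (Ty.pure 0))) : M.HasMUC := by
  have hmod : ∀ (Y : M.Fnl) N, IsModulus Y N ↔
      ¬ ∃ f, InC f ∧ ∃ g, InC g ∧ Agree f g N ∧ M.app Y f ≠ M.app Y g := by
    intro Y N
    unfold IsModulus
    push Not
    exact ⟨fun h f hf g hg => h f g ⟨hf, hg⟩, fun h f g hfg => h f hfg.1 g hfg.2⟩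
  refine exists_choice_of_models (σ := (.nat ⇒ₜ .nat) ⇒ₜ .nat) (by simp) hQ ?_ fun Y =>
    exists_isModulus hκ hW (continuous_of_not_hasExists2 h2 Y)
  simp only [hmod]
  refine Rep.not (hκ.rep_exists (P := fun (p : M.Fnl × M.Num) f =>
    ∃ g, InC g ∧ Agree f g p.2 ∧ M.app p.1 f ≠ M.app p.1 g) (hκ.rep_exists
      (P := fun (q : (M.Fnl × M.Num) × M.Fn) g =>
        Agree q.2 g q.1.2 ∧ M.app q.1.1 q.2 ≠ M.app q.1.1 g) (by fun_prop)))

end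
end Interp

/-! ### The four derivability statements -/

/-- To prove a formula, argue in the extensional models of `RCA₀^ω`. -/
theorem proves_of_forall_isRCA {T : Set Formula} (hT : RCA0ω ⊆ T) {φ : Formula}
    (h : ∀ (M : Interp) [M.IsRCA], M.Models T → ∀ ρ : M.Env, Interp.sat ρ φ) : T ⊢ₜ φ :=
  proves_of_forall_extensional hT fun M hE hM ρ =>
    haveI : M.IsRCA := ⟨hE, fun φ hφ => hM φ (hT hφ)⟩
    h M hM ρ

section
open Interp

theorem proves_kappa0_and_wkl_iff : RCA0ω ∪ QFAC (Ty.pure 2) (Ty.pure 0) ⊢ₜ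
    (Kappa0 ⋏ WKL ⟺ Exists3 ⋎ MUC) := by
  refine proves_of_forall_isRCA Set.subset_union_left fun M _ hM ρ => ?_
  rw [sat_iff, sat_and, sat_or, sat_Kappa0, sat_WKL, sat_Exists3, sat_MUC]
  constructor
  · rintro ⟨hκ, hW⟩
    -- The disjunct obtained depends on whether discontinuous functionals are available.
    by_cases h2 : M.HasExists2
    · exact .inl (h2.hasExists3 hκ)
    · exact .inr (hκ.hasMUC hW h2 fun φ hφ => hM φ (.inr hφ))
  · rintro (h | h)
    · exact ⟨h.hasKappa0, h.hasExists2.hasWKL⟩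
    · exact ⟨h.hasKappa0, h.hasWKL⟩

theorem proves_iff_kappa0_and_ff : RCA0ω ∪ QFAC (Ty.pure 2) (Ty.pure 0) ⊢ₜ
    (Exists3 ⋎ MUC ⟺ Kappa0 ⋏ FF) := by
  refine proves_of_forall_isRCA Set.subset_union_left fun M _ _ ρ => ?_
  rw [sat_iff, sat_and, sat_or, sat_Kappa0, sat_FF, sat_Exists3, sat_MUC]
  constructor
  · rintro (h | h)
    · exact ⟨h.hasKappa0, h.hasExists2.hasFF⟩
    · exact ⟨h.hasKappa0, h.hasFF⟩
  · rintro ⟨hκ, hF⟩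
    exact hF.hasExists2_or_hasMUC.imp_left fun h2 => h2.hasExists3 hκ

theorem proves_ff_iff_exists2_or_muc : RCA0ω ⊢ₜ (FF ⟺ Exists2 ⋎ MUC) := by
  refine proves_of_forall_isRCA subset_rfl fun M _ _ ρ => ?_
  rw [sat_iff, sat_or, sat_FF, sat_Exists2, sat_MUC]
  exact ⟨HasFF.hasExists2_or_hasMUC, fun h => h.elim HasExists2.hasFF HasMUC.hasFF⟩

theorem proves_ff_iff_exists2_or_kappa0 : WKL0ω ∪ QFAC (Ty.pure 2) (Ty.pure 0) ⊢ₜ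
    (FF ⟺ Exists2 ⋎ Kappa0) := by
  refine proves_of_forall_isRCA (Set.subset_union_left.trans Set.subset_union_left)
    fun M _ hM ρ => ?_
  have hW : M.HasWKL := (sat_WKL ρ).1 (hM WKL (.inl (.inr rfl)) ρ)
  rw [sat_iff, sat_or, sat_FF, sat_Exists2, sat_Kappa0]
  constructor
  · exact fun h => h.hasExists2_or_hasMUC.imp_right HasMUC.hasKappa0
  · rintro (h | h)
    · exact h.hasFF
    -- Only when `(∃²)` fails are weak König's lemma and choice at type two needed.
    · by_cases h2 : M.HasExists2
      · exact h2.hasFF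
      · exact (h.hasMUC hW h2 fun φ hφ => hM φ (.inr hφ)).hasFF

end

end HOArith

theorem mainTheorem4 :
    (HOArith.RCA0ω ∪ HOArith.QFAC (HOArith.Ty.pure 2) (HOArith.Ty.pure 0) ⊢ₜ
      (HOArith.Kappa0 ⋏ HOArith.WKL ⟺ HOArith.Exists3 ⋎ HOArith.MUC)) ∧
    (HOArith.RCA0ω ∪ HOArith.QFAC (HOArith.Ty.pure 2) (HOArith.Ty.pure 0) ⊢ₜ
      (HOArith.Exists3 ⋎ HOArith.MUC ⟺ HOArith.Kappa0 ⋏ HOArith.FF)) ∧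
    (HOArith.RCA0ω ⊢ₜ (HOArith.FF ⟺ HOArith.Exists2 ⋎ HOArith.MUC)) ∧
    (HOArith.WKL0ω ∪ HOArith.QFAC (HOArith.Ty.pure 2) (HOArith.Ty.pure 0) ⊢ₜ
      (HOArith.FF ⟺ HOArith.Exists2 ⋎ HOArith.Kappa0)) :=
  ⟨HOArith.proves_kappa0_and_wkl_iff, HOArith.proves_iff_kappa0_and_ff,
    HOArith.proves_ff_iff_exists2_or_muc, HOArith.proves_ff_iff_exists2_or_kappa0⟩
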